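/- Let $0<\alpha<1$ and $\gamma>0$. For $1<r<\alpha^{-1}$ put $$m^*=\frac{\alpha(r-1)}{1-\alpha r},\quad a^*=\frac{1-\alpha r}{r(1-\alpha)},\quad E_*(r)=(m^*,a^*),\quad \delta_0(r)=\frac{1-\alpha r}{1-\alpha},\quad \rho_0(r)=\frac{r(1-\alpha)}{\gamma(r-1)} .$$ Consider the system without diffusion $$m'=rma-\frac{m}{1+m},\qquad \gamma a'=\alpha(1-a)-ma, \tag{1}$$ and, for $d,l>0$, the system with diffusion $$m_t=d\,m_{xx}+rma-\frac{m}{1+m},\qquad \gamma a_t=a_{xx}+\alpha(1-a)-ma\qquad (0<x<l\pi) \tag{2}$$ with homogeneous Neumann boundary conditions. For $n=0,1,2,\dots$ let $$T_n=(1+\gamma d)\frac{n^2}{l^2}+\frac{\alpha}{a^*}-\gamma r^2a^{*2}m^*,\qquad D_n=d\frac{n^4}{l^4}+\Big(\frac{d\alpha}{a^*}-r^2a^{*2}m^*\Big)\frac{n^2}{l^2}+\alpha r(r-1)a^*,$$ so that the characteristic values of (2) at $E_*$ are the roots of $\gamma\lambda^2+T_n\lambda+D_n=0$, $n\ge 0$;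 let $\beta_n(r)$ be the real part of the root $\big(-T_n+\sqrt{T_n^2-4\gamma D_n}\big)/(2\gamma)$. Let $r^*=\frac{1}{4\alpha}\big(\alpha+\sqrt{\alpha^2+8\alpha}\big)$, and let $S=S(\alpha,\gamma,d,l)$ be the set of all $r\in(1,\alpha^{-1})\setminus\{r^*\}$ for which there is an $n\ge 0$ with $T_n(r)=0$, $D_n(r)>0$, $\beta_n'(r)\ne 0$, and $T_j(r)\neq 0$, $D_j(r)\ne 0$ for all $j\ne n$. 1. If $1<r<\alpha^{-1}$ and $\delta_0^2(r)<\rho_0(r)$, then $E_*$ is a locally asymptotically stable equilibrium of (1). 2. If $1<r<\alpha^{-1}$ and $\delta_0^2(r)>\rho_0(r)$, then $E_*$ is an unstable equilibrium of (1). 3. Let $d,l>0$ and let $r_H\in S$ satisfy $\delta_0^2(r_H)=\rho_0(r_H)$. Then (1) undergoes a Hopf bifurcation at $E_*$ for $r=r_H$. That is: for $r$ near $r_H$ the eigenvalues of the linearization of (1) at $E_*(r)$ are $\beta(r)\pm i\omega(r)$, with $\beta,\omega$ continuously differentiable at $r_H$, $\beta(r_H)=0$, $\omega(r_H)>0$,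 $\beta'(r_H)\neq0$. There is a family $(r(s),P(s),u_s)_{0\le s<s_0}$, continuous in $s$ ($u_s(t)$ jointly in $(s,t)$), with $r(0)=r_H$, $P(0)=2\pi/\omega(r_H)$ and $u_0\equiv E_*(r_H)$, such that for $0<s<s_0$ the function $u_s$ is a nonconstant periodic solution of (1) with $r=r(s)$, of minimal period $P(s)$. For some $\eta>0$ every nonconstant periodic solution of (1), with parameter within $\eta$ of $r_H$, that stays within $\eta$ of $E_*(r_H)$ is a time translate of some $u_s$, $0<s<s_0$, with $r(s)$ equal to that parameter. Moreover, (2) undergoes a Hopf bifurcation at $r_H$ to spatially homogeneous periodic solutions: for $r$ near $r_H$ the characteristic values of (2) for $n=0$ are a pair $\beta(r)\pm i\omega(r)$ as above, at $r=r_H$ all characteristic values for $n\ge1$ have nonzero real part, and the members of such a family ($0<s<s_0$), as functions independent of $x$, are positive classical solutions of (2) with $r=r(s)$. 4. The critical curve is given by $\delta_0^2=\rho_0$: if $1<r_H<\alpha^{-1}$ and (1) undergoes a Hopf bifurcation at $E_*$ for $r=r_H$, then $\delta_0^2(r_H)=\rho_0(r_H)$. -/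

import Mathlib

open Set Filter Topology Polynomial

noncomputable section

namespace MusselAlgae

/-! ### Notions for autonomous ordinary differential equations in the plane -/

/-- Lyapunov stability of `p` for `u' = F u`, tested on all solutions on compact intervals
`[0, T]`. -/
def IsLyapunovStable (F : ℝ × ℝ → ℝ × ℝ) (p : ℝ × ℝ) : Prop :=
  ∀ ε > 0, ∃ δ > 0, ∀ (T : ℝ) (u : ℝ → ℝ × ℝ), 0 ≤ T →
    IsIntegralCurveOn u (fun _ => F) (Icc 0 T) → dist (u 0) p < δ →
      ∀ t ∈ Icc 0 T, dist (u t) p < ε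

/-- `p` is an equilibrium that is Lyapunov stable, and every initial value near `p` has a solution
on `[0, ∞)`, all such solutions converging to `p`. -/
def IsLocallyAsymptoticallyStable (F : ℝ × ℝ → ℝ × ℝ) (p : ℝ × ℝ) : Prop :=
  F p = 0 ∧ IsLyapunovStable F p ∧
    ∃ δ > 0, ∀ u₀ : ℝ × ℝ, dist u₀ p < δ →
      (∃ u : ℝ → ℝ × ℝ, u 0 = u₀ ∧ IsIntegralCurveOn u (fun _ => F) (Ici 0)) ∧
      ∀ u : ℝ → ℝ × ℝ, u 0 = u₀ → IsIntegralCurveOn u (fun _ => F) (Ici 0) →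
        Tendsto u atTop (𝓝 p)

/-- `p` is an equilibrium that is not Lyapunov stable. -/
def IsUnstable (F : ℝ × ℝ → ℝ × ℝ) (p : ℝ × ℝ) : Prop :=
  F p = 0 ∧ ¬ IsLyapunovStable F p

/-- `(μ s, P s, u s)`, `0 ≤ s < s₀`, is a continuous family that starts at the equilibrium `p` for
the parameter `μ₀` with `P 0 = P₀`; for `0 < s < s₀`, `u s` is a nonconstant periodic solution of
`u' = F (μ s) u` of minimal period `P s`.  For parameters near `μ₀` there are, near `p`, no
nonconstant periodic solutions other than the time translates of the members of the family. -/
structure IsPeriodicBranch (F : ℝ → ℝ × ℝ → ℝ × ℝ) (p : ℝ × ℝ) (μ₀ P₀ s₀ : ℝ)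
    (μ P : ℝ → ℝ) (u : ℝ → ℝ → ℝ × ℝ) : Prop where
  pos : 0 < s₀
  cont_param : ContinuousOn μ (Ico 0 s₀)
  cont_period : ContinuousOn P (Ico 0 s₀)
  cont_sol : ContinuousOn (fun q : ℝ × ℝ => u q.1 q.2) (Ico 0 s₀ ×ˢ univ)
  param_zero : μ 0 = μ₀
  period_zero : P 0 = P₀
  sol_zero : ∀ t, u 0 t = p
  solves : ∀ s ∈ Ioo 0 s₀, IsIntegralCurve (u s) (fun _ => F (μ s))
  period_pos : ∀ s ∈ Ioo 0 s₀, 0 < P s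
  periodic : ∀ s ∈ Ioo 0 s₀, Function.Periodic (u s) (P s)
  minimal : ∀ s ∈ Ioo 0 s₀, ∀ P' : ℝ, 0 < P' → P' < P s → ¬ Function.Periodic (u s) P'
  complete : ∃ η > 0, ∀ ν : ℝ, |ν - μ₀| < η → ∀ v : ℝ → ℝ × ℝ,
    IsIntegralCurve v (fun _ => F ν) → (∀ t, dist (v t) p < η) →
    (∃ P' > 0, Function.Periodic v P') → (∃ t t', v t ≠ v t') →
      ∃ s ∈ Ioo 0 s₀, μ s = ν ∧ ∃ t₀ : ℝ, ∀ t, v t = u s (t + t₀)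

/-- `β ± i ω` crosses the imaginary axis at `μ₀`, at `± i ω μ₀ ≠ 0`, with nonzero speed. -/
def CrossesImaginaryAxis (β ω : ℝ → ℝ) (μ₀ : ℝ) : Prop :=
  ContDiffAt ℝ 1 β μ₀ ∧ ContDiffAt ℝ 1 ω μ₀ ∧ β μ₀ = 0 ∧ 0 < ω μ₀ ∧ deriv β μ₀ ≠ 0

/-- The conjugate pair `β ± i ω`, as a multiset. -/
def conjPair (β ω : ℝ) : Multiset ℂ :=
  {(β : ℂ) + ω * Complex.I, (β : ℂ) - ω * Complex.I}

/-- The family `u' = F μ u` with equilibria `E μ` undergoes a Hopf bifurcation at `μ₀`: the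
eigenvalues (with multiplicity) of the linearization at `E μ` are a conjugate pair that crosses
the imaginary axis transversally at `μ₀`, and a branch of periodic solutions, of period tending to
`2π / ω μ₀`, bifurcates from `E μ₀`. -/
def IsHopfBifurcation (F : ℝ → ℝ × ℝ → ℝ × ℝ) (E : ℝ → ℝ × ℝ) (μ₀ : ℝ) : Prop :=
  ∃ β ω : ℝ → ℝ, CrossesImaginaryAxis β ω μ₀ ∧
    (∀ᶠ μ in 𝓝 μ₀, F μ (E μ) = 0 ∧
      ((LinearMap.charpoly (fderiv ℝ (F μ) (E μ)).toLinearMap).map (algebraMap ℝ ℂ)).roots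
        = conjPair (β μ) (ω μ)) ∧
    ∃ (s₀ : ℝ) (μ P : ℝ → ℝ) (u : ℝ → ℝ → ℝ × ℝ),
      IsPeriodicBranch F (E μ₀) μ₀ (2 * Real.pi / ω μ₀) s₀ μ P u

/-! ### The mussel-algae system -/

/-- The system without diffusion, `m' = r m a - m / (1 + m)`, `γ a' = α (1 - a) - m a`. -/
def kinetics (α γ r : ℝ) (u : ℝ × ℝ) : ℝ × ℝ :=
  (r * u.1 * u.2 - u.1 / (1 + u.1), (α * (1 - u.2) - u.1 * u.2) / γ)

/-- First component `m^*` of the positive equilibrium. -/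
def mStar (α r : ℝ) : ℝ := α * (r - 1) / (1 - α * r)

/-- Second component `a^*` of the positive equilibrium. -/
def aStar (α r : ℝ) : ℝ := (1 - α * r) / (r * (1 - α))

/-- The positive equilibrium `E_*`. -/
def EStar (α r : ℝ) : ℝ × ℝ := (mStar α r, aStar α r)

def delta0 (α r : ℝ) : ℝ := (1 - α * r) / (1 - α)

def rho0 (α γ r : ℝ) : ℝ := r * (1 - α) / (γ * (r - 1))

/-- Coefficient `T_n` of the `n`-th characteristic equation `γ λ² + T_n λ + D_n = 0` at `E_*` of
the system with diffusion on `(0, lπ)`. -/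
def Tn (α γ d l : ℝ) (n : ℕ) (r : ℝ) : ℝ :=
  (1 + γ * d) * ((n : ℝ) ^ 2 / l ^ 2) + α / aStar α r - γ * r ^ 2 * aStar α r ^ 2 * mStar α r

/-- Coefficient `D_n` of the `n`-th characteristic equation. -/
def Dn (α d l : ℝ) (n : ℕ) (r : ℝ) : ℝ :=
  d * ((n : ℝ) ^ 4 / l ^ 4)
    + (d * α / aStar α r - r ^ 2 * aStar α r ^ 2 * mStar α r) * ((n : ℝ) ^ 2 / l ^ 2)
    + α * r * (r - 1) * aStar α r

/-- The characteristic value `(-T_n + √(T_n² - 4 γ D_n)) / (2γ)`, with the principal complex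
square root. -/
def charValue (α γ d l : ℝ) (n : ℕ) (r : ℝ) : ℂ :=
  (-(Tn α γ d l n r : ℂ)
    + (((Tn α γ d l n r) ^ 2 - 4 * γ * Dn α d l n r : ℝ) : ℂ) ^ (1 / 2 : ℂ)) / (2 * γ)

/-- The point `r^*`, where transversality fails. -/
def rStar (α : ℝ) : ℝ := (α + Real.sqrt (α ^ 2 + 8 * α)) / (4 * α)

/-- The set `S` of candidate Hopf bifurcation points. -/
def hopfSet (α γ d l : ℝ) : Set ℝ :=
  {r | r ∈ Ioo 1 α⁻¹ \ {rStar α} ∧ ∃ n : ℕ,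
    Tn α γ d l n r = 0 ∧ 0 < Dn α d l n r ∧
    deriv (fun r' => (charValue α γ d l n r').re) r ≠ 0 ∧
    ∀ j : ℕ, j ≠ n → Tn α γ d l j r ≠ 0 ∧ Dn α d l j r ≠ 0}

/-- `det (λ Γ + (n²/l²) D - L)` as a polynomial in `λ`, where `Γ = diag(1, γ)`, `D = diag(d, 1)`
and `L` is the linearization of the reaction terms at `E_*`; its roots are the eigenvalues of the
linearized Neumann problem on `(0, lπ)` on the mode `cos (n x / l)`. -/
def modePoly (α γ d l : ℝ) (n : ℕ) (r : ℝ) : ℂ[X] :=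
  let m := mStar α r
  let a := aStar α r
  let k := (n : ℝ) ^ 2 / l ^ 2
  Matrix.det !![X + C ((d * k - (r * a - 1 / (1 + m) ^ 2) : ℝ) : ℂ), C ((-(r * m) : ℝ) : ℂ);
    C (a : ℂ), C (γ : ℂ) * X + C ((k + (α + m) : ℝ) : ℂ)]

/-- `(m, a)`, functions of `x ∈ [0, lπ]` and `t ∈ ℝ`, is a positive classical solution of
`m_t = d m_xx + r m a - m / (1 + m)`, `γ a_t = a_xx + α (1 - a) - m a` with homogeneous Neumann
boundary conditions.  Here `mx, mxx, ax, axx` are the spatial derivatives. -/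
def IsDiffusiveSolution (α γ d l r : ℝ) (m a : ℝ → ℝ → ℝ) : Prop :=
  ∃ mx mxx ax axx : ℝ → ℝ → ℝ,
    ContinuousOn (fun q : ℝ × ℝ => mxx q.1 q.2) (Icc 0 (l * Real.pi) ×ˢ univ) ∧
    ContinuousOn (fun q : ℝ × ℝ => axx q.1 q.2) (Icc 0 (l * Real.pi) ×ˢ univ) ∧
    (∀ x ∈ Icc 0 (l * Real.pi), ∀ t : ℝ,
      HasDerivWithinAt (fun y => m y t) (mx x t) (Icc 0 (l * Real.pi)) x ∧
      HasDerivWithinAt (fun y => mx y t) (mxx x t) (Icc 0 (l * Real.pi)) x ∧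
      HasDerivWithinAt (fun y => a y t) (ax x t) (Icc 0 (l * Real.pi)) x ∧
      HasDerivWithinAt (fun y => ax y t) (axx x t) (Icc 0 (l * Real.pi)) x ∧
      0 < m x t ∧ 0 < a x t ∧
      HasDerivAt (fun τ => m x τ)
        (d * mxx x t + r * m x t * a x t - m x t / (1 + m x t)) t ∧
      HasDerivAt (fun τ => a x τ)
        ((axx x t + α * (1 - a x t) - m x t * a x t) / γ) t) ∧
    ∀ t : ℝ, mx 0 t = 0 ∧ mx (l * Real.pi) t = 0 ∧ ax 0 t = 0 ∧ ax (l * Real.pi) t = 0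

/-- The system with diffusion undergoes at `rH` a Hopf bifurcation to spatially homogeneous
periodic solutions: the characteristic values of the spatially constant mode are a conjugate pair
crossing the imaginary axis transversally, at `rH` all characteristic values of the other modes
have nonzero real parts, and the periodic solutions of the system without diffusion that
bifurcate from `E_*` are, as functions independent of `x`, positive solutions of the system with
diffusion. -/
def IsHomogeneousHopfBifurcation (α γ d l rH : ℝ) : Prop :=
  ∃ β ω : ℝ → ℝ, CrossesImaginaryAxis β ω rH ∧
    (∀ᶠ r in 𝓝 rH, (modePoly α γ d l 0 r).roots = conjPair (β r) (ω r)) ∧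
    (∀ n : ℕ, n ≠ 0 → ∀ z ∈ (modePoly α γ d l n rH).roots, z.re ≠ 0) ∧
    ∃ (s₀ : ℝ) (r P : ℝ → ℝ) (u : ℝ → ℝ → ℝ × ℝ),
      IsPeriodicBranch (kinetics α γ) (EStar α rH) rH (2 * Real.pi / ω rH) s₀ r P u ∧
      ∀ s ∈ Ioo 0 s₀, IsDiffusiveSolution α γ d l (r s)
        (fun _ t => (u s t).1) (fun _ t => (u s t).2)

end MusselAlgae

end

/-! At `E_*` the Jacobian has trace m*(δ₀² - ρ₀) and determinant αr(r-1)a*/γ > 0, so the sign of δ₀²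
- ρ₀ decides everything. For a planar linear map A with determinant Δ > 0, the form |adj(A)v|² +
Δ|v|² has derivative 2Δ tr(A)|v|² along v' = Av, because adj(A)A = Δ and A + adj(A) = tr(A). It is
therefore a Lyapunov function in both the stable and the unstable case (`exists_lyapunov_function`).

The Hopf theorem is proved directly. A shear depending on the parameter ν turns the linear part into
multiplication by β + iω, and polar coordinates give ρ' = ρA, θ' = Θ with A = β and Θ = ω at ρ = 0.
Taking the angle as independent variable and y = log ρ as unknown gives dy/dθ = A/Θ. An orbit
through log s at angle 0 closes up iff its displacement g(s, ν) after one turn vanishes. For small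
s, g(s, ν) is close to 2πD(ν - μ₀) with D = β'/ω, and ν ↦ g(s, ν) expands distances by at least
π|D|/2. The intermediate value theorem then yields exactly one ν = r(s), and the expansion makes r
continuous (`exists_closed_orbits`). Integrating 1/Θ over the closed orbit restores time and gives
the period.

Completeness of the branch: a small nonconstant periodic solution never meets the equilibrium, so it
has a continuous logarithm whose imaginary part, the angle, increases strictly. Over a period it
makes some number of turns. The return map is monotone in y, so the orbit already closes after one
turn and belongs to the branch.

On the critical curve T₀ = 0, and the definition of S allows no second mode with T_j = 0. Hence the
critical mode is n = 0, transversality of `charValue` is transversality of the trace, and the other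
modes have T_j, D_j ≠ 0 and so no imaginary roots. Conversely, a root iω ≠ 0 of a real monic
quadratic forces the trace to vanish. -/

open scoped NNReal

noncomputable section

namespace MusselAlgae

/-! ### Ordinary differential equations -/

section ODE

variable {E : Type*} [NormedAddCommGroup E] [NormedSpace ℝ E]

/-- A bounded vector field that is Lipschitz in space and continuous in time has global integral
curves. -/
theorem exists_isIntegralCurve_of_bounded [CompleteSpace E] {f : ℝ → E → E} {K M : ℝ≥0}
    (hlip : ∀ t, LipschitzWith K (f t)) (hcont : ∀ x, Continuous (f · x))
    (hM : ∀ t x, ‖f t x‖ ≤ M) (t₀ : ℝ) (x₀ : E) :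
    ∃ u : ℝ → E, u t₀ = x₀ ∧ IsIntegralCurve u f := by
  have loc : ∀ n : ℕ, ∃ u : ℝ → E, u t₀ = x₀ ∧
      ∀ t ∈ Icc (t₀ - (n + 1)) (t₀ + (n + 1)),
        HasDerivWithinAt u (f t (u t)) (Icc (t₀ - (n + 1)) (t₀ + (n + 1))) t := by
    intro n
    have hn : (0 : ℝ) ≤ n := n.cast_nonneg
    have hmem : t₀ ∈ Icc (t₀ - ((n : ℝ) + 1)) (t₀ + (n + 1)) := ⟨by linarith, by linarith⟩
    -- Since the field is bounded by `M`, no solution leaves the ball of radius M(n+1) within time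
    -- n+1, so the time interval need not be shrunk.
    have hPL : IsPicardLindelof f (⟨t₀, hmem⟩ : Icc (t₀ - ((n : ℝ) + 1)) (t₀ + (n + 1))) x₀
        (M * (n + 1)) 0 M K :=
      { lipschitzOnWith := fun t _ => (hlip t).lipschitzOnWith
        continuousOn := fun x _ => (hcont x).continuousOn
        norm_le := fun t _ x _ => hM t x
        mul_max_le := by simp }
    exact hPL.exists_eq_forall_mem_Icc_hasDerivWithinAt₀
  choose U hU0 hU using loc
  have hd : ∀ n : ℕ, ∀ t ∈ Ioo (t₀ - ((n : ℝ) + 1)) (t₀ + (n + 1)),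
      HasDerivAt (U n) (f t (U n t)) t := fun n t ht =>
    (hU n t (Ioo_subset_Icc_self ht)).hasDerivAt (Icc_mem_nhds ht.1 ht.2)
  have agree : ∀ n m : ℕ, n ≤ m → ∀ t ∈ Ioo (t₀ - ((n : ℝ) + 1)) (t₀ + (n + 1)),
      U n t = U m t := by
    intro n m hnm t ht
    have hnm' : (n : ℝ) ≤ m := by exact_mod_cast hnm
    have hn : (0 : ℝ) ≤ n := n.cast_nonneg
    refine ODE_solution_unique_of_mem_Ioo (v := f) (s := fun _ => univ) (K := K) (t₀ := t₀)
      (fun t _ => (hlip t).lipschitzOnWith) ⟨by linarith, by linarith⟩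
      (fun t ht => ⟨hd n t ht, trivial⟩) (fun t ht => ⟨hd m t ⟨?_, ?_⟩, trivial⟩)
      (by rw [hU0, hU0]) ht
    · linarith [ht.1]
    · linarith [ht.2]
  -- `U n` is a solution up to distance n + 1 from `t₀`, so `t` is interior for the index used. The
  -- index jumps with `t`, but near each `t` the glued function agrees with one fixed `U`.
  refine ⟨fun t => U ⌈|t - t₀|⌉₊ t, by simp [hU0], fun t => ?_⟩
  have key : ∀ᶠ τ in 𝓝 t, U ⌈|τ - t₀|⌉₊ τ = U (⌈|t - t₀|⌉₊ + 1) τ := by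
    have h1 : ∀ᶠ τ in 𝓝 t, |τ - t₀| < |t - t₀| + 1 :=
      (Continuous.tendsto (by fun_prop) t).eventually_lt_const (by simp)
    filter_upwards [h1] with τ hτ
    apply agree
    · apply Nat.ceil_le.2
      push_cast
      linarith [Nat.le_ceil |t - t₀|]
    · have := Nat.le_ceil |τ - t₀|
      have h2 := abs_lt.1 (lt_of_le_of_lt this (lt_add_one _))
      constructor <;> linarith [h2.1, h2.2]
  have hval := key.self_of_nhds
  have := hd (⌈|t - t₀|⌉₊ + 1) t (by
    have := Nat.le_ceil |t - t₀|
    have h2 := abs_lt.1 (lt_of_le_of_lt this (lt_add_one _))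
    push_cast
    constructor <;> linarith [h2.1, h2.2])
  simp only [hval]
  exact this.congr_of_eventuallyEq key

/-- Grönwall's inequality for an exact and an approximate trajectory, in both time directions. -/
theorem dist_le_gronwallBound_abs {v : ℝ → E → E} {K : ℝ≥0} {f g g' : ℝ → E} {ε : ℝ}
    (hv : ∀ t, LipschitzWith K (v t)) (hf : IsIntegralCurve f v)
    (hg : ∀ t, HasDerivAt g (g' t) t) (hε : ∀ t, dist (g' t) (v t (g t)) ≤ ε) (t₀ t : ℝ) :
    dist (f t) (g t) ≤ gronwallBound (dist (f t₀) (g t₀)) K ε |t - t₀| := by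
  have fwd : ∀ (v : ℝ → E → E) (f g g' : ℝ → E), (∀ t, LipschitzWith K (v t)) →
      IsIntegralCurve f v → (∀ t, HasDerivAt g (g' t) t) → (∀ t, dist (g' t) (v t (g t)) ≤ ε) →
      ∀ t₀ t, t₀ ≤ t → dist (f t) (g t) ≤ gronwallBound (dist (f t₀) (g t₀)) K ε (t - t₀) := by
    intro v f g g' hv hf hg hε t₀ t ht
    have := dist_le_of_approx_trajectories_ODE (a := t₀) (b := t) (εf := 0) (εg := ε) hv
      (fun x _ => (hf x).continuousAt.continuousWithinAt) (fun x _ => (hf x).hasDerivWithinAt)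
      (fun x _ => by simp) (fun x _ => (hg x).continuousAt.continuousWithinAt)
      (fun x _ => (hg x).hasDerivWithinAt) (fun x _ => hε x) le_rfl t ⟨ht, le_rfl⟩
    simpa using this
  rcases le_total t₀ t with h | h
  · rw [abs_of_nonneg (by linarith)]
    exact fwd v f g g' hv hf hg hε t₀ t h
  · rw [abs_of_nonpos (by linarith)]
    have := fwd (fun t x => - v (-t) x) (fun t => f (-t)) (fun t => g (-t)) (fun t => - g' (-t))
      (fun t => (hv (-t)).neg)
      (fun t => by simpa [Function.comp_def] using (hf (-t)).scomp t (hasDerivAt_neg t))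
      (fun t => by simpa [Function.comp_def] using (hg (-t)).scomp t (hasDerivAt_neg t))
      (fun t => by simpa using hε (-t)) (-t₀) (-t) (by linarith)
    simpa [add_comm, sub_eq_add_neg] using this

/-- From e^z - 1 ≤ z e^z. The bound is linear in ε and needs no case distinction at K = 0. -/
theorem gronwallBound_zero_left_le {K ε x : ℝ} (hK : 0 ≤ K) (hε : 0 ≤ ε) :
    gronwallBound 0 K ε x ≤ ε * (x * Real.exp (K * x)) := by
  rcases eq_or_lt_of_le hK with rfl | hK
  · simp [gronwallBound_K0]
  · rw [gronwallBound_of_K_ne_0 hK.ne']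
    have h1 : Real.exp (K * x) - 1 ≤ K * x * Real.exp (K * x) := by
      have := Real.add_one_le_exp (-(K * x))
      have h2 : Real.exp (-(K * x)) * Real.exp (K * x) = 1 := by
        rw [← Real.exp_add]; simp
      nlinarith [Real.exp_pos (K * x)]
    calc 0 * Real.exp (K * x) + ε / K * (Real.exp (K * x) - 1)
        ≤ ε / K * (K * x * Real.exp (K * x)) := by
          rw [zero_mul, zero_add]; gcongr
      _ = ε * (x * Real.exp (K * x)) := by field_simp

end ODE

/-- Continuation principle: a continuous function that is `< R` as long as it was `≤ R` before,
stays `< R`. -/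
theorem lt_of_continuation {f : ℝ → ℝ} {R T : ℝ} (hf : ContinuousOn f (Icc 0 T)) (h0 : f 0 < R)
    (h : ∀ t ∈ Icc 0 T, (∀ s ∈ Icc 0 t, f s ≤ R) → f t < R) : ∀ t ∈ Icc 0 T, f t < R := by
  by_contra! hne
  obtain ⟨t₁, ht₁, hR⟩ := hne
  have hcl : IsClosed (Icc 0 T ∩ f ⁻¹' Ici R) := hf.preimage_isClosed_of_isClosed isClosed_Icc isClosed_Ici
  have hbdd : BddBelow (Icc 0 T ∩ f ⁻¹' Ici R) := ⟨0, fun x hx => hx.1.1⟩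
  obtain ⟨hm, hmR⟩ := hcl.csInf_mem ⟨t₁, ht₁, hR⟩ hbdd
  -- The first time at which `f` reaches `R`; up to and including it `f ≤ R`, so the hypothesis
  -- applies there.
  set m := sInf (Icc 0 T ∩ f ⁻¹' Ici R)
  have hlt : ∀ s ∈ Ico 0 m, f s < R := fun s hs => by
    by_contra! hs'
    exact absurd (csInf_le hbdd ⟨⟨hs.1, hs.2.le.trans hm.2⟩, hs'⟩) (not_le.2 hs.2)
  have hm0 : 0 < m := by
    rcases hm.1.eq_or_lt with h' | h'
    · rw [mem_preimage, ← h'] at hmR; exact absurd h0 (not_lt.2 hmR)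
    · exact h'
  have hle : f m ≤ R := by
    have hc : ContinuousWithinAt f (Ico 0 m) m :=
      (hf m hm).mono fun s hs => ⟨hs.1, hs.2.le.trans hm.2⟩
    have : (𝓝[Ico 0 m] m).NeBot := by
      rw [← mem_closure_iff_nhdsWithin_neBot, closure_Ico hm0.ne]; exact ⟨hm0.le, le_rfl⟩
    exact le_of_tendsto hc (eventually_mem_nhdsWithin.mono fun s hs => (hlt s hs).le)
  have := h m hm fun s hs => by
    rcases hs.2.eq_or_lt with rfl | h'
    · exact hle
    · exact (hlt s ⟨hs.1, h'⟩).le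
  exact absurd this (not_lt.2 hmR)

/-- Inverting a continuous family of functions whose derivatives are bounded below. -/
theorem exists_continuous_inverse_family {X : Type*} [TopologicalSpace X] {T τ : X → ℝ → ℝ} {κ : ℝ}
    (hκ : 0 < κ) (hT : Continuous fun q : X × ℝ => T q.1 q.2)
    (hd : ∀ x φ, HasDerivAt (T x) (τ x φ) φ) (hτ : ∀ x φ, κ ≤ τ x φ) :
    ∃ ϑ : X → ℝ → ℝ, (Continuous fun q : X × ℝ => ϑ q.1 q.2) ∧ (∀ x t, T x (ϑ x t) = t) ∧
      (∀ x φ, ϑ x (T x φ) = φ) ∧ (∀ x, StrictMono (ϑ x)) ∧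
      ∀ x t, HasDerivAt (ϑ x) (τ x (ϑ x t))⁻¹ t := by
  have expand : ∀ x φ ψ, φ ≤ ψ → κ * (ψ - φ) ≤ T x ψ - T x φ := by
    intro x φ ψ h
    refine Convex.mul_sub_le_image_sub_of_le_deriv convex_univ
      (fun y _ => (hd x y).continuousAt.continuousWithinAt)
      (fun y _ => (hd x y).differentiableAt.differentiableWithinAt)
      (fun y _ => by rw [(hd x y).deriv]; exact hτ x y) φ trivial ψ trivial h
  have expand' : ∀ x φ ψ, κ * |ψ - φ| ≤ |T x ψ - T x φ| := by
    intro x φ ψ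
    rcases le_total φ ψ with h | h
    · rw [abs_of_nonneg (by linarith)]
      exact (expand x φ ψ h).trans (le_abs_self _)
    · rw [abs_sub_comm, abs_sub_comm (T x ψ), abs_of_nonneg (by linarith)]
      exact (expand x ψ φ h).trans (le_abs_self _)
  have hmono : ∀ x, StrictMono (T x) := fun x φ ψ h => by
    have := expand x φ ψ h.le
    nlinarith
  have hcont : ∀ x, Continuous (T x) := fun x => by fun_prop
  have hsurj : ∀ x, Function.Surjective (T x) := fun x => by
    refine (hcont x).surjective ?_ ?_
    · refine tendsto_atTop_mono' atTop (f₁ := fun φ => T x 0 + κ * φ) ?_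
        (tendsto_atTop_add_const_left _ _ (tendsto_id.const_mul_atTop hκ))
      filter_upwards [eventually_ge_atTop 0] with φ hφ
      have := expand x 0 φ hφ
      linarith
    · have hlim : Tendsto (fun φ => T x 0 + κ * φ) atBot atBot :=
        tendsto_atBot_add_const_left _ _ (tendsto_id.const_mul_atBot hκ)
      refine tendsto_atBot_mono' atBot ?_ hlim
      filter_upwards [eventually_le_atBot 0] with φ hφ
      have := expand x φ 0 hφ
      linarith
  choose ϑ hϑ using hsurj
  have hinv : ∀ x φ, ϑ x (T x φ) = φ := fun x φ => (hmono x).injective (hϑ x _)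
  have hc : Continuous fun q : X × ℝ => ϑ q.1 q.2 := by
    rw [continuous_iff_continuousAt]
    rintro ⟨x₀, t₀⟩
    rw [ContinuousAt, tendsto_iff_dist_tendsto_zero]
    -- With φ₀ = ϑ x₀ t₀ fixed, expansion gives |ϑ x t - φ₀| ≤ κ⁻¹ |t - T x φ₀|, and the right side
    -- is jointly continuous and vanishes at (x₀, t₀).
    have hlim : Tendsto (fun q : X × ℝ => κ⁻¹ * |q.2 - T q.1 (ϑ x₀ t₀)|) (𝓝 (x₀, t₀)) (𝓝 0) := by
      have : Continuous fun q : X × ℝ => κ⁻¹ * |q.2 - T q.1 (ϑ x₀ t₀)| := by fun_prop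
      simpa [hϑ] using this.tendsto (x₀, t₀)
    refine squeeze_zero (fun _ => dist_nonneg) (fun q => ?_) hlim
    have := expand' q.1 (ϑ x₀ t₀) (ϑ q.1 q.2)
    rw [hϑ] at this
    rw [Real.dist_eq, inv_mul_eq_div, le_div_iff₀ hκ, mul_comm]
    exact this
  refine ⟨ϑ, hc, hϑ, hinv, fun x t t' h => ?_, fun x t => ?_⟩
  · by_contra! h'
    have := (hmono x).monotone h'
    rw [hϑ, hϑ] at this
    linarith
  · exact (hd x (ϑ x t)).of_local_left_inverse (by fun_prop)
      (hκ.trans_le (hτ x _)).ne' (Eventually.of_forall fun y => hϑ x y)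

/-- Logarithm of a nonvanishing curve `z` in the plane with `z' = z q`. -/
theorem exists_log_of_hasDerivAt_mul {z q : ℝ → ℂ} (hq : Continuous q)
    (hz : ∀ t, HasDerivAt z (z t * q t) t) (h0 : z 0 ≠ 0) :
    ∃ w : ℝ → ℂ, (∀ t, HasDerivAt w (q t) t) ∧ ∀ t, z t = Complex.exp (w t) := by
  have hw : ∀ t, HasDerivAt (fun t => Complex.log (z 0) + ∫ x in (0 : ℝ)..t, q x) (q t) t :=
    fun t => (intervalIntegral.integral_hasDerivAt_right (hq.intervalIntegrable _ _)
      hq.aestronglyMeasurable.stronglyMeasurableAtFilter hq.continuousAt).const_add _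
  refine ⟨_, hw, fun t => ?_⟩
  set w := fun t => Complex.log (z 0) + ∫ x in (0 : ℝ)..t, q x
  have hconst : ∀ t, HasDerivAt (fun t => z t * Complex.exp (-w t)) 0 t := fun t => by
    exact ((hz t).mul (hw t).neg.cexp).congr_deriv (by simp only [Pi.neg_apply]; ring)
  have h1 := is_const_of_deriv_eq_zero (fun t => (hconst t).differentiableAt)
    (fun t => (hconst t).deriv) t 0
  have h2 : z 0 * Complex.exp (-w 0) = 1 := by
    simp [w, Complex.exp_neg, Complex.exp_log h0, h0]
  rw [h2, Complex.exp_neg] at h1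
  field_simp [Complex.exp_ne_zero] at h1
  exact h1

/-! ### Stability of equilibria in the plane by the linearization -/

/-- A quadratic Lyapunov function for a planar equilibrium with nonzero trace and positive
determinant; `σ = ± 1` is the sign of the trace. -/
theorem exists_lyapunov_function {F : ℝ × ℝ → ℝ × ℝ} {p : ℝ × ℝ} {F' : ℝ × ℝ →L[ℝ] ℝ × ℝ}
    {a b c d σ : ℝ} (hp : F p = 0) (hF : HasFDerivAt F F' p)
    (hF' : ∀ v, F' v = (a * v.1 + b * v.2, c * v.1 + d * v.2)) (hσ : σ ^ 2 = 1)
    (htr : 0 < σ * (a + d)) (hdet : 0 < a * d - b * c) :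
    ∃ (Q : ℝ × ℝ → ℝ) (Q' : ℝ × ℝ → ℝ × ℝ →L[ℝ] ℝ) (m N κ R : ℝ), 0 < m ∧ 0 < N ∧ 0 < κ ∧ 0 < R ∧
      (∀ v, HasFDerivAt Q (Q' v) v) ∧ (∀ v, m * ‖v‖ ^ 2 ≤ Q v) ∧ (∀ v, Q v ≤ N * ‖v‖ ^ 2) ∧
      ∀ q, dist q p ≤ R → κ * Q (q - p) ≤ σ * Q' (q - p) (F q) := by
  set Δ := a * d - b * c with hΔ
  -- In the sup norm, `C` bounds the bilinear form (v, e) ↦ Q'(v)e and `N` bounds the quadratic form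
  -- Q.
  set C := 2 * (|d| + |b|) ^ 2 + 2 * (|a| + |c|) ^ 2 + 4 * Δ with hC
  set N := (|d| + |b|) ^ 2 + (|a| + |c|) ^ 2 + 2 * Δ with hN
  have hCpos : 0 < C := by positivity
  have hNpos : 0 < N := by positivity
  have hx : ∀ v : ℝ × ℝ, |v.1| ≤ ‖v‖ := fun v => norm_fst_le v
  have hy : ∀ v : ℝ × ℝ, |v.2| ≤ ‖v‖ := fun v => norm_snd_le v
  have hsq : ∀ v : ℝ × ℝ, ‖v‖ ^ 2 ≤ v.1 ^ 2 + v.2 ^ 2 := fun v => by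
    rw [Prod.norm_def]
    rcases max_cases ‖v.1‖ ‖v.2‖ with h | h <;> rw [h.1, Real.norm_eq_abs, sq_abs] <;> nlinarith
  have hlin : ∀ (k l : ℝ) (v : ℝ × ℝ), |k * v.1 + l * v.2| ≤ (|k| + |l|) * ‖v‖ := fun k l v => by
    refine (abs_add_le _ _).trans ?_
    rw [abs_mul, abs_mul, add_mul]
    exact add_le_add (mul_le_mul_of_nonneg_left (hx v) (abs_nonneg _))
      (mul_le_mul_of_nonneg_left (hy v) (abs_nonneg _))
  let fs := ContinuousLinearMap.fst ℝ ℝ ℝ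
  let sn := ContinuousLinearMap.snd ℝ ℝ ℝ
  -- This is |adj(A)v|² + Δ|v|². Along Av its derivative is 2Δ⟨v, (A + adj(A))v⟩ = 2Δ tr(A)|v|².
  refine ⟨fun v => (d * v.1 + (-b) * v.2) ^ 2 + ((-c) * v.1 + a * v.2) ^ 2 + Δ * (v.1 ^ 2 + v.2 ^ 2),
    fun v => (2 * (d * v.1 + (-b) * v.2)) • (d • fs + (-b) • sn) +
      (2 * ((-c) * v.1 + a * v.2)) • ((-c) • fs + a • sn) + (2 * Δ) • (v.1 • fs + v.2 • sn),
    Δ, N, σ * (a + d) * Δ / N, ?_⟩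
  -- With this bound on the nonlinear remainder, the perturbation uses up at most half of the
  -- leading term 2σ tr(A)Δ|v|².
  have hsmall : 0 < σ * (a + d) * Δ / C := by positivity
  have hlittle := (hasFDerivAt_iff_isLittleO.1 hF).def hsmall
  obtain ⟨R, hR, hRF⟩ := Metric.eventually_nhds_iff_ball.1 hlittle
  have hupper : ∀ v : ℝ × ℝ, (d * v.1 + (-b) * v.2) ^ 2 + ((-c) * v.1 + a * v.2) ^ 2 +
      Δ * (v.1 ^ 2 + v.2 ^ 2) ≤ N * ‖v‖ ^ 2 := fun v => by
    have h1 := sq_le_sq' (abs_le.1 (hlin d (-b) v)).1 (abs_le.1 (hlin d (-b) v)).2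
    have h2 := sq_le_sq' (abs_le.1 (hlin (-c) a v)).1 (abs_le.1 (hlin (-c) a v)).2
    have h3 := sq_le_sq' (abs_le.1 (hx v)).1 (abs_le.1 (hx v)).2
    have h4 := sq_le_sq' (abs_le.1 (hy v)).1 (abs_le.1 (hy v)).2
    rw [abs_neg] at h1 h2
    nlinarith
  refine ⟨R / 2, hdet, hNpos, by positivity, by positivity, fun v => ?_, fun v => ?_, hupper,
    fun q hq => ?_⟩
  · have hf : HasFDerivAt (fun v : ℝ × ℝ => v.1) fs v := hasFDerivAt_fst
    have hs : HasFDerivAt (fun v : ℝ × ℝ => v.2) sn v := hasFDerivAt_snd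
    refine (((((hf.const_mul d).add (hs.const_mul (-b))).pow 2).add
      (((hf.const_mul (-c)).add (hs.const_mul a)).pow 2)).add
      (((hf.pow 2).add (hs.pow 2)).const_mul Δ)).congr_fderiv ?_
    ext <;> simp [fs, sn] <;> ring
  · have := hsq v
    nlinarith [sq_nonneg (d * v.1 + (-b) * v.2), sq_nonneg ((-c) * v.1 + a * v.2)]
  · have hq' := hRF q (by rw [Metric.mem_ball]; linarith)
    set v := q - p with hv
    rw [hp, sub_zero, hF'] at hq'
    set e := F q - (a * v.1 + b * v.2, c * v.1 + d * v.2) with he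
    have hFq : F q = (a * v.1 + b * v.2 + e.1, c * v.1 + d * v.2 + e.2) := by
      simp [he]
    rw [hFq]
    simp only [fs, sn, add_apply, smul_apply,
      ContinuousLinearMap.coe_fst', ContinuousLinearMap.coe_snd', smul_eq_mul]
    have hσ1 : |σ| = 1 := by rw [← Real.sqrt_sq_eq_abs, hσ, Real.sqrt_one]
    set r := 2 * (d * v.1 + (-b) * v.2) * (d * e.1 + (-b) * e.2) +
      2 * ((-c) * v.1 + a * v.2) * ((-c) * e.1 + a * e.2) +
      2 * Δ * (v.1 * e.1 + v.2 * e.2) with hr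
    have hrb : |r| ≤ C * (‖v‖ * ‖e‖) := by
      have k1 : |2 * (d * v.1 + (-b) * v.2) * (d * e.1 + (-b) * e.2)| ≤
          2 * (((|d| + |b|) * ‖v‖) * ((|d| + |b|) * ‖e‖)) := by
        rw [abs_mul, abs_mul, abs_two, mul_assoc]
        have h1 := hlin d (-b) v
        have h2 := hlin d (-b) e
        rw [abs_neg] at h1 h2
        gcongr
      have k2 : |2 * ((-c) * v.1 + a * v.2) * ((-c) * e.1 + a * e.2)| ≤
          2 * (((|c| + |a|) * ‖v‖) * ((|c| + |a|) * ‖e‖)) := by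
        rw [abs_mul, abs_mul, abs_two, mul_assoc]
        have h1 := hlin (-c) a v
        have h2 := hlin (-c) a e
        rw [abs_neg] at h1 h2
        gcongr
      have k3 : |2 * Δ * (v.1 * e.1 + v.2 * e.2)| ≤ 2 * Δ * (‖v‖ * ‖e‖ + ‖v‖ * ‖e‖) := by
        rw [abs_mul, abs_of_pos (by positivity : 0 < 2 * Δ)]
        refine mul_le_mul_of_nonneg_left ((abs_add_le _ _).trans ?_) (by positivity)
        rw [abs_mul, abs_mul]
        exact add_le_add (mul_le_mul (hx v) (hx e) (abs_nonneg _) (norm_nonneg _))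
          (mul_le_mul (hy v) (hy e) (abs_nonneg _) (norm_nonneg _))
      calc |r| ≤ _ := (abs_add_le _ _).trans (add_le_add_left (abs_add_le _ _) _)
        _ ≤ _ := add_le_add (add_le_add k1 k2) k3
        _ = C * (‖v‖ * ‖e‖) := by rw [hC]; ring
    have hrb' : |σ * r| ≤ σ * (a + d) * Δ * ‖v‖ ^ 2 := by
      rw [abs_mul, hσ1, one_mul]
      refine hrb.trans ?_
      calc C * (‖v‖ * ‖e‖) ≤ C * (‖v‖ * (σ * (a + d) * Δ / C * ‖v‖)) := by gcongr
        _ = _ := by field_simp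
    have hmain : σ * ((2 * (d * v.1 + (-b) * v.2) *
        (d * (a * v.1 + b * v.2 + e.1) + (-b) * (c * v.1 + d * v.2 + e.2)) +
      2 * ((-c) * v.1 + a * v.2) *
        ((-c) * (a * v.1 + b * v.2 + e.1) + a * (c * v.1 + d * v.2 + e.2)) +
      2 * Δ * (v.1 * (a * v.1 + b * v.2 + e.1) + v.2 * (c * v.1 + d * v.2 + e.2)))) =
        2 * (σ * (a + d) * Δ) * (v.1 ^ 2 + v.2 ^ 2) + σ * r := by
      rw [hr, hΔ]; ring
    rw [hmain]
    have h5 : σ * (a + d) * Δ / N * ((d * v.1 + (-b) * v.2) ^ 2 + ((-c) * v.1 + a * v.2) ^ 2 +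
        Δ * (v.1 ^ 2 + v.2 ^ 2)) ≤ σ * (a + d) * Δ * ‖v‖ ^ 2 := by
      calc _ ≤ σ * (a + d) * Δ / N * (N * ‖v‖ ^ 2) := by gcongr; exact hupper v
        _ = _ := by field_simp
    have h6 := (abs_le.1 hrb').1
    have h7 : σ * (a + d) * Δ * ‖v‖ ^ 2 ≤ σ * (a + d) * Δ * (v.1 ^ 2 + v.2 ^ 2) := by
      gcongr; exact hsq v
    linarith

/-- Exponential growth (`σ = 1`) or decay (`σ = -1`) of a Lyapunov function along a solution. -/
theorem lyapunov_along_solution {F : ℝ × ℝ → ℝ × ℝ} {p : ℝ × ℝ} {Q : ℝ × ℝ → ℝ}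
    {Q' : ℝ × ℝ → ℝ × ℝ →L[ℝ] ℝ} {κ σ R T : ℝ} (hσ : σ ^ 2 = 1)
    (hQ : ∀ v, HasFDerivAt Q (Q' v) v)
    (hQF : ∀ q, dist q p ≤ R → κ * Q (q - p) ≤ σ * Q' (q - p) (F q)) {u : ℝ → ℝ × ℝ}
    (hu : IsIntegralCurveOn u (fun _ => F) (Icc 0 T)) (hR : ∀ t ∈ Icc 0 T, dist (u t) p ≤ R) :
    ∀ t ∈ Icc 0 T, σ * Q (u 0 - p) ≤ σ * (Real.exp (-(σ * κ * t)) * Q (u t - p)) := by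
  have hd : ∀ t ∈ Icc 0 T, HasDerivWithinAt
      (fun t => σ * (Real.exp (-(σ * κ * t)) * Q (u t - p)))
      (Real.exp (-(σ * κ * t)) * (σ * Q' (u t - p) (F (u t)) - κ * Q (u t - p))) (Icc 0 T) t := by
    intro t ht
    have h1 := (hQ (u t - p)).comp_hasDerivWithinAt t ((hu t ht).sub_const p)
    have h2 : HasDerivWithinAt (fun t => Real.exp (-(σ * κ * t)))
        (Real.exp (-(σ * κ * t)) * (-(σ * κ * 1))) (Icc 0 T) t :=
      (((hasDerivWithinAt_id t _).const_mul (σ * κ)).neg).exp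
    refine ((h2.mul h1).const_mul σ).congr_deriv ?_
    simp only [Function.comp_apply]
    linear_combination (-κ * Real.exp (-(σ * κ * t)) * Q (u t - p)) * hσ
  have hmono : MonotoneOn (fun t => σ * (Real.exp (-(σ * κ * t)) * Q (u t - p))) (Icc 0 T) := by
    refine monotoneOn_of_hasDerivWithinAt_nonneg (convex_Icc 0 T)
      (fun t ht => (hd t ht).continuousWithinAt)
      (fun t ht => (hd t (interior_subset ht)).mono interior_subset) fun t ht => ?_
    have := hQF _ (hR t (interior_subset ht))
    have := Real.exp_pos (-(σ * κ * t))
    nlinarith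
  intro t ht
  have := hmono ⟨le_rfl, ht.1.trans ht.2⟩ ht ht.1
  simpa using this

/-- A vector field that is `C¹` near `p` agrees near `p` with one that has global solutions. -/
theorem exists_global_solution_of_contDiffAt {F : ℝ × ℝ → ℝ × ℝ} {p : ℝ × ℝ}
    (hF : ContDiffAt ℝ 1 F p) :
    ∃ R > 0, ∃ G : ℝ × ℝ → ℝ × ℝ, (∀ q, dist q p ≤ R → G q = F q) ∧
      ∀ u₀, ∃ u : ℝ → ℝ × ℝ, u 0 = u₀ ∧ IsIntegralCurve u (fun _ => G) := by
  obtain ⟨K, s, hs, hK⟩ := hF.exists_lipschitzOnWith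
  obtain ⟨R, hR, hRs⟩ := Metric.nhds_basis_closedBall.mem_iff.1 hs
  -- Coordinatewise clamping: a 1-Lipschitz retraction onto the closed ball, which is a square in
  -- the sup norm. Composing with it makes `F` globally Lipschitz and bounded.
  let π : ℝ × ℝ → ℝ × ℝ := fun q =>
    (max (p.1 - R) (min (p.1 + R) q.1), max (p.2 - R) (min (p.2 + R) q.2))
  have hπ : LipschitzWith 1 π := by
    have := ((LipschitzWith.prod_fst (α := ℝ) (β := ℝ)).const_min (p.1 + R)).const_max (p.1 - R)
    have h2 := ((LipschitzWith.prod_snd (α := ℝ) (β := ℝ)).const_min (p.2 + R)).const_max (p.2 - R)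
    simpa using! this.prodMk h2
  have hπm : ∀ q, π q ∈ Metric.closedBall p R := fun q => by
    rw [Metric.mem_closedBall, Prod.dist_eq, max_le_iff, Real.dist_eq, Real.dist_eq, abs_le, abs_le]
    simp only [π]
    refine ⟨⟨?_, ?_⟩, ?_, ?_⟩
    · linarith [le_max_left (p.1 - R) (min (p.1 + R) q.1)]
    · rw [sub_le_iff_le_add', max_le_iff]
      exact ⟨by linarith, min_le_left _ _⟩
    · linarith [le_max_left (p.2 - R) (min (p.2 + R) q.2)]
    · rw [sub_le_iff_le_add', max_le_iff]
      exact ⟨by linarith, min_le_left _ _⟩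
  have hlip : LipschitzWith (K * 1) (F ∘ π) := by
    rw [← lipschitzOnWith_univ]
    exact hK.comp hπ.lipschitzOnWith fun q _ => hRs (hπm q)
  obtain ⟨M, hM⟩ := ((isCompact_closedBall p R).image_of_continuousOn
    (hK.continuousOn.mono hRs)).isBounded.exists_norm_le
  refine ⟨R, hR, F ∘ π, fun q hq => ?_, fun u₀ =>
    exists_isIntegralCurve_of_bounded (M := M.toNNReal) (fun _ => hlip)
      (fun _ => continuous_const) (fun _ x => ?_) 0 u₀⟩
  · rw [Prod.dist_eq, max_le_iff, Real.dist_eq, Real.dist_eq, abs_le, abs_le] at hq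
    have h1 : π q = q := by
      simp only [π]
      rw [min_eq_right (by linarith), min_eq_right (by linarith), max_eq_right (by linarith),
        max_eq_right (by linarith)]
    simp [h1]
  · exact (hM _ ⟨π x, hπm x, rfl⟩).trans (Real.le_coe_toNNReal M)

/-- The Lyapunov function decays exponentially along solutions near `p`, which traps them and forces
convergence. Existence on [0, ∞) comes from the globally solvable field `G`, whose solution is
trapped in the region where `G = F`. -/
theorem isLocallyAsymptoticallyStable_of_trace_neg {F : ℝ × ℝ → ℝ × ℝ} {p : ℝ × ℝ}
    {F' : ℝ × ℝ →L[ℝ] ℝ × ℝ} {a b c d : ℝ} (hp : F p = 0) (hC : ContDiffAt ℝ 1 F p)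
    (hF : HasFDerivAt F F' p) (hF' : ∀ v, F' v = (a * v.1 + b * v.2, c * v.1 + d * v.2))
    (htr : a + d < 0) (hdet : 0 < a * d - b * c) : IsLocallyAsymptoticallyStable F p := by
  obtain ⟨Q, Q', m, N, κ, R₁, hm, hN, hκ, hR₁, hQ, hQm, hQN, hQF⟩ :=
    exists_lyapunov_function (σ := -1) hp hF hF' (by norm_num) (by linarith) hdet
  obtain ⟨R₂, hR₂, G, hG, hGsol⟩ := exists_global_solution_of_contDiffAt hC
  have decay : ∀ (T : ℝ) (u : ℝ → ℝ × ℝ), IsIntegralCurveOn u (fun _ => F) (Icc 0 T) →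
      (∀ t ∈ Icc 0 T, dist (u t) p ≤ R₁) →
      ∀ t ∈ Icc 0 T, m * dist (u t) p ^ 2 ≤ Real.exp (-(κ * t)) * (N * dist (u 0) p ^ 2) := by
    intro T u hu hR t ht
    have h1 := lyapunov_along_solution (by norm_num) hQ hQF hu hR t ht
    have h2 : Q (u t - p) ≤ Real.exp (-(κ * t)) * Q (u 0 - p) := by
      have h3 : Real.exp (κ * t) * Q (u t - p) ≤ Q (u 0 - p) := by
        simp only [neg_mul, one_mul, neg_neg] at h1; linarith
      rw [Real.exp_neg, inv_mul_eq_div, le_div_iff₀ (Real.exp_pos _)]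
      linarith
    rw [dist_eq_norm, dist_eq_norm]
    calc _ ≤ _ := hQm _
      _ ≤ _ := h2
      _ ≤ _ := by gcongr; exact hQN _
  -- Since m|v|² ≤ Q ≤ N|v|², the condition Nδ² < mε² places the δ-ball inside a sublevel set of Q
  -- contained in the ε-ball.
  have radius : ∀ ε > 0, ∃ δ > 0, δ ≤ ε ∧ N * δ ^ 2 < m * ε ^ 2 := by
    intro ε hε
    have h1 : Tendsto (fun δ : ℝ => N * δ ^ 2) (𝓝[>] 0) (𝓝 0) := by
      have : Continuous fun δ : ℝ => N * δ ^ 2 := by fun_prop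
      simpa using (this.tendsto 0).mono_left nhdsWithin_le_nhds
    obtain ⟨δ, h2, h3⟩ := ((h1.eventually_lt_const (by positivity : 0 < m * ε ^ 2)).and
      (Ioc_mem_nhdsGT hε)).exists
    exact ⟨δ, h3.1, h3.2, h2⟩
  -- The curve is only required to solve `F` as long as it stays in the ε-ball, so the claim covers
  -- solutions of `F` and of `G` alike.
  have trap : ∀ ε > 0, ε ≤ R₁ → ∀ δ > 0, δ ≤ ε → N * δ ^ 2 < m * ε ^ 2 → ∀ (T : ℝ) (u : ℝ → ℝ × ℝ),
      ContinuousOn u (Icc 0 T) →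
      (∀ t ∈ Icc 0 T, (∀ s ∈ Icc 0 t, dist (u s) p ≤ ε) →
        IsIntegralCurveOn u (fun _ => F) (Icc 0 t)) →
      dist (u 0) p < δ → ∀ t ∈ Icc 0 T, dist (u t) p < ε := by
    intro ε hε hεR δ hδ hδε hδN T u hu hsol h0
    refine lt_of_continuation (f := fun t => dist (u t) p) (by fun_prop) (h0.trans_le hδε) fun t ht hs => ?_
    have h1 := decay t u (hsol t ht hs) (fun s h => (hs s h).trans hεR) t ⟨ht.1, le_rfl⟩
    have h2 : Real.exp (-(κ * t)) ≤ 1 := Real.exp_le_one_iff.2 (by nlinarith [ht.1])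
    have h3 : N * dist (u 0) p ^ 2 ≤ N * δ ^ 2 := by gcongr
    have h4 : 0 ≤ N * dist (u 0) p ^ 2 := by positivity
    have h5 : m * dist (u t) p ^ 2 < m * ε ^ 2 := by nlinarith
    exact lt_of_pow_lt_pow_left₀ 2 hε.le (lt_of_mul_lt_mul_left h5 hm.le)
  refine ⟨hp, fun ε hε => ?_, ?_⟩
  · obtain ⟨δ, hδ, hδε, hδN⟩ := radius (min ε R₁) (lt_min hε hR₁)
    refine ⟨δ, hδ, fun T u _ hu h0 t ht => ?_⟩
    exact (trap _ (lt_min hε hR₁) (min_le_right _ _) δ hδ hδε hδN T u hu.continuousOn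
      (fun t ht _ => hu.mono (Icc_subset_Icc_right ht.2)) h0 t ht).trans_le (min_le_left _ _)
  · set ε := min R₁ R₂
    have hε : 0 < ε := lt_min hR₁ hR₂
    obtain ⟨δ, hδ, hδε, hδN⟩ := radius ε hε
    refine ⟨δ, hδ, fun u₀ h0 => ⟨?_, fun u hu0 hu => ?_⟩⟩
    · obtain ⟨u, hu0, hu⟩ := hGsol u₀
      have hin : ∀ t, 0 ≤ t → dist (u t) p < ε := fun t ht =>
        trap ε hε (min_le_left _ _) δ hδ hδε hδN t u hu.continuous.continuousOn
          (fun τ _ hs s hsτ => by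
            exact (hu s).hasDerivWithinAt.congr_deriv (hG _ ((hs s hsτ).trans (min_le_right _ _))))
          (by rwa [hu0]) t ⟨ht, le_rfl⟩
      refine ⟨u, hu0, fun t ht => ?_⟩
      exact (hu t).hasDerivWithinAt.congr_deriv (hG _ ((hin t ht).le.trans (min_le_right _ _)))
    · have hcurve : ∀ T, IsIntegralCurveOn u (fun _ => F) (Icc 0 T) := fun T =>
        hu.mono Icc_subset_Ici_self
      have hin : ∀ t, 0 ≤ t → dist (u t) p < ε := fun t ht =>
        trap ε hε (min_le_left _ _) δ hδ hδε hδN t u (hcurve t).continuousOn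
          (fun τ _ _ => hcurve τ) (by rwa [hu0]) t ⟨ht, le_rfl⟩
      have hb : ∀ᶠ t in atTop, dist (u t) p ^ 2 ≤
          Real.exp (-(κ * t)) * (N * dist (u 0) p ^ 2) / m := by
        filter_upwards [eventually_ge_atTop 0] with t ht
        rw [le_div_iff₀ hm, mul_comm]
        exact decay t u (hcurve t) (fun s hs => (hin s hs.1).le.trans (min_le_left _ _)) t
          ⟨ht, le_rfl⟩
      have hlim : Tendsto (fun t => Real.exp (-(κ * t)) * (N * dist (u 0) p ^ 2) / m) atTop
          (𝓝 0) := by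
        have h1 : Tendsto (fun t => Real.exp (-(κ * t))) atTop (𝓝 0) :=
          Real.tendsto_exp_neg_atTop_nhds_zero.comp (tendsto_id.const_mul_atTop hκ)
        simpa using (h1.mul_const (N * dist (u 0) p ^ 2)).div_const m
      have hsq := squeeze_zero' (Eventually.of_forall fun t => sq_nonneg _) hb hlim
      rw [tendsto_iff_dist_tendsto_zero]
      simpa [Real.sqrt_sq] using hsq.sqrt

/-- Stability would confine a solution starting at distance ρ > 0 to a region where Q grows at least
like mρ²e^{κt}, while Q ≤ NR² there. -/
theorem isUnstable_of_trace_pos {F : ℝ × ℝ → ℝ × ℝ} {p : ℝ × ℝ}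
    {F' : ℝ × ℝ →L[ℝ] ℝ × ℝ} {a b c d : ℝ} (hp : F p = 0) (hC : ContDiffAt ℝ 1 F p)
    (hF : HasFDerivAt F F' p) (hF' : ∀ v, F' v = (a * v.1 + b * v.2, c * v.1 + d * v.2))
    (htr : 0 < a + d) (hdet : 0 < a * d - b * c) : IsUnstable F p := by
  obtain ⟨Q, Q', m, N, κ, R₁, hm, hN, hκ, hR₁, hQ, hQm, hQN, hQF⟩ :=
    exists_lyapunov_function (σ := 1) hp hF hF' (by norm_num) (by linarith) hdet
  obtain ⟨R₂, hR₂, G, hG, hGsol⟩ := exists_global_solution_of_contDiffAt hC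
  refine ⟨hp, fun hst => ?_⟩
  set R := min R₁ R₂
  have hR : 0 < R := lt_min hR₁ hR₂
  obtain ⟨δ, hδ, hstab⟩ := hst (R / 2) (by positivity)
  set ρ := min δ R / 2
  have hρ : 0 < ρ := by positivity
  obtain ⟨u, hu0, hu⟩ := hGsol (p + (ρ, 0))
  have hd0 : dist (u 0) p = ρ := by
    rw [hu0, dist_eq_norm, add_sub_cancel_left, Prod.norm_def]
    simp [abs_of_pos hρ, hρ.le]
  have hρδ : ρ < δ := by have := min_le_left δ R; simp only [ρ] at *; linarith
  have hρR : ρ < R := by have := min_le_right δ R; simp only [ρ] at *; linarith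
  have hcurve : ∀ τ, (∀ s ∈ Icc 0 τ, dist (u s) p ≤ R) →
      IsIntegralCurveOn u (fun _ => F) (Icc 0 τ) := fun τ hs s hsτ => by
    exact (hu s).hasDerivWithinAt.congr_deriv (hG _ ((hs s hsτ).trans (min_le_right _ _)))
  -- Stability speaks of solutions of `F`, whereas `u` solves `G`. While `u` is within `R` it also
  -- solves `F`, hence is within R/2, and continuation closes the loop.
  have hin : ∀ t, 0 ≤ t → dist (u t) p < R := fun t ht =>
    lt_of_continuation (T := t) (f := fun t => dist (u t) p)
      (by have := hu.continuous; fun_prop) (by rwa [hd0]) (fun τ hτ hs => by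
        have := hstab τ u hτ.1 (hcurve τ hs) (by rwa [hd0]) τ ⟨hτ.1, le_rfl⟩
        linarith) t ⟨ht, le_rfl⟩
  have hgrow : ∀ t, 0 ≤ t → m * ρ ^ 2 * Real.exp (κ * t) ≤ N * R ^ 2 := fun t ht => by
    have h1 := lyapunov_along_solution (by norm_num) hQ hQF
      (hcurve t fun s hs => (hin s hs.1).le)
      (fun s hs => (hin s hs.1).le.trans (min_le_left _ _)) t ⟨ht, le_rfl⟩
    have h2 := hQm (u 0 - p)
    have h3 := hQN (u t - p)
    rw [← dist_eq_norm] at h2 h3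
    rw [hd0] at h2
    have h4 : N * dist (u t) p ^ 2 ≤ N * R ^ 2 := by
      have := (hin t ht).le
      gcongr
    simp only [one_mul, Real.exp_neg] at h1
    rw [inv_mul_eq_div, le_div_iff₀ (Real.exp_pos _)] at h1
    have := Real.exp_pos (κ * t)
    nlinarith
  have hlim : Tendsto (fun t => m * ρ ^ 2 * Real.exp (κ * t)) atTop atTop :=
    (Real.tendsto_exp_atTop.comp (tendsto_id.const_mul_atTop hκ)).const_mul_atTop (by positivity)
  obtain ⟨t, h1, h2⟩ := ((hlim.eventually_gt_atTop (N * R ^ 2)).and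
    (eventually_ge_atTop 0)).exists
  exact absurd (hgrow t h2) (not_le.2 h1)

/-! ### Polar form of a planar Hopf bifurcation -/

/-- Logarithmic derivative of the radius with respect to the angle, for the polar system
`ρ' = ρ A ν ρ θ`, `θ' = Θ ν ρ θ` with parameter `ν`. -/
def polarRate (A Θ : ℝ → ℝ → ℝ → ℝ) (ν ρ θ : ℝ) : ℝ := A ν ρ θ / Θ ν ρ θ

/-- Polar systems `ρ' = ρ A ν ρ θ`, `θ' = Θ ν ρ θ`, cut off at the radius `ρ₀`, for which the
circulation changes stability at `ρ = 0`, `ν = μ₀` with speed `D ≠ 0`. -/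
structure IsPolarHopf (A Θ : ℝ → ℝ → ℝ → ℝ) (μ₀ ω₀ ε ρ₀ K C c D : ℝ) : Prop where
  ε_pos : 0 < ε
  ρ₀_pos : 0 < ρ₀
  K_nonneg : 0 ≤ K
  c_pos : 0 < c
  D_ne : D ≠ 0
  periodic_A : ∀ ν ρ, Function.Periodic (A ν ρ) (2 * Real.pi)
  periodic_Θ : ∀ ν ρ, Function.Periodic (Θ ν ρ) (2 * Real.pi)
  cont_A : Continuous fun q : ℝ × ℝ × ℝ => A q.1 q.2.1 q.2.2
  cont_Θ : Continuous fun q : ℝ × ℝ × ℝ => Θ q.1 q.2.1 q.2.2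
  le_Θ : ∀ ν ρ θ, c ≤ Θ ν ρ θ
  Θ_le : ∀ ν ρ θ, Θ ν ρ θ ≤ C
  abs_A_le : ∀ ν ρ θ, |A ν ρ θ| ≤ C
  lip : ∀ ν ν' ρ ρ' θ, |polarRate A Θ ν ρ θ - polarRate A Θ ν' ρ' θ| ≤
    K * (|min ρ ρ₀ - min ρ' ρ₀| + |ν - ν'|)
  transversal : ∀ ν ∈ Icc (μ₀ - ε) (μ₀ + ε), ∀ ν' ∈ Icc (μ₀ - ε) (μ₀ + ε), ∀ ρ θ,
    |polarRate A Θ ν ρ θ - polarRate A Θ ν' ρ θ - D * (ν - ν')| ≤ |D| / 2 * |ν - ν'|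
  A_zero : ∀ θ, A μ₀ 0 θ = 0
  Θ_zero : ∀ θ, Θ μ₀ 0 θ = ω₀

/-- `Y` is the logarithm of the radius along an orbit, as a function of the angle. -/
def IsPolarOrbit (A Θ : ℝ → ℝ → ℝ → ℝ) (ν : ℝ) (Y : ℝ → ℝ) : Prop :=
  IsIntegralCurve Y fun θ y => polarRate A Θ ν (Real.exp y) θ

theorem abs_min_sub_min_le (a b c : ℝ) : |min a c - min b c| ≤ |a - b| := by
  simpa using abs_min_sub_min_le_max a c b c

theorem abs_exp_sub_exp_le {x y z : ℝ} (hx : x ≤ z) (hy : y ≤ z) :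
    |Real.exp x - Real.exp y| ≤ Real.exp z * |x - y| := by
  have key : ∀ x y : ℝ, x ≤ z → Real.exp x - Real.exp y ≤ Real.exp z * |x - y| := by
    intro x y hx
    have h1 := Real.add_one_le_exp (y - x)
    have h2 : Real.exp x * Real.exp (y - x) = Real.exp y := by rw [← Real.exp_add]; ring_nf
    have h3 : Real.exp x - Real.exp y ≤ Real.exp x * (x - y) := by
      nlinarith [Real.exp_pos x]
    calc _ ≤ _ := h3
      _ ≤ Real.exp x * |x - y| := by gcongr; exact le_abs_self _
      _ ≤ _ := by gcongr
  rw [abs_le]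
  constructor
  · have := key y x hy
    rw [abs_sub_comm] at this
    linarith
  · exact key x y hx

theorem abs_min_exp_sub_min_exp_le {ρ₀ : ℝ} (hρ₀ : 0 < ρ₀) (x y : ℝ) :
    |min (Real.exp x) ρ₀ - min (Real.exp y) ρ₀| ≤ ρ₀ * |x - y| := by
  have h : ∀ x, min (Real.exp x) ρ₀ = Real.exp (min x (Real.log ρ₀)) := fun x => by
    rw [Real.exp_monotone.map_min, Real.exp_log hρ₀]
  rw [h, h]
  refine (abs_exp_sub_exp_le (min_le_right _ _) (min_le_right _ _)).trans ?_
  rw [Real.exp_log hρ₀]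
  exact mul_le_mul_of_nonneg_left (abs_min_sub_min_le _ _ _) hρ₀.le

/-! ### Closed orbits of polar systems -/

section

variable {A Θ : ℝ → ℝ → ℝ → ℝ} {μ₀ ω₀ ε ρ₀ K C c D : ℝ}

namespace IsPolarHopf

theorem C_pos (H : IsPolarHopf A Θ μ₀ ω₀ ε ρ₀ K C c D) : 0 < C :=
  H.c_pos.trans_le ((H.le_Θ 0 0 0).trans (H.Θ_le 0 0 0))

theorem Θ_pos (H : IsPolarHopf A Θ μ₀ ω₀ ε ρ₀ K C c D) (ν ρ θ : ℝ) : 0 < Θ ν ρ θ :=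
  H.c_pos.trans_le (H.le_Θ ν ρ θ)

theorem cont_rate (H : IsPolarHopf A Θ μ₀ ω₀ ε ρ₀ K C c D) :
    Continuous fun q : ℝ × ℝ × ℝ => polarRate A Θ q.1 q.2.1 q.2.2 :=
  H.cont_A.div H.cont_Θ fun _ => (H.Θ_pos _ _ _).ne'

theorem abs_rate_le (H : IsPolarHopf A Θ μ₀ ω₀ ε ρ₀ K C c D) (ν ρ θ : ℝ) :
    |polarRate A Θ ν ρ θ| ≤ C / c := by
  rw [polarRate, abs_div, abs_of_pos (H.Θ_pos ν ρ θ)]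
  exact div_le_div₀ H.C_pos.le (H.abs_A_le ν ρ θ) H.c_pos (H.le_Θ ν ρ θ)

/-- The cutoff at `ρ₀` is needed here: e^y is not globally Lipschitz, but min(e^y, ρ₀) = e^{min(y,
log ρ₀)} is, with constant `ρ₀`. -/
theorem lipschitz_log (H : IsPolarHopf A Θ μ₀ ω₀ ε ρ₀ K C c D) (ν θ : ℝ) :
    LipschitzWith (K * ρ₀).toNNReal fun y => polarRate A Θ ν (Real.exp y) θ := by
  refine LipschitzWith.of_dist_le_mul fun x y => ?_
  rw [Real.coe_toNNReal _ (mul_nonneg H.K_nonneg H.ρ₀_pos.le), Real.dist_eq, Real.dist_eq, mul_assoc]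
  refine (H.lip _ _ _ _ _).trans ?_
  rw [sub_self, abs_zero, add_zero]
  exact mul_le_mul_of_nonneg_left (abs_min_exp_sub_min_exp_le H.ρ₀_pos x y) H.K_nonneg

theorem exists_orbit (H : IsPolarHopf A Θ μ₀ ω₀ ε ρ₀ K C c D) (ν θ₀ y₀ : ℝ) :
    ∃ Y, Y θ₀ = y₀ ∧ IsPolarOrbit A Θ ν Y :=
  exists_isIntegralCurve_of_bounded (M := (C / c).toNNReal) (H.lipschitz_log ν)
    (fun x => H.cont_rate.comp (by fun_prop : Continuous fun θ : ℝ => (ν, Real.exp x, θ)))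
    (fun t x => (H.abs_rate_le _ _ _).trans (Real.le_coe_toNNReal _)) θ₀ y₀

theorem orbit_unique (H : IsPolarHopf A Θ μ₀ ω₀ ε ρ₀ K C c D) {ν θ₀ : ℝ} {Y Z : ℝ → ℝ}
    (hY : IsPolarOrbit A Θ ν Y) (hZ : IsPolarOrbit A Θ ν Z) (h : Y θ₀ = Z θ₀) : Y = Z :=
  ODE_solution_unique_univ (s := fun _ => univ)
    (fun t => (H.lipschitz_log ν t).lipschitzOnWith) (fun t => ⟨hY t, trivial⟩)
    (fun t => ⟨hZ t, trivial⟩) h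

theorem orbit_dist_le (H : IsPolarHopf A Θ μ₀ ω₀ ε ρ₀ K C c D) {ν : ℝ} {Y : ℝ → ℝ}
    (hY : IsPolarOrbit A Θ ν Y) (θ : ℝ) : |Y θ - Y 0| ≤ C / c * |θ| := by
  have := convex_univ.norm_image_sub_le_of_norm_hasDerivWithin_le (f := Y)
    (fun x _ => (hY x).hasDerivWithinAt) (fun x _ => H.abs_rate_le _ _ _) (mem_univ 0) (mem_univ θ)
  simpa using this

/-- An orbit for `ν'` solves the equation for `ν` up to an error K|ν - ν'|, so Grönwall's inequality
handles initial value and parameter together. -/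
theorem orbit_dependence (H : IsPolarHopf A Θ μ₀ ω₀ ε ρ₀ K C c D) {ν ν' : ℝ} {Y Z : ℝ → ℝ}
    (hY : IsPolarOrbit A Θ ν Y) (hZ : IsPolarOrbit A Θ ν' Z) (θ : ℝ) :
    |Y θ - Z θ| ≤ gronwallBound |Y 0 - Z 0| (K * ρ₀) (K * |ν - ν'|) |θ| := by
  have := dist_le_gronwallBound_abs (ε := K * |ν - ν'|) (H.lipschitz_log ν) hY hZ
    (fun t => by
      rw [dist_comm]
      refine (H.lip _ _ _ _ _).trans_eq ?_
      simp) 0 θ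
  rwa [Real.coe_toNNReal _ (mul_nonneg H.K_nonneg H.ρ₀_pos.le), sub_zero] at this

theorem orbit_dependence_param (H : IsPolarHopf A Θ μ₀ ω₀ ε ρ₀ K C c D) {ν ν' : ℝ} {Y Z : ℝ → ℝ}
    (hY : IsPolarOrbit A Θ ν Y) (hZ : IsPolarOrbit A Θ ν' Z) (h0 : Y 0 = Z 0) {θ : ℝ}
    (hθ : θ ∈ Icc 0 (2 * Real.pi)) : |Y θ - Z θ| ≤
      K * (2 * Real.pi * Real.exp (K * ρ₀ * (2 * Real.pi))) * |ν - ν'| := by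
  have hK := H.K_nonneg
  have hρ := H.ρ₀_pos.le
  have h1 := H.orbit_dependence hY hZ θ
  rw [h0, sub_self, abs_zero, abs_of_nonneg hθ.1] at h1
  refine h1.trans ((gronwallBound_zero_left_le (by positivity) (by positivity)).trans ?_)
  have h2 := hθ.2
  have h3 := hθ.1
  calc K * |ν - ν'| * (θ * Real.exp (K * ρ₀ * θ))
      ≤ K * |ν - ν'| * (2 * Real.pi * Real.exp (K * ρ₀ * (2 * Real.pi))) := by gcongr
    _ = _ := by ring

theorem rate_periodic (H : IsPolarHopf A Θ μ₀ ω₀ ε ρ₀ K C c D) (ν ρ θ : ℝ) :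
    polarRate A Θ ν ρ (θ + 2 * Real.pi) = polarRate A Θ ν ρ θ := by
  rw [polarRate, polarRate, H.periodic_A ν ρ θ, H.periodic_Θ ν ρ θ]

theorem orbit_shift (H : IsPolarHopf A Θ μ₀ ω₀ ε ρ₀ K C c D) {ν : ℝ} {Y : ℝ → ℝ}
    (hY : IsPolarOrbit A Θ ν Y) : IsPolarOrbit A Θ ν fun θ => Y (θ + 2 * Real.pi) := fun θ =>
  ((hY (θ + 2 * Real.pi)).comp_add_const θ _).congr_deriv (H.rate_periodic _ _ _)

theorem orbit_periodic (H : IsPolarHopf A Θ μ₀ ω₀ ε ρ₀ K C c D) {ν : ℝ} {Y : ℝ → ℝ}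
    (hY : IsPolarOrbit A Θ ν Y) {θ₀ : ℝ} (h : Y (θ₀ + 2 * Real.pi) = Y θ₀) :
    Function.Periodic Y (2 * Real.pi) :=
  congrFun (H.orbit_unique (H.orbit_shift hY) hY h)

/-- The return map is monotone, hence its periodic points are fixed points. -/
theorem orbit_periodic_of_iterate (H : IsPolarHopf A Θ μ₀ ω₀ ε ρ₀ K C c D) {ν : ℝ} {Y : ℝ → ℝ}
    (hY : IsPolarOrbit A Θ ν Y) {k : ℕ} (hk : 0 < k) {θ₀ : ℝ}
    (h : Y (θ₀ + k * (2 * Real.pi)) = Y θ₀) : Function.Periodic Y (2 * Real.pi) := by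
  by_contra hne
  have hne' : ∀ θ, Y (θ + 2 * Real.pi) - Y θ ≠ 0 := fun θ h =>
    hne (H.orbit_periodic hY (sub_eq_zero.1 h))
  have hc : Continuous fun θ => Y (θ + 2 * Real.pi) - Y θ := by
    have : Continuous Y := IsIntegralCurve.continuous hY
    fun_prop
  -- A one-turn displacement that never vanishes has constant sign, so the displacements over `k`
  -- turns cannot sum to zero.
  have hsign : (∀ θ, 0 < Y (θ + 2 * Real.pi) - Y θ) ∨ ∀ θ, Y (θ + 2 * Real.pi) - Y θ < 0 := by
    by_contra! hcon
    obtain ⟨⟨x, hx⟩, y, hy⟩ := hcon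
    obtain ⟨z, hz⟩ := mem_range_of_exists_le_of_exists_ge hc ⟨x, hx⟩ ⟨y, hy⟩
    exact hne' z hz
  have hsum : ∀ n : ℕ, Y (θ₀ + n * (2 * Real.pi)) - Y θ₀ =
      ∑ i ∈ Finset.range n, (Y (θ₀ + i * (2 * Real.pi) + 2 * Real.pi) -
        Y (θ₀ + i * (2 * Real.pi))) := fun n => by
    induction n with
    | zero => simp
    | succ n ih =>
      rw [Finset.sum_range_succ, ← ih]
      push_cast
      ring_nf
  have hk' : (Finset.range k).Nonempty := Finset.nonempty_range_iff.2 hk.ne'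
  have hz := hsum k
  rw [h, sub_self] at hz
  rcases hsign with hs | hs
  · exact (Finset.sum_pos (fun (i : ℕ) _ => hs (θ₀ + (i : ℝ) * (2 * Real.pi))) hk').ne hz
  · exact (Finset.sum_neg (fun (i : ℕ) _ => hs (θ₀ + (i : ℝ) * (2 * Real.pi))) hk').ne' hz

theorem orbit_le (H : IsPolarHopf A Θ μ₀ ω₀ ε ρ₀ K C c D) {ν : ℝ} {Y : ℝ → ℝ}
    (hY : IsPolarOrbit A Θ ν Y) {θ : ℝ} (hθ : θ ∈ Icc 0 (2 * Real.pi)) :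
    Y θ ≤ Y 0 + C / c * (2 * Real.pi) := by
  have h1 := (abs_le.1 (H.orbit_dist_le hY θ)).2
  rw [abs_of_nonneg hθ.1] at h1
  have := mul_le_mul_of_nonneg_left hθ.2 (div_nonneg H.C_pos.le H.c_pos.le)
  linarith

/-- The displacement of an orbit after one turn, compared with its linearization. -/
theorem abs_displacement_sub_le (H : IsPolarHopf A Θ μ₀ ω₀ ε ρ₀ K C c D) {ν : ℝ} {Y : ℝ → ℝ}
    (hY : IsPolarOrbit A Θ ν Y) (hν : ν ∈ Icc (μ₀ - ε) (μ₀ + ε)) :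
    |Y (2 * Real.pi) - Y 0 - 2 * Real.pi * (D * (ν - μ₀))| ≤
      2 * Real.pi * (K * Real.exp (Y 0 + C / c * (2 * Real.pi)) + |D| / 2 * |ν - μ₀|) := by
  have hμ : μ₀ ∈ Icc (μ₀ - ε) (μ₀ + ε) := ⟨by linarith [H.ε_pos], by linarith [H.ε_pos]⟩
  have h2π : (0 : ℝ) ≤ 2 * Real.pi := by positivity
  -- The derivative splits at radius 0: changing the radius costs at most K e^Y, and at radius 0
  -- transversality compares ν with μ₀, where the rate vanishes.
  have := (convex_Icc 0 (2 * Real.pi)).norm_image_sub_le_of_norm_hasDerivWithin_le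
    (f := fun θ => Y θ - θ * (D * (ν - μ₀)))
    (C := K * Real.exp (Y 0 + C / c * (2 * Real.pi)) + |D| / 2 * |ν - μ₀|)
    (fun x _ => ((hY x).sub ((hasDerivAt_id x).mul_const _)).hasDerivWithinAt)
    (fun x hx => ?_) ⟨le_rfl, h2π⟩ ⟨h2π, le_rfl⟩
  · rw [Real.norm_eq_abs, Real.norm_eq_abs, sub_zero, abs_of_nonneg h2π] at this
    convert this using 1
    · congr 1; ring
    · ring
  · have h1 := H.lip ν ν (Real.exp (Y x)) 0 x
    have h2 := H.transversal ν hν μ₀ hμ 0 x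
    have h3 : polarRate A Θ μ₀ 0 x = 0 := by rw [polarRate, H.A_zero, zero_div]
    rw [sub_self, abs_zero, add_zero] at h1
    rw [h3, sub_zero] at h2
    have h4 : |min (Real.exp (Y x)) ρ₀ - min 0 ρ₀| ≤ Real.exp (Y 0 + C / c * (2 * Real.pi)) := by
      refine (abs_min_sub_min_le _ _ _).trans ?_
      rw [sub_zero, abs_of_pos (Real.exp_pos _)]
      exact Real.exp_le_exp.2 (H.orbit_le hY hx)
    have h5 := mul_le_mul_of_nonneg_left h4 H.K_nonneg
    calc _ = |(polarRate A Θ ν (Real.exp (Y x)) x - polarRate A Θ ν 0 x) +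
          (polarRate A Θ ν 0 x - D * (ν - μ₀))| := by rw [Real.norm_eq_abs]; congr 1; ring
      _ ≤ _ := (abs_add_le _ _).trans (add_le_add (h1.trans h5) h2)

/-- The displacements after one turn, for one initial radius and two parameters. -/
theorem abs_displacement_sub_displacement_le (H : IsPolarHopf A Θ μ₀ ω₀ ε ρ₀ K C c D) {ν ν' : ℝ}
    {Y Z : ℝ → ℝ} (hY : IsPolarOrbit A Θ ν Y) (hZ : IsPolarOrbit A Θ ν' Z) (h0 : Y 0 = Z 0)
    (hν : ν ∈ Icc (μ₀ - ε) (μ₀ + ε)) (hν' : ν' ∈ Icc (μ₀ - ε) (μ₀ + ε)) :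
    |Y (2 * Real.pi) - Z (2 * Real.pi) - 2 * Real.pi * (D * (ν - ν'))| ≤
      2 * Real.pi * ((K * (Real.exp (Y 0 + C / c * (2 * Real.pi)) *
        (K * (2 * Real.pi * Real.exp (K * ρ₀ * (2 * Real.pi))))) + |D| / 2) * |ν - ν'|) := by
  set B := K * (2 * Real.pi * Real.exp (K * ρ₀ * (2 * Real.pi)))
  set e := Real.exp (Y 0 + C / c * (2 * Real.pi))
  have h2π : (0 : ℝ) ≤ 2 * Real.pi := by positivity
  -- Here the derivative splits at (ν, e^Z). The error from the radius carries the factor e^{Y 0},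
  -- which is small for small orbits, besides |ν - ν'|.
  have := (convex_Icc 0 (2 * Real.pi)).norm_image_sub_le_of_norm_hasDerivWithin_le
    (f := fun θ => Y θ - Z θ - θ * (D * (ν - ν')))
    (C := (K * (e * B) + |D| / 2) * |ν - ν'|)
    (fun x _ => (((hY x).sub (hZ x)).sub ((hasDerivAt_id x).mul_const _)).hasDerivWithinAt)
    (fun x hx => ?_) ⟨le_rfl, h2π⟩ ⟨h2π, le_rfl⟩
  · rw [Real.norm_eq_abs, Real.norm_eq_abs, sub_zero, abs_of_nonneg h2π] at this
    convert this using 1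
    · congr 1
      simp only [h0]
      ring
    · ring
  · have h1 := H.lip ν ν (Real.exp (Y x)) (Real.exp (Z x)) x
    have h2 := H.transversal ν hν ν' hν' (Real.exp (Z x)) x
    rw [sub_self, abs_zero, add_zero] at h1
    have h4 : |min (Real.exp (Y x)) ρ₀ - min (Real.exp (Z x)) ρ₀| ≤ e * (B * |ν - ν'|) := by
      refine (abs_min_sub_min_le _ _ _).trans ((abs_exp_sub_exp_le (H.orbit_le hY hx) ?_).trans ?_)
      · rw [h0]; exact H.orbit_le hZ hx
      · exact mul_le_mul_of_nonneg_left (H.orbit_dependence_param hY hZ h0 hx) (Real.exp_pos _).le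
    have h5 := mul_le_mul_of_nonneg_left h4 H.K_nonneg
    calc _ = |(polarRate A Θ ν (Real.exp (Y x)) x - polarRate A Θ ν (Real.exp (Z x)) x) +
          (polarRate A Θ ν (Real.exp (Z x)) x - polarRate A Θ ν' (Real.exp (Z x)) x
            - D * (ν - ν'))| := by rw [Real.norm_eq_abs]; congr 1; ring
      _ ≤ _ := (abs_add_le _ _).trans (add_le_add (h1.trans h5) h2)
      _ = _ := by ring

/-- The branch of closed orbits of a polar system, parametrized by the radius at the angle `0`. -/
theorem exists_closed_orbits (H : IsPolarHopf A Θ μ₀ ω₀ ε ρ₀ K C c D) {δ : ℝ} (hδ : 0 < δ) :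
    ∃ s₀ > 0, ∃ (r : ℝ → ℝ) (Y : ℝ → ℝ → ℝ), ContinuousOn r (Ico 0 s₀) ∧ r 0 = μ₀ ∧
      (∀ s ∈ Ioo 0 s₀, |r s - μ₀| < ε ∧ |r s - μ₀| < δ ∧ Y s 0 = Real.log s ∧ IsPolarOrbit A Θ (r s) (Y s) ∧
        Function.Periodic (Y s) (2 * Real.pi) ∧ ∀ θ, Real.exp (Y s θ) < δ) ∧
      (∀ ν Z, |ν - μ₀| ≤ ε → IsPolarOrbit A Θ ν Z → Function.Periodic Z (2 * Real.pi) →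
        Real.exp (Z 0) < s₀ → r (Real.exp (Z 0)) = ν ∧ Y (Real.exp (Z 0)) = Z) ∧
      ContinuousOn (fun q : ℝ × ℝ => if q.1 = 0 then 0 else Real.exp (Y q.1 q.2))
        (Ico 0 s₀ ×ˢ univ) := by
  have hD : 0 < |D| := abs_pos.2 H.D_ne
  have hK := H.K_nonneg
  have hε := H.ε_pos
  have h2π : (0 : ℝ) ≤ 2 * Real.pi := by positivity
  choose! orb horb0 horb using fun ν y => H.exists_orbit ν 0 y
  set L := Real.exp (C / c * (2 * Real.pi)) with hL
  have hLpos : 0 < L := Real.exp_pos _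
  set B := K * (2 * Real.pi * Real.exp (K * ρ₀ * (2 * Real.pi))) with hB
  have hBnn : 0 ≤ B := by positivity
  -- `hs1` fixes the sign of the displacement at μ₀ ± ε, `hs2` makes it expanding in the parameter,
  -- `hs3` and `hs4` keep the radius and the parameter shift below δ.
  obtain ⟨s₀, hs₀, hs1, hs2, hs3, hs4⟩ : ∃ s₀ > 0, K * (s₀ * L) < |D| * ε / 2 ∧
      K * (s₀ * L * B) < |D| / 4 ∧ s₀ * L < δ ∧ 2 * (K * L) / |D| * s₀ < δ := by
    have lim : ∀ k x : ℝ, 0 < x → ∀ᶠ s in 𝓝[>] (0 : ℝ), s * k < x := fun k x hx => by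
      have : Continuous fun s : ℝ => s * k := by fun_prop
      exact ((this.tendsto' 0 0 (by simp)).mono_left nhdsWithin_le_nhds).eventually_lt_const hx
    obtain ⟨s, h1, h2, h3, h4, h5⟩ := ((lim (K * L) (|D| * ε / 2) (by positivity)).and
      ((lim (K * L * B) (|D| / 4) (by positivity)).and
        ((lim L δ hδ).and ((lim (2 * (K * L) / |D|) δ hδ).and self_mem_nhdsWithin)))).exists
    exact ⟨s, h5, by linarith, by linarith, h3, by linarith⟩
  have hexp : ∀ {s : ℝ}, 0 < s → Real.exp (Real.log s + C / c * (2 * Real.pi)) = s * L :=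
    fun hs => by rw [Real.exp_add, Real.exp_log hs]
  have mem : ∀ {ν}, |ν - μ₀| ≤ ε → ν ∈ Icc (μ₀ - ε) (μ₀ + ε) := fun h => by
    have := abs_le.1 h
    constructor <;> linarith [this.1, this.2]
  set g : ℝ → ℝ → ℝ := fun s ν => orb ν (Real.log s) (2 * Real.pi) - Real.log s with hg
  have g1 : ∀ s ∈ Ioo 0 s₀, ∀ ν, |ν - μ₀| ≤ ε → |g s ν - 2 * Real.pi * (D * (ν - μ₀))| ≤
      2 * Real.pi * (K * (s * L) + |D| / 2 * |ν - μ₀|) := fun s hs ν hν => by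
    have := H.abs_displacement_sub_le (horb ν (Real.log s)) (mem hν)
    rwa [horb0, hexp hs.1] at this
  -- Of the slope 2π|D|, transversality may take 2π|D|/2 and the radius 2π|D|/4; the remaining
  -- π|D|/2 gives uniqueness of the zero and continuity in `s`.
  have g2 : ∀ s ∈ Ioo 0 s₀, ∀ ν ν', |ν - μ₀| ≤ ε → |ν' - μ₀| ≤ ε →
      Real.pi * |D| / 2 * |ν - ν'| ≤ |g s ν - g s ν'| := fun s hs ν ν' hν hν' => by
    have := H.abs_displacement_sub_displacement_le (horb ν (Real.log s)) (horb ν' (Real.log s))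
      (by rw [horb0, horb0]) (mem hν) (mem hν')
    rw [horb0, hexp hs.1] at this
    have h1 : K * (s * L * B) ≤ |D| / 4 := le_trans (by have := hs.2.le; gcongr) hs2.le
    have h2 : g s ν - g s ν' = orb ν (Real.log s) (2 * Real.pi) - orb ν' (Real.log s) (2 * Real.pi) := by
      simp [hg]
    rw [h2]
    have h3 : |2 * Real.pi * (D * (ν - ν'))| = 2 * Real.pi * (|D| * |ν - ν'|) := by
      rw [abs_mul, abs_mul D, abs_of_nonneg h2π]
    have h4 := abs_sub_abs_le_abs_sub (2 * Real.pi * (D * (ν - ν')))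
      (orb ν (Real.log s) (2 * Real.pi) - orb ν' (Real.log s) (2 * Real.pi))
    rw [abs_sub_comm (2 * Real.pi * (D * (ν - ν'))), h3] at h4
    have h5 : (K * (s * L * B) + |D| / 2) * |ν - ν'| ≤ (|D| / 4 + |D| / 2) * |ν - ν'| := by gcongr
    have h6 := mul_le_mul_of_nonneg_left h5 h2π
    linarith
  have gcont : ∀ s, Continuous (g s) := fun s => by
    refine (LipschitzWith.of_dist_le_mul (K := B.toNNReal) fun ν ν' => ?_).continuous
    have := H.orbit_dependence_param (horb ν (Real.log s)) (horb ν' (Real.log s))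
      (by rw [horb0, horb0]) (θ := 2 * Real.pi) ⟨h2π, le_rfl⟩
    rw [Real.coe_toNNReal _ hBnn, Real.dist_eq, Real.dist_eq]
    simpa [hg] using this
  have gcont' : ∀ ν, ∀ s ∈ Ioo 0 s₀, ContinuousAt (fun s => g s ν) s := fun ν s hs => by
    have hlog : ContinuousAt Real.log s := Real.continuousAt_log hs.1.ne'
    refine ContinuousAt.sub ?_ hlog
    rw [ContinuousAt, tendsto_iff_dist_tendsto_zero]
    have hlim : Tendsto (fun s' => |Real.log s' - Real.log s| *
        Real.exp (K * ρ₀ * |2 * Real.pi|)) (𝓝 s) (𝓝 0) := by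
      have : ContinuousAt (fun s' => |Real.log s' - Real.log s| *
        Real.exp (K * ρ₀ * |2 * Real.pi|)) s := by fun_prop
      simpa using this.tendsto
    refine squeeze_zero (fun _ => dist_nonneg) (fun s' => ?_) hlim
    have := H.orbit_dependence (horb ν (Real.log s')) (horb ν (Real.log s)) (2 * Real.pi)
    rwa [horb0, horb0, sub_self, abs_zero, mul_zero, gronwallBound_ε0] at this
  have hex : ∀ s ∈ Ioo 0 s₀, ∃ ν, |ν - μ₀| < ε ∧ g s ν = 0 := fun s hs => by
    have hsL : K * (s * L) < |D| * ε / 2 := lt_of_le_of_lt (by have := hs.2.le; gcongr) hs1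
    have hp := abs_le.1 (g1 s hs (μ₀ + ε) (by simp [abs_of_pos hε]))
    have hm := abs_le.1 (g1 s hs (μ₀ - ε) (by simp [abs_of_pos hε]))
    simp only [add_sub_cancel_left, sub_sub_cancel_left, abs_neg, abs_of_pos hε] at hp hm
    have hbound : 2 * Real.pi * (K * (s * L) + |D| / 2 * ε) < 2 * Real.pi * (|D| * ε) := by
      gcongr; linarith
    have hle : μ₀ - ε ≤ μ₀ + ε := by linarith
    have : (0 : ℝ) ∈ g s '' Ioo (μ₀ - ε) (μ₀ + ε) := by
      rcases H.D_ne.lt_or_gt with hDs | hDs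
      · rw [abs_of_neg hDs] at hbound hp hm
        exact intermediate_value_Ioo' hle (gcont s).continuousOn ⟨by linarith, by linarith⟩
      · rw [abs_of_pos hDs] at hbound hp hm
        exact intermediate_value_Ioo hle (gcont s).continuousOn ⟨by linarith, by linarith⟩
    obtain ⟨ν, hν, h0⟩ := this
    exact ⟨ν, by rw [abs_lt]; constructor <;> linarith [hν.1, hν.2], h0⟩
  choose! r' hr'ε hr'0 using hex
  -- The value at s = 0 is set by hand, since log s has no meaning there; continuity at 0 follows
  -- from |r s - μ₀| = O(s).
  set r : ℝ → ℝ := fun s => if s = 0 then μ₀ else r' s with hr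
  have hr_pos : ∀ s ∈ Ioo 0 s₀, r s = r' s := fun s hs => if_neg hs.1.ne'
  have hr_dist : ∀ s ∈ Ico 0 s₀, |r s - μ₀| ≤ 2 * (K * L) / |D| * s := fun s hs => by
    rcases hs.1.eq_or_lt with rfl | h
    · simp [hr]
    · have hs' : s ∈ Ioo 0 s₀ := ⟨h, hs.2⟩
      have h1 := g1 s hs' (r' s) (hr'ε s hs').le
      rw [hr'0 s hs', zero_sub, abs_neg, abs_mul (2 * Real.pi), abs_mul D, abs_of_nonneg h2π] at h1
      have h2 := le_of_mul_le_mul_left h1 (by positivity)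
      rw [hr_pos s hs', div_mul_eq_mul_div, le_div_iff₀ hD]
      nlinarith
  have hrcont : ContinuousOn r (Ico 0 s₀) := by
    intro s hs
    rw [ContinuousWithinAt, tendsto_iff_dist_tendsto_zero]
    rcases hs.1.eq_or_lt with rfl | h
    · have hlim : Tendsto (fun s : ℝ => 2 * (K * L) / |D| * s) (𝓝[Ico 0 s₀] 0) (𝓝 0) := by
        have : Continuous fun s : ℝ => 2 * (K * L) / |D| * s := by fun_prop
        exact (this.tendsto' 0 0 (by simp)).mono_left nhdsWithin_le_nhds
      refine squeeze_zero' (Eventually.of_forall fun _ => dist_nonneg)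
        (eventually_mem_nhdsWithin.mono fun s hs => ?_) hlim
      have : r 0 = μ₀ := if_pos rfl
      rw [this]
      exact hr_dist s hs
    · have hs' : s ∈ Ioo 0 s₀ := ⟨h, hs.2⟩
      refine Tendsto.mono_left ?_ nhdsWithin_le_nhds
      -- By `g2`, (π|D|/2)|r s' - r s| ≤ |g s' (r s)|, which tends to |g s (r s)| = 0.
      have hlim : Tendsto (fun s' => (Real.pi * |D| / 2)⁻¹ * |g s' (r' s)|) (𝓝 s) (𝓝 0) := by
        have := ((gcont' (r' s) s hs').abs.const_mul ((Real.pi * |D| / 2)⁻¹)).tendsto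
        simpa [hr'0 s hs'] using! this
      refine squeeze_zero' (Eventually.of_forall fun _ => dist_nonneg) ?_ hlim
      filter_upwards [isOpen_Ioo.mem_nhds hs'] with s' hs''
      rw [hr_pos s hs', hr_pos s' hs'', Real.dist_eq, inv_mul_eq_div, le_div_iff₀ (by positivity),
        mul_comm]
      have := g2 s' hs'' (r' s') (r' s) (hr'ε _ hs'').le (hr'ε _ hs').le
      rwa [hr'0 s' hs'', zero_sub, abs_neg] at this
  set Y : ℝ → ℝ → ℝ := fun s => orb (r s) (Real.log s) with hY
  have hY0 : ∀ s, Y s 0 = Real.log s := fun s => horb0 _ _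
  have hYorb : ∀ s, IsPolarOrbit A Θ (r s) (Y s) := fun s => horb _ _
  have hYper : ∀ s ∈ Ioo 0 s₀, Function.Periodic (Y s) (2 * Real.pi) := fun s hs => by
    refine H.orbit_periodic (hYorb s) (θ₀ := 0) ?_
    have := hr'0 s hs
    have hYs : Y s = orb (r' s) (Real.log s) := by simp only [hY, hr_pos s hs]
    rw [zero_add, hY0, hYs]
    linarith
  have hYle : ∀ s ∈ Ioo 0 s₀, ∀ θ, Real.exp (Y s θ) ≤ s * L := fun s hs θ => by
    obtain ⟨θ', hθ', h⟩ := (hYper s hs).exists_mem_Ico₀ (by positivity) θ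
    rw [h, ← hexp hs.1, Real.exp_le_exp, ← hY0 s]
    exact H.orbit_le (hYorb s) (Ico_subset_Icc_self hθ')
  refine ⟨s₀, hs₀, r, Y, hrcont, if_pos rfl, fun s hs => ⟨?_, ?_, hY0 s, hYorb s,
    hYper s hs, fun θ => ?_⟩, fun ν Z hν hZ hZper hZ0 => ?_, ?_⟩
  · rw [hr_pos s hs]; exact hr'ε s hs
  · refine (hr_dist s (Ioo_subset_Ico_self hs)).trans_lt (lt_of_le_of_lt ?_ hs4)
    have := hs.2.le
    gcongr
  · refine (hYle s hs θ).trans_lt (lt_of_le_of_lt ?_ hs3)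
    have := hs.2.le
    gcongr
  · set s := Real.exp (Z 0)
    have hs : s ∈ Ioo 0 s₀ := ⟨Real.exp_pos _, hZ0⟩
    have hlog : Real.log s = Z 0 := Real.log_exp _
    have hZeq : orb ν (Real.log s) = Z :=
      H.orbit_unique (horb _ _) hZ (θ₀ := 0) (by rw [horb0, hlog])
    have hgν : g s ν = 0 := by
      have := hZper 0
      rw [zero_add] at this
      change orb ν (Real.log s) (2 * Real.pi) - Real.log s = 0
      rw [hZeq, hlog, this, sub_self]
    have hrν : r s = ν := by
      have := g2 s hs (r' s) ν (hr'ε s hs).le hν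
      rw [hgν, hr'0 s hs, sub_zero, abs_zero] at this
      rw [hr_pos s hs, ← sub_eq_zero, ← abs_nonpos_iff]
      by_contra! hpos
      have : 0 < Real.pi * |D| / 2 * |r' s - ν| := by positivity
      linarith
    exact ⟨hrν, by simp only [hY, hrν, hZeq]⟩
  · rintro ⟨s, θ⟩ ⟨hs, -⟩
    rcases hs.1.eq_or_lt with h0 | h
    · simp only at h0
      subst h0
      rw [ContinuousWithinAt, if_pos rfl]
      have hlim : Tendsto (fun q : ℝ × ℝ => q.1 * L) (𝓝[Ico 0 s₀ ×ˢ univ] (0, θ)) (𝓝 0) := by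
        have : Continuous fun q : ℝ × ℝ => q.1 * L := by fun_prop
        exact (this.tendsto' _ 0 (by simp)).mono_left nhdsWithin_le_nhds
      refine squeeze_zero' (Eventually.of_forall fun q => ?_)
        (eventually_mem_nhdsWithin.mono fun q hq => ?_) hlim
      · split_ifs
        · rfl
        · exact (Real.exp_pos _).le
      · split_ifs with h
        · rw [h]; simp
        · exact hYle _ ⟨lt_of_le_of_ne hq.1.1 (Ne.symm h), hq.1.2⟩ _
    · have hs' : s ∈ Ioo 0 s₀ := ⟨h, hs.2⟩
      refine ContinuousAt.continuousWithinAt ?_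
      have hne : ∀ᶠ q : ℝ × ℝ in 𝓝 (s, θ), q.1 ∈ Ioo 0 s₀ :=
        continuousAt_fst.eventually (isOpen_Ioo.mem_nhds hs')
      refine ContinuousAt.congr_of_eventuallyEq (f := fun q : ℝ × ℝ => Real.exp (Y q.1 q.2)) ?_
        (hne.mono fun q hq => if_neg hq.1.ne')
      refine Real.continuous_exp.continuousAt.comp ?_
      rw [ContinuousAt, tendsto_iff_dist_tendsto_zero]
      have hrs : ContinuousAt r s := (hrcont s hs).continuousAt
        (mem_of_superset (isOpen_Ioo.mem_nhds hs') Ioo_subset_Ico_self)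
      have hYc : Continuous (Y s) := IsIntegralCurve.continuous (hYorb s)
      have hlogc : ContinuousAt Real.log s := Real.continuousAt_log h.ne'
      have hlim : Tendsto (fun q : ℝ × ℝ => (|Real.log q.1 - Real.log s| *
          Real.exp (K * ρ₀ * |q.2|) + K * |r q.1 - r s| * (|q.2| * Real.exp (K * ρ₀ * |q.2|))) +
          |Y s q.2 - Y s θ|) (𝓝 (s, θ)) (𝓝 0) := by
        have h1 : ContinuousAt (fun q : ℝ × ℝ => r q.1) (s, θ) :=
          ContinuousAt.comp (g := r) (f := Prod.fst) hrs continuousAt_fst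
        have h2 : ContinuousAt (fun q : ℝ × ℝ => Real.log q.1) (s, θ) :=
          ContinuousAt.comp (g := Real.log) (f := Prod.fst) hlogc continuousAt_fst
        have h3 : ContinuousAt (fun q : ℝ × ℝ => (|Real.log q.1 - Real.log s| *
          Real.exp (K * ρ₀ * |q.2|) + K * |r q.1 - r s| * (|q.2| * Real.exp (K * ρ₀ * |q.2|))) +
          |Y s q.2 - Y s θ|) (s, θ) := by fun_prop
        simpa using h3.tendsto
      refine squeeze_zero (fun _ => dist_nonneg) (fun q => ?_) hlim
      refine (dist_triangle _ (Y s q.2) _).trans (add_le_add ?_ le_rfl)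
      have h4 := H.orbit_dependence (hYorb q.1) (hYorb s) q.2
      rw [hY0, hY0] at h4
      refine h4.trans ?_
      have h5 := gronwallBound_zero_left_le (K := K * ρ₀) (ε := K * |r q.1 - r s|) (x := |q.2|)
        (mul_nonneg hK H.ρ₀_pos.le) (by positivity)
      have h6 : gronwallBound |Real.log q.1 - Real.log s| (K * ρ₀) (K * |r q.1 - r s|) |q.2| =
          |Real.log q.1 - Real.log s| * Real.exp (K * ρ₀ * |q.2|) +
          gronwallBound 0 (K * ρ₀) (K * |r q.1 - r s|) |q.2| := by
        by_cases h0 : K * ρ₀ = 0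
        · simp [h0, gronwallBound_K0]
        · simp [gronwallBound_of_K_ne_0 h0]
      rw [h6]
      exact add_le_add le_rfl h5

end IsPolarHopf

end

/-! ### Linear coordinates and the polar form of a vector field -/

/-- The linear coordinates `(x, k₁ x + k₂ y)` of the plane, `z = x + i y`. -/
def shear (k₁ k₂ : ℝ) (z : ℂ) : ℝ × ℝ := (z.re, k₁ * z.re + k₂ * z.im)

/-- The inverse of `shear`. -/
def unshear (k₁ k₂ : ℝ) (q : ℝ × ℝ) : ℂ := (q.1 : ℂ) + ((q.2 - k₁ * q.1) / k₂ : ℝ) * Complex.I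

theorem shear_unshear {k₁ k₂ : ℝ} (hk : k₂ ≠ 0) (q : ℝ × ℝ) : shear k₁ k₂ (unshear k₁ k₂ q) = q := by
  ext
  · simp [shear, unshear]
  · simp [shear, unshear]
    field_simp
    ring

theorem unshear_shear {k₁ k₂ : ℝ} (hk : k₂ ≠ 0) (z : ℂ) : unshear k₁ k₂ (shear k₁ k₂ z) = z := by
  apply Complex.ext <;> simp [shear, unshear, hk]

theorem continuous_shear : Continuous fun p : ℝ × ℝ × ℂ => shear p.1 p.2.1 p.2.2 := by
  unfold shear
  fun_prop

theorem continuous_unshear (k₁ k₂ : ℝ) : Continuous (unshear k₁ k₂) := by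
  unfold unshear
  fun_prop

theorem hasDerivAt_shear {k₁ k₂ : ℝ} {z : ℝ → ℂ} {z' : ℂ} {t : ℝ} (hz : HasDerivAt z z' t) :
    HasDerivAt (fun t => shear k₁ k₂ (z t)) (shear k₁ k₂ z') t := by
  have hre : HasDerivAt (fun t => (z t).re) z'.re t := Complex.reCLM.hasFDerivAt.comp_hasDerivAt t hz
  have him : HasDerivAt (fun t => (z t).im) z'.im t := Complex.imCLM.hasFDerivAt.comp_hasDerivAt t hz
  exact hre.prodMk ((hre.const_mul k₁).add (him.const_mul k₂))

theorem hasDerivAt_unshear {k₁ k₂ : ℝ} {q : ℝ → ℝ × ℝ} {q' : ℝ × ℝ} {t : ℝ}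
    (hq : HasDerivAt q q' t) :
    HasDerivAt (fun t => unshear k₁ k₂ (q t)) (unshear k₁ k₂ q') t := by
  have h1 : HasDerivAt (fun t => (q t).1) q'.1 t := (ContinuousLinearMap.fst ℝ ℝ ℝ).hasFDerivAt.comp_hasDerivAt t hq
  have h2 : HasDerivAt (fun t => (q t).2) q'.2 t := (ContinuousLinearMap.snd ℝ ℝ ℝ).hasFDerivAt.comp_hasDerivAt t hq
  exact h1.ofReal_comp.add ((((h2.sub (h1.const_mul k₁)).div_const k₂).ofReal_comp).mul_const _)

/-- In the coordinates `E ν + shear (k₁ ν) (k₂ ν) z`, `z = ρ e ^ (i θ)`, the vector field `F ν` is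
the polar system `ρ' = ρ A ν ρ θ`, `θ' = Θ ν ρ θ`. -/
structure IsPolarForm (F : ℝ → ℝ × ℝ → ℝ × ℝ) (E : ℝ → ℝ × ℝ) (k₁ k₂ : ℝ → ℝ)
    (A Θ : ℝ → ℝ → ℝ → ℝ) (μ₀ ε ρ₀ : ℝ) : Prop where
  cont_E : ContinuousOn E (Icc (μ₀ - ε) (μ₀ + ε))
  cont_k₁ : ContinuousOn k₁ (Icc (μ₀ - ε) (μ₀ + ε))
  cont_k₂ : ContinuousOn k₂ (Icc (μ₀ - ε) (μ₀ + ε))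
  k₂_ne : ∀ ν ∈ Icc (μ₀ - ε) (μ₀ + ε), k₂ ν ≠ 0
  cont_F : ∀ ν ∈ Icc (μ₀ - ε) (μ₀ + ε), ∀ z : ℂ, ‖z‖ ≤ ρ₀ →
    ContinuousAt (F ν) (E ν + shear (k₁ ν) (k₂ ν) z)
  eq_polar : ∀ ν ∈ Icc (μ₀ - ε) (μ₀ + ε), ∀ ρ ∈ Icc 0 ρ₀, ∀ θ : ℝ,
    F ν (E ν + shear (k₁ ν) (k₂ ν) (ρ * Complex.exp (θ * Complex.I))) =
      shear (k₁ ν) (k₂ ν)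
        (ρ * Complex.exp (θ * Complex.I) * (A ν ρ θ + Θ ν ρ θ * Complex.I))

/-! ### From closed polar orbits to periodic solutions in time -/

section

variable {A Θ : ℝ → ℝ → ℝ → ℝ} {μ₀ ω₀ ε ρ₀ K C c D : ℝ}

namespace IsPolarHopf

/-- Parametrization by time of closed curves with radius `R s θ`, on which the angle moves with
speed `Θ`. -/
theorem exists_time_parametrization (H : IsPolarHopf A Θ μ₀ ω₀ ε ρ₀ K C c D) {r : ℝ → ℝ}
    {R : ℝ → ℝ → ℝ} (hr : Continuous r) (hR : Continuous fun q : ℝ × ℝ => R q.1 q.2)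
    (hper : ∀ s, Function.Periodic (R s) (2 * Real.pi)) :
    ∃ (ϑ : ℝ → ℝ → ℝ) (P : ℝ → ℝ), (Continuous fun q : ℝ × ℝ => ϑ q.1 q.2) ∧ Continuous P ∧
      (∀ s, ϑ s 0 = 0) ∧ (∀ s, ϑ s (P s) = 2 * Real.pi) ∧ (∀ s, StrictMono (ϑ s)) ∧
      (∀ s t, ϑ s (t + P s) = ϑ s t + 2 * Real.pi) ∧
      (∀ s t, HasDerivAt (ϑ s) (Θ (r s) (R s (ϑ s t)) (ϑ s t)) t) ∧
      (∀ s (f : ℝ → ℝ), f 0 = 0 → (∀ t, HasDerivAt f (Θ (r s) (R s (f t)) (f t)) t) → f = ϑ s) ∧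
      ∀ s ω, (∀ θ, Θ (r s) (R s θ) θ = ω) → P s = 2 * Real.pi / ω := by
  -- `τ` is dt/dθ on the closed curve and its integral `T s φ` is the time needed to reach the angle
  -- φ. The inverse of `T s` is the angle as a function of time, and `T s (2π)` is the period.
  set τ : ℝ → ℝ → ℝ := fun s θ => (Θ (r s) (R s θ) θ)⁻¹ with hτ
  have hτc : Continuous fun q : ℝ × ℝ => τ q.1 q.2 := by
    refine Continuous.inv₀ ?_ fun q => (H.Θ_pos _ _ _).ne'
    exact H.cont_Θ.comp (f := fun q : ℝ × ℝ => (r q.1, R q.1 q.2, q.2)) (by fun_prop)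
  have hτs : ∀ s, Continuous (τ s) := fun s => by fun_prop
  set T : ℝ → ℝ → ℝ := fun s φ => ∫ θ in (0 : ℝ)..φ, τ s θ with hT
  have hTc : Continuous fun q : ℝ × ℝ => T q.1 q.2 :=
    intervalIntegral.continuous_parametric_intervalIntegral_of_continuous
      (f := fun (q : ℝ × ℝ) θ => τ q.1 θ)
      (hτc.comp (f := fun p : (ℝ × ℝ) × ℝ => (p.1.1, p.2)) (by fun_prop)) continuous_snd
  have hTd : ∀ s φ, HasDerivAt (T s) (τ s φ) φ := fun s φ =>
    intervalIntegral.integral_hasDerivAt_right ((hτs s).intervalIntegrable _ _)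
      (hτs s).aestronglyMeasurable.stronglyMeasurableAtFilter (hτs s).continuousAt
  have hτper : ∀ s, Function.Periodic (τ s) (2 * Real.pi) := fun s θ => by
    simp only [hτ]
    rw [hper s θ, H.periodic_Θ]
  obtain ⟨ϑ, hϑc, hTϑ, hϑT, hmono, hϑd⟩ := exists_continuous_inverse_family
    (inv_pos.2 H.C_pos) hTc hTd fun s θ => inv_anti₀ (H.Θ_pos _ _ _) (H.Θ_le _ _ _)
  have hT0 : ∀ s, T s 0 = 0 := fun s => by simp [hT]
  have hϑ0 : ∀ s, ϑ s 0 = 0 := fun s =>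
    (congrArg (ϑ s) (hT0 s)).symm.trans (hϑT s 0)
  refine ⟨ϑ, fun s => T s (2 * Real.pi), hϑc, by fun_prop, hϑ0, fun s => hϑT _ _, hmono,
    fun s t => ?_, fun s t => by simpa [hτ] using hϑd s t, fun s f hf0 hf => ?_,
    fun s ω hω => ?_⟩
  · have h1 : T s (ϑ s t + 2 * Real.pi) = t + T s (2 * Real.pi) := by
      have h2 : T s (ϑ s t + 2 * Real.pi) = T s (ϑ s t) + ∫ θ in ϑ s t..ϑ s t + 2 * Real.pi, τ s θ :=
        (intervalIntegral.integral_add_adjacent_intervals ((hτs s).intervalIntegrable _ _)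
          ((hτs s).intervalIntegrable _ _)).symm
      rw [h2, hTϑ, (hτper s).intervalIntegral_add_eq (ϑ s t) 0, zero_add]
    rw [← h1, hϑT]
  -- Separation of variables gives uniqueness, although `Θ` is only continuous in the angle.
  · have hd : ∀ t, HasDerivAt (fun t => T s (f t) - t) 0 t := fun t => by
      refine (((hTd s (f t)).comp t (hf t)).sub (hasDerivAt_id t)).congr_deriv ?_
      simp only [hτ]
      rw [inv_mul_cancel₀ (H.Θ_pos _ _ _).ne', sub_self]
    funext t
    have h1 := is_const_of_deriv_eq_zero (fun t => (hd t).differentiableAt)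
      (fun t => (hd t).deriv) t 0
    simp only [hf0, hT0, sub_zero] at h1
    rw [← hϑT s (f t), sub_eq_zero.1 h1]
  · simp [hT, hτ, hω, div_eq_mul_inv]

/-- Allows passing from `Complex.arg`, which jumps, to a continuous choice of the angle. -/
theorem eq_of_angle (H : IsPolarHopf A Θ μ₀ ω₀ ε ρ₀ K C c D) (ν ρ : ℝ) {θ θ' : ℝ}
    (h : ∃ n : ℤ, θ = θ' + n * (2 * Real.pi)) : A ν ρ θ = A ν ρ θ' ∧ Θ ν ρ θ = Θ ν ρ θ' := by
  obtain ⟨n, rfl⟩ := h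
  exact ⟨(H.periodic_A ν ρ).int_mul n θ', (H.periodic_Θ ν ρ).int_mul n θ'⟩

/-- A small periodic solution of a vector field in polar form runs along a closed polar orbit. -/
theorem exists_closed_orbit_of_periodic (H : IsPolarHopf A Θ μ₀ ω₀ ε ρ₀ K C c D)
    {F : ℝ → ℝ × ℝ → ℝ × ℝ} {E : ℝ → ℝ × ℝ} {k₁ k₂ : ℝ → ℝ}
    (hF : IsPolarForm F E k₁ k₂ A Θ μ₀ ε ρ₀) {ν : ℝ} (hν : ν ∈ Icc (μ₀ - ε) (μ₀ + ε))
    {z : ℝ → ℂ} (hz : ∀ t, ‖z t‖ ≤ ρ₀)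
    (hv : IsIntegralCurve (fun t => E ν + shear (k₁ ν) (k₂ ν) (z t)) fun _ => F ν)
    {P : ℝ} (hP : 0 < P) (hzP : Function.Periodic z P) (hne : ∃ t, z t ≠ 0) :
    ∃ (Z f : ℝ → ℝ) (t₀ : ℝ), IsPolarOrbit A Θ ν Z ∧ Function.Periodic Z (2 * Real.pi) ∧
      Real.exp (Z 0) = ‖z t₀‖ ∧ f 0 = 0 ∧
      (∀ t, HasDerivAt f (Θ ν (Real.exp (Z (f t))) (f t)) t) ∧
      ∀ t, z (t₀ + t) = Real.exp (Z (f t)) * Complex.exp (f t * Complex.I) := by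
  have hk := hF.k₂_ne ν hν
  set q : ℝ → ℂ := fun t => A ν ‖z t‖ (z t).arg + Θ ν ‖z t‖ (z t).arg * Complex.I with hq
  have hFv : ∀ t, F ν (E ν + shear (k₁ ν) (k₂ ν) (z t)) = shear (k₁ ν) (k₂ ν) (z t * q t) :=
    fun t => by
      have := hF.eq_polar ν hν ‖z t‖ ⟨norm_nonneg _, hz t⟩ (z t).arg
      rwa [Complex.norm_mul_exp_arg_mul_I] at this
  have hz' : ∀ t, HasDerivAt z (z t * q t) t := fun t => by
    have h1 := (hv t).const_add (-E ν)
    simp only [neg_add_cancel_left] at h1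
    have h2 := hasDerivAt_unshear (k₁ := k₁ ν) (k₂ := k₂ ν) h1
    rw [hFv, unshear_shear hk] at h2
    simpa only [unshear_shear hk] using h2
  have hzc : Continuous z := continuous_iff_continuousAt.2 fun t => (hz' t).continuousAt
  have hqb : ∀ t, ‖q t‖ ≤ 2 * C := fun t => by
    have h1 := H.abs_A_le ν ‖z t‖ (z t).arg
    have h2 := H.Θ_le ν ‖z t‖ (z t).arg
    have h3 := (H.Θ_pos ν ‖z t‖ (z t).arg).le
    refine (norm_add_le _ _).trans ?_
    rw [norm_mul, Complex.norm_I, mul_one, Complex.norm_real, Complex.norm_real, Real.norm_eq_abs,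
      Real.norm_eq_abs, abs_of_nonneg h3]
    linarith
  -- As z' = zq with q bounded, a zero would persist at all later times, among them t' + nP, where z
  -- takes the nonzero value z(t').
  have hz0 : ∀ t, z t ≠ 0 := by
    intro t ht
    obtain ⟨t', ht'⟩ := hne
    obtain ⟨n, hn⟩ := exists_nat_ge ((t - t') / P)
    have hle : t ≤ t' + n * P := by
      rw [div_le_iff₀ hP] at hn
      linarith
    have := eq_zero_of_abs_deriv_le_mul_abs_self_of_eq_zero_right (f := z) (K := 2 * C)
      (a := t) (b := t' + n * P) hzc.continuousOn (fun x _ => (hz' x).hasDerivWithinAt) ht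
      (fun x _ => by
        rw [norm_mul, mul_comm]
        exact mul_le_mul_of_nonneg_right (hqb x) (norm_nonneg _)) _ ⟨hle, le_rfl⟩
    rw [hzP.nat_mul n t'] at this
    exact ht' this
  have hqc : Continuous q := by
    -- The definition of `q` uses the discontinuous `arg`; its continuity is read off from q = z'/z.
    have h1 : q = fun t => unshear (k₁ ν) (k₂ ν) (F ν (E ν + shear (k₁ ν) (k₂ ν) (z t))) / z t := by
      funext t
      rw [hFv, unshear_shear hk, mul_div_cancel_left₀ _ (hz0 t)]
    rw [h1]
    refine Continuous.div ?_ hzc hz0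
    have h2 : Continuous fun t => F ν (E ν + shear (k₁ ν) (k₂ ν) (z t)) :=
      continuous_iff_continuousAt.2 fun t =>
        (hF.cont_F ν hν (z t) (hz t)).comp (f := fun t => E ν + shear (k₁ ν) (k₂ ν) (z t))
          (by unfold shear; fun_prop)
    exact (continuous_unshear _ _).comp h2
  obtain ⟨w, hw, hzw⟩ := exists_log_of_hasDerivAt_mul hqc hz' (hz0 0)
  set y : ℝ → ℝ := fun t => (w t).re with hy
  set θ : ℝ → ℝ := fun t => (w t).im with hθ
  have hzyθ : ∀ t, z t = Real.exp (y t) * Complex.exp (θ t * Complex.I) := fun t => by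
    rw [hzw, Complex.ofReal_exp, ← Complex.exp_add, Complex.re_add_im]
  have hnorm : ∀ t, ‖z t‖ = Real.exp (y t) := fun t => by rw [hzw, Complex.norm_exp]
  have hang : ∀ t, A ν ‖z t‖ (z t).arg = A ν (Real.exp (y t)) (θ t) ∧
      Θ ν ‖z t‖ (z t).arg = Θ ν (Real.exp (y t)) (θ t) := fun t => by
    rw [hnorm]
    refine H.eq_of_angle ν _ ?_
    have h1 := Complex.norm_mul_exp_arg_mul_I (z t)
    rw [hnorm] at h1
    nth_rewrite 2 [hzyθ] at h1
    have h2 := mul_left_cancel₀ (by exact_mod_cast (Real.exp_pos _).ne') h1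
    obtain ⟨n, hn⟩ := Complex.exp_eq_exp_iff_exists_int.1 h2
    refine ⟨n, ?_⟩
    have := congrArg Complex.im hn
    simpa using this
  have hyd : ∀ t, HasDerivAt y (A ν (Real.exp (y t)) (θ t)) t := fun t => by
    have : HasDerivAt y (q t).re t := Complex.reCLM.hasFDerivAt.comp_hasDerivAt t (hw t)
    rwa [← (hang t).1, show (q t).re = A ν ‖z t‖ (z t).arg by simp [hq]] at *
  have hθd : ∀ t, HasDerivAt θ (Θ ν (Real.exp (y t)) (θ t)) t := fun t => by
    have : HasDerivAt θ (q t).im t := Complex.imCLM.hasFDerivAt.comp_hasDerivAt t (hw t)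
    rwa [← (hang t).2, show (q t).im = Θ ν ‖z t‖ (z t).arg by simp [hq]] at *
  have hθc : Continuous θ := continuous_iff_continuousAt.2 fun t => (hθd t).continuousAt
  -- The angle has speed at least `c`, hence is invertible; `σ` is the time as a function of the
  -- angle and y ∘ σ is a polar orbit.
  obtain ⟨σ', -, hθσ', hσθ', -, hσd'⟩ := exists_continuous_inverse_family (X := Unit)
    (T := fun _ => θ) (τ := fun _ t => Θ ν (Real.exp (y t)) (θ t)) H.c_pos
    (hθc.comp continuous_snd) (fun _ t => hθd t) fun _ t => H.le_Θ _ _ _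
  set σ := σ' ()
  have hθσ : ∀ x, θ (σ x) = x := hθσ' ()
  have hσθ : ∀ t, σ (θ t) = t := hσθ' ()
  have hθmono : StrictMono θ := strictMono_of_hasDerivAt_pos hθd fun t => H.Θ_pos _ _ _
  have hZ : IsPolarOrbit A Θ ν fun x => y (σ x) := fun x => by
    refine ((hyd (σ x)).comp x (hσd' () x)).congr_deriv ?_
    change _ * (Θ ν (Real.exp (y (σ x))) (θ (σ x)))⁻¹ = _
    simp only [hθσ, polarRate, div_eq_mul_inv]
  -- After time `P` the point returns with the same radius and its angle has advanced by `n` > 0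
  -- turns; monotonicity of the return map reduces `n` turns to one.
  have hZper : Function.Periodic (fun x => y (σ x)) (2 * Real.pi) := by
    have h1 := hzP (σ 0)
    rw [hzw, hzw] at h1
    obtain ⟨n, hn⟩ := Complex.exp_eq_exp_iff_exists_int.1 h1
    have hre : y (σ 0 + P) = y (σ 0) := by simpa using congrArg Complex.re hn
    have him : θ (σ 0 + P) = 0 + n * (2 * Real.pi) := by
      have h2 : θ (σ 0 + P) = θ (σ 0) + n * (2 * Real.pi) := by
        simpa using congrArg Complex.im hn
      rwa [hθσ] at h2
    have hpos : 0 < n := by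
      have h2 := hθmono (lt_add_of_pos_right (σ 0) hP)
      rw [him, hθσ, zero_add] at h2
      have h3 := (mul_pos_iff_of_pos_right (by positivity)).1 h2
      exact_mod_cast h3
    lift n to ℕ using hpos.le
    refine H.orbit_periodic_of_iterate hZ (k := n) (by exact_mod_cast hpos) (θ₀ := 0) ?_
    have h4 : (0 : ℝ) + n * (2 * Real.pi) = θ (σ 0 + P) := by rw [him]; simp
    simp only [h4, hσθ, hre]
  refine ⟨fun x => y (σ x), fun t => θ (σ 0 + t), σ 0, hZ, hZper, (hnorm _).symm, ?_,
    fun t => ?_, fun t => ?_⟩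
  · simp only [add_zero, hθσ]
  · simp only [hσθ]
    simpa using (hθd (σ 0 + t)).comp_const_add (σ 0) t
  · simp only [hσθ]
    exact hzyθ _

/-- Hopf bifurcation for a vector field in polar form. -/
theorem exists_isPeriodicBranch (H : IsPolarHopf A Θ μ₀ ω₀ ε ρ₀ K C c D)
    {F : ℝ → ℝ × ℝ → ℝ × ℝ} {E : ℝ → ℝ × ℝ} {k₁ k₂ : ℝ → ℝ}
    (hF : IsPolarForm F E k₁ k₂ A Θ μ₀ ε ρ₀) {U : Set (ℝ × ℝ)} (hU : U ∈ 𝓝 (E μ₀)) :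
    ∃ (s₀ : ℝ) (μ P : ℝ → ℝ) (u : ℝ → ℝ → ℝ × ℝ),
      IsPeriodicBranch F (E μ₀) μ₀ (2 * Real.pi / ω₀) s₀ μ P u ∧
      ∀ s ∈ Ioo 0 s₀, ∀ t, u s t ∈ U := by
  have hε := H.ε_pos
  have hρ₀ := H.ρ₀_pos
  have hwin : Icc (μ₀ - ε) (μ₀ + ε) ∈ 𝓝 μ₀ := Icc_mem_nhds (by linarith) (by linarith)
  have mem : ∀ {ν}, |ν - μ₀| ≤ ε → ν ∈ Icc (μ₀ - ε) (μ₀ + ε) := fun h => by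
    have := abs_le.1 h
    constructor <;> linarith [this.1, this.2]
  have hEc := hF.cont_E.continuousAt hwin
  have hk₁c := hF.cont_k₁.continuousAt hwin
  have hk₂c := hF.cont_k₂.continuousAt hwin
  have hk₂0 := hF.k₂_ne μ₀ (mem (by simpa using hε.le))
  have comp_fst : ∀ {α β : Type} [TopologicalSpace α] [TopologicalSpace β] {g : ℝ → α} {b : β},
      ContinuousAt g μ₀ → ContinuousAt (fun p : ℝ × β => g p.1) (μ₀, b) := fun h =>
    ContinuousAt.comp (f := Prod.fst) h continuousAt_fst
  -- small radii stay in `U`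
  obtain ⟨δ, hδ, hδU⟩ : ∃ δ > 0, ∀ ν (z : ℂ), |ν - μ₀| < δ → ‖z‖ < δ →
      E ν + shear (k₁ ν) (k₂ ν) z ∈ U := by
    have hc : ContinuousAt (fun p : ℝ × ℂ => E p.1 + shear (k₁ p.1) (k₂ p.1) p.2) (μ₀, 0) := by
      have h1 := comp_fst (b := (0 : ℂ)) hEc
      have h2 := comp_fst (b := (0 : ℂ)) hk₁c
      have h3 := comp_fst (b := (0 : ℂ)) hk₂c
      unfold shear
      fun_prop
    have hU' : U ∈ 𝓝 ((fun p : ℝ × ℂ => E p.1 + shear (k₁ p.1) (k₂ p.1) p.2) (μ₀, 0)) := by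
      have h0 : E μ₀ + shear (k₁ μ₀) (k₂ μ₀) 0 = E μ₀ := by ext <;> simp [shear]
      simpa only [h0] using hU
    obtain ⟨δ, hδ, h⟩ := Metric.mem_nhds_iff.1 (hc hU')
    refine ⟨δ, hδ, fun ν z h1 h2 => ?_⟩
    refine h (show (ν, z) ∈ Metric.ball (μ₀, (0 : ℂ)) δ from ?_)
    rw [Metric.mem_ball, Prod.dist_eq, max_lt_iff, Real.dist_eq, dist_zero_right]
    exact ⟨h1, h2⟩
  obtain ⟨s₀, hs₀, r, Y, hr, hr0, hY, huniq, hRc⟩ := H.exists_closed_orbits (lt_min hδ hρ₀)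
  set s₁ := s₀ / 2 with hs₁def
  have hs₁ : 0 < s₁ := by positivity
  -- Clamping to [0, s₀/2] extends the family continuously to all real `s`, as the time
  -- parametrization requires.
  set κ : ℝ → ℝ := fun s => max 0 (min s s₁) with hκ
  have hκc : Continuous κ := by fun_prop
  have hκmem : ∀ s, κ s ∈ Ico 0 s₀ := fun s =>
    ⟨le_max_left _ _, max_lt hs₀ ((min_le_right _ _).trans_lt (by linarith))⟩
  have hκeq : ∀ s ∈ Ico 0 s₁, κ s = s := fun s hs => by
    simp only [hκ]
    rw [min_eq_left hs.2.le, max_eq_right hs.1]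
  have hIoo : ∀ {s}, s ∈ Ico 0 s₀ → s ≠ 0 → s ∈ Ioo 0 s₀ := fun hs h =>
    ⟨lt_of_le_of_ne hs.1 (Ne.symm h), hs.2⟩
  set r' : ℝ → ℝ := fun s => r (κ s) with hr'
  set R : ℝ → ℝ → ℝ := fun s θ => if κ s = 0 then 0 else Real.exp (Y (κ s) θ) with hRdef
  have hr'c : Continuous r' := hr.comp_continuous hκc hκmem
  have hR'c : Continuous fun q : ℝ × ℝ => R q.1 q.2 :=
    hRc.comp_continuous (f := fun q : ℝ × ℝ => (κ q.1, q.2)) (by fun_prop)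
      fun q => ⟨hκmem q.1, trivial⟩
  have hRper : ∀ s, Function.Periodic (R s) (2 * Real.pi) := fun s θ => by
    simp only [hRdef]
    split_ifs with h
    · rfl
    · rw [(hY _ (hIoo (hκmem s) h)).2.2.2.2.1 θ]
  have hr'ε : ∀ s, |r' s - μ₀| < ε := fun s => by
    by_cases h : κ s = 0
    · simp only [hr', h, hr0, sub_self, abs_zero]; exact hε
    · exact (hY _ (hIoo (hκmem s) h)).1
  obtain ⟨ϑ, P, hϑc, hPc, hϑ0, hϑP, hϑmono, hϑadd, hϑd, hϑuniq, hPconst⟩ :=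
    H.exists_time_parametrization hr'c hR'c hRper
  set u : ℝ → ℝ → ℝ × ℝ := fun s t => E (r' s) + shear (k₁ (r' s)) (k₂ (r' s))
    (R s (ϑ s t) * Complex.exp (ϑ s t * Complex.I)) with hu
  have hκ0 : κ 0 = 0 := hκeq 0 ⟨le_rfl, hs₁⟩
  have hr'0 : r' 0 = μ₀ := by simp only [hr', hκ0, hr0]
  have hR0 : ∀ θ, R 0 θ = 0 := fun θ => if_pos hκ0
  have hRpos : ∀ s ∈ Ioo 0 s₁, ∀ θ, R s θ = Real.exp (Y s θ) := fun s hs θ => by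
    simp only [hRdef, hκeq s (Ioo_subset_Ico_self hs)]
    rw [if_neg hs.1.ne']
  have hr's : ∀ s ∈ Ioo 0 s₁, r' s = r s := fun s hs => by
    simp only [hr', hκeq s (Ioo_subset_Ico_self hs)]
  have hs₁s₀ : ∀ s ∈ Ioo 0 s₁, s ∈ Ioo 0 s₀ := fun s hs => ⟨hs.1, by linarith [hs.2]⟩
  have huc : Continuous fun q : ℝ × ℝ => u q.1 q.2 := by
    have h1 : Continuous fun s => E (r' s) := hF.cont_E.comp_continuous hr'c fun s => mem (hr'ε s).le
    have h2 : Continuous fun s => k₁ (r' s) :=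
      hF.cont_k₁.comp_continuous hr'c fun s => mem (hr'ε s).le
    have h3 : Continuous fun s => k₂ (r' s) :=
      hF.cont_k₂.comp_continuous hr'c fun s => mem (hr'ε s).le
    have h4 : Continuous fun q : ℝ × ℝ => R q.1 (ϑ q.1 q.2) :=
      hR'c.comp (f := fun q : ℝ × ℝ => (q.1, ϑ q.1 q.2)) (by fun_prop)
    exact (h1.comp continuous_fst).add (continuous_shear.comp
      (f := fun q : ℝ × ℝ => (k₁ (r' q.1), k₂ (r' q.1),
        (R q.1 (ϑ q.1 q.2) : ℂ) * Complex.exp (ϑ q.1 q.2 * Complex.I)))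
      ((h2.comp continuous_fst).prodMk ((h3.comp continuous_fst).prodMk
        ((Complex.continuous_ofReal.comp h4).mul
          (((Complex.continuous_ofReal.comp hϑc).mul continuous_const).cexp)))))
  have huexp : ∀ s ∈ Ioo 0 s₁, ∀ t, ((R s (ϑ s t) : ℝ) : ℂ) * Complex.exp (ϑ s t * Complex.I) =
      Complex.exp (Y s (ϑ s t) + ϑ s t * Complex.I) := fun s hs t => by
    rw [hRpos s hs, Complex.exp_add, Complex.ofReal_exp]
  have hsol : ∀ s ∈ Ioo 0 s₁, IsIntegralCurve (u s) fun _ => F (r' s) := fun s hs t => by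
    obtain ⟨-, -, -, horb, -, hlt⟩ := hY s (hs₁s₀ s hs)
    have hY' : HasDerivAt (fun t => Y s (ϑ s t)) (A (r' s) (R s (ϑ s t)) (ϑ s t)) t := by
      refine ((horb (ϑ s t)).comp t (hϑd s t)).congr_deriv ?_
      simp only [hRpos s hs, hr's s hs, polarRate]
      rw [div_mul_cancel₀ _ (H.Θ_pos _ _ _).ne']
    have hw := (hY'.ofReal_comp.add ((hϑd s t).ofReal_comp.mul_const Complex.I)).cexp
    have hw2 := (hasDerivAt_shear (k₁ := k₁ (r' s)) (k₂ := k₂ (r' s)) hw).const_add (E (r' s))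
    have hpol := hF.eq_polar (r' s) (mem (hr'ε s).le) (R s (ϑ s t))
      ⟨by rw [hRpos s hs]; exact (Real.exp_pos _).le,
        by rw [hRpos s hs]; exact ((hlt _).trans_le (min_le_right _ _)).le⟩ (ϑ s t)
    have hus : u s = fun t => E (r' s) + shear (k₁ (r' s)) (k₂ (r' s))
        (Complex.exp (Y s (ϑ s t) + ϑ s t * Complex.I)) := by
      funext t
      simp only [hu, huexp s hs t]
    have hut : F (r' s) (u s t) = shear (k₁ (r' s)) (k₂ (r' s))
        (Complex.exp (Y s (ϑ s t) + ϑ s t * Complex.I) *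
          (A (r' s) (R s (ϑ s t)) (ϑ s t) + Θ (r' s) (R s (ϑ s t)) (ϑ s t) * Complex.I)) := by
      rw [← huexp s hs t, ← hpol]
    change HasDerivAt (u s) (F (r' s) (u s t)) t
    rw [hut, hus]
    exact hw2
  refine ⟨s₁, r', P, u, ⟨hs₁, hr'c.continuousOn, hPc.continuousOn, huc.continuousOn, hr'0, ?_, ?_,
    hsol, ?_, ?_, ?_, ?_⟩, ?_⟩
  · exact hPconst 0 ω₀ fun θ => by rw [hr'0, hR0, H.Θ_zero]
  · intro t
    simp only [hu, hR0, hr'0]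
    simp [shear]
  · intro s _
    rw [← (hϑmono s).lt_iff_lt, hϑ0, hϑP]
    positivity
  · intro s _ t
    simp only [hu]
    rw [hϑadd, hRper s]
    have : Complex.exp (((ϑ s t + 2 * Real.pi : ℝ) : ℂ) * Complex.I) =
        Complex.exp (ϑ s t * Complex.I) := by
      push_cast
      rw [add_mul, Complex.exp_add, Complex.exp_two_pi_mul_I, mul_one]
    rw [this]
  -- For 0 < P' < P the angle at time P' lies strictly between 0 and 2π, so it is not a whole number
  -- of turns.
  · intro s hs P' hP' hP'P hper
    have h1 := hper 0
    rw [zero_add] at h1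
    simp only [hu] at h1
    have h2 := congrArg (unshear (k₁ (r' s)) (k₂ (r' s))) (add_left_cancel h1)
    have hk := hF.k₂_ne (r' s) (mem (hr'ε s).le)
    rw [unshear_shear hk, unshear_shear hk, huexp s hs, huexp s hs, hϑ0] at h2
    obtain ⟨n, hn⟩ := Complex.exp_eq_exp_iff_exists_int.1 h2
    have h3 : ϑ s P' = n * (2 * Real.pi) := by simpa using congrArg Complex.im hn
    have h4 : 0 < ϑ s P' := by rw [← hϑ0 s]; exact hϑmono s hP'
    have h5 : ϑ s P' < 2 * Real.pi := by rw [← hϑP s]; exact hϑmono s hP'P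
    rw [h3] at h4 h5
    have h6 : (0 : ℝ) < n := (mul_pos_iff_of_pos_right (by positivity)).1 h4
    have h7 : (n : ℝ) < 1 := by
      have : (0 : ℝ) < 2 * Real.pi := by positivity
      nlinarith
    have h8 : 0 < n := by exact_mod_cast h6
    have h9 : n < 1 := by exact_mod_cast h7
    omega
  · have hc : ContinuousAt (fun p : ℝ × (ℝ × ℝ) => unshear (k₁ p.1) (k₂ p.1) (p.2 - E p.1))
        (μ₀, E μ₀) := by
      have h1 := comp_fst (b := E μ₀) hEc
      have h2 := comp_fst (b := E μ₀) hk₁c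
      have h3 := comp_fst (b := E μ₀) hk₂c
      unfold unshear
      fun_prop (disch := exact hk₂0)
    have hm : Metric.ball (0 : ℂ) (min s₁ ρ₀) ∈ 𝓝 ((fun p : ℝ × (ℝ × ℝ) =>
        unshear (k₁ p.1) (k₂ p.1) (p.2 - E p.1)) (μ₀, E μ₀)) := by
      simpa [unshear] using! Metric.ball_mem_nhds (0 : ℂ) (lt_min hs₁ hρ₀)
    obtain ⟨η, hη, hηz⟩ := Metric.mem_nhds_iff.1 (hc hm)
    refine ⟨min η ε, lt_min hη hε, fun ν hν v hv hvη hvP hvne => ?_⟩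
    have hνε : |ν - μ₀| ≤ ε := (hν.trans_le (min_le_right _ _)).le
    have hk := hF.k₂_ne ν (mem hνε)
    set z : ℝ → ℂ := fun t => unshear (k₁ ν) (k₂ ν) (v t - E ν) with hz
    have hzlt : ∀ t, ‖z t‖ < min s₁ ρ₀ := fun t => by
      have : (ν, v t) ∈ Metric.ball (μ₀, E μ₀) η := by
        rw [Metric.mem_ball, Prod.dist_eq, max_lt_iff, Real.dist_eq]
        exact ⟨hν.trans_le (min_le_left _ _), (hvη t).trans_le (min_le_left _ _)⟩
      have := hηz this
      rwa [mem_preimage, mem_ball_zero_iff] at this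
    have hvz : ∀ t, v t = E ν + shear (k₁ ν) (k₂ ν) (z t) := fun t => by
      rw [hz]
      simp only [shear_unshear hk, add_sub_cancel]
    obtain ⟨P', hP', hvP⟩ := hvP
    have hzP : Function.Periodic z P' := fun t => by simp only [hz, hvP t]
    have hzne : ∃ t, z t ≠ 0 := by
      by_contra! h0
      obtain ⟨t, t', h⟩ := hvne
      exact h (by rw [hvz, hvz t', h0, h0])
    obtain ⟨Z, f, t₀, hZ, hZper, hZ0, hf0, hf, hzf⟩ := H.exists_closed_orbit_of_periodic hF
      (mem hνε) (fun t => ((hzlt t).trans_le (min_le_right _ _)).le)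
      (by rw [← funext hvz]; exact hv) hP' hzP hzne
    set s := Real.exp (Z 0) with hs
    have hsmem : s ∈ Ioo 0 s₁ :=
      ⟨Real.exp_pos _, by rw [hZ0]; exact (hzlt t₀).trans_le (min_le_left _ _)⟩
    obtain ⟨hrs, hYs⟩ := huniq ν Z hνε hZ hZper (hs₁s₀ s hsmem).2
    have hr's' : r' s = ν := by rw [hr's s hsmem, hrs]
    have hfϑ : f = ϑ s := hϑuniq s f hf0 fun t => by
      rw [hr's', hRpos s hsmem, hYs]
      exact hf t
    -- `t₀` is a time at which the given solution has angle 0, where the branch is parametrized by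
    -- its radius.
    refine ⟨s, hsmem, hr's', -t₀, fun t => ?_⟩
    have h1 := hzf (t + -t₀)
    rw [add_comm t, add_neg_cancel_left] at h1
    rw [hvz, h1, hfϑ]
    simp only [hu, hr's', hRpos s hsmem, add_comm t]
    rw [hYs]
  · intro s hs t
    obtain ⟨-, hrδ, -, -, -, hlt⟩ := hY s (hs₁s₀ s hs)
    refine hδU _ _ ?_ ?_
    · rw [hr's s hs]; exact hrδ.trans_le (min_le_left _ _)
    · rw [norm_mul, Complex.norm_exp_ofReal_mul_I, mul_one, Complex.norm_real, Real.norm_eq_abs,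
        hRpos s hs, abs_of_pos (Real.exp_pos _)]
      exact (hlt _).trans_le (min_le_left _ _)

end IsPolarHopf

end

/-! ### Cutting off a polar system near radius zero -/

/-- Local Lipschitz bound and local approximation by the linearization, uniform in the angle. -/
theorem exists_uniform_strict_bound {h : ℝ × ℝ × ℝ → ℝ} {μ₀ D η : ℝ} (hη : 0 < η)
    (hh : ∀ θ, ContDiffAt ℝ 1 h (μ₀, 0, θ))
    (hD : ∀ θ, HasDerivAt (fun ν => h (ν, 0, θ)) D μ₀) :
    ∃ K, 0 ≤ K ∧ ∀ᶠ x : (ℝ × ℝ) × (ℝ × ℝ) in 𝓝 ((μ₀, 0), (μ₀, 0)), ∀ θ ∈ Icc 0 (2 * Real.pi),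
      |h (x.1.1, x.1.2, θ) - h (x.2.1, x.2.2, θ)| ≤ K * (|x.1.2 - x.2.2| + |x.1.1 - x.2.1|) ∧
      |h (x.1.1, x.1.2, θ) - h (x.2.1, x.1.2, θ) - D * (x.1.1 - x.2.1)| ≤
        η * |x.1.1 - x.2.1| := by
  have hfc : ContinuousOn (fun θ => fderiv ℝ h (μ₀, 0, θ)) (Icc 0 (2 * Real.pi)) := fun θ _ => by
    refine ContinuousAt.continuousWithinAt ?_
    have h1 : ContinuousAt (fderiv ℝ h) (μ₀, 0, θ) :=
      ((hh θ).fderiv_right (m := 0) le_rfl).continuousAt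
    exact ContinuousAt.comp (f := fun θ : ℝ => (μ₀, (0 : ℝ), θ)) h1 (by fun_prop)
  obtain ⟨K, hK⟩ := isCompact_Icc.exists_bound_of_continuousOn hfc
  refine ⟨max K 0 + η, by positivity, isCompact_Icc.eventually_forall_of_forall_eventually
    fun θ hθ => ?_⟩
  -- Strict differentiability yields both bounds: a Lipschitz constant ‖h'‖ + η, and, for pairs
  -- differing only in ν, approximation by the partial derivative `D`. Compactness of the angle
  -- interval makes both uniform.
  have hstrict : HasStrictFDerivAt h (fderiv ℝ h (μ₀, 0, θ)) (μ₀, 0, θ) :=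
    (hh θ).hasStrictFDerivAt one_ne_zero
  have hpart : fderiv ℝ h (μ₀, 0, θ) (1, 0, 0) = D := by
    have h1 : HasDerivAt (fun ν : ℝ => (ν, (0 : ℝ), θ)) (1, 0, 0) μ₀ :=
      (hasDerivAt_id μ₀).prodMk ((hasDerivAt_const _ _).prodMk (hasDerivAt_const _ _))
    exact (hstrict.hasFDerivAt.comp_hasDerivAt μ₀ h1).unique (hD θ)
  have hsmall := hstrict.isLittleO.def hη
  have htend : Tendsto (fun p : ((ℝ × ℝ) × (ℝ × ℝ)) × ℝ =>
      ((p.1.1.1, p.1.1.2, p.2), (p.1.2.1, p.1.2.2, p.2)))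
      (𝓝 (((μ₀, 0), (μ₀, 0)), θ)) (𝓝 ((μ₀, 0, θ), (μ₀, 0, θ))) :=
    Continuous.tendsto' (by fun_prop) _ _ rfl
  have htend2 : Tendsto (fun p : ((ℝ × ℝ) × (ℝ × ℝ)) × ℝ =>
      ((p.1.1.1, p.1.1.2, p.2), (p.1.2.1, p.1.1.2, p.2)))
      (𝓝 (((μ₀, 0), (μ₀, 0)), θ)) (𝓝 ((μ₀, 0, θ), (μ₀, 0, θ))) :=
    Continuous.tendsto' (by fun_prop) _ _ rfl
  filter_upwards [htend.eventually hsmall, htend2.eventually hsmall] with p h1 h2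
  constructor
  · have h3 : ‖((p.1.1.1, p.1.1.2, p.2) : ℝ × ℝ × ℝ) - (p.1.2.1, p.1.2.2, p.2)‖ ≤
        |p.1.1.2 - p.1.2.2| + |p.1.1.1 - p.1.2.1| := by
      simp only [Prod.mk_sub_mk, sub_self, Prod.norm_def, Real.norm_eq_abs, abs_zero]
      refine max_le (le_add_of_nonneg_left (abs_nonneg _)) (max_le ?_ (by positivity))
      exact le_add_of_nonneg_right (abs_nonneg _)
    have h4 := (fderiv ℝ h (μ₀, 0, θ)).le_opNorm ((p.1.1.1, p.1.1.2, p.2) - (p.1.2.1, p.1.2.2, p.2))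
    have h5 : ‖fderiv ℝ h (μ₀, 0, θ)‖ ≤ max K 0 := (hK θ hθ).trans (le_max_left _ _)
    rw [← Real.norm_eq_abs]
    calc _ = ‖(h (p.1.1.1, p.1.1.2, p.2) - h (p.1.2.1, p.1.2.2, p.2) - fderiv ℝ h (μ₀, 0, θ)
            ((p.1.1.1, p.1.1.2, p.2) - (p.1.2.1, p.1.2.2, p.2))) + fderiv ℝ h (μ₀, 0, θ)
            ((p.1.1.1, p.1.1.2, p.2) - (p.1.2.1, p.1.2.2, p.2))‖ := by rw [sub_add_cancel]
      _ ≤ _ := (norm_add_le _ _).trans (add_le_add h1 h4)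
      _ ≤ (max K 0 + η) * ‖((p.1.1.1, p.1.1.2, p.2) : ℝ × ℝ × ℝ) - (p.1.2.1, p.1.2.2, p.2)‖ := by
          rw [add_mul, add_comm]
          gcongr
      _ ≤ _ := by gcongr
  · have h3 : ((p.1.1.1, p.1.1.2, p.2) : ℝ × ℝ × ℝ) - (p.1.2.1, p.1.1.2, p.2) =
        (p.1.1.1 - p.1.2.1) • ((1, 0, 0) : ℝ × ℝ × ℝ) := by ext <;> simp
    simp only [h3, map_smul, hpart, smul_eq_mul] at h2
    rw [norm_smul] at h2
    simpa [Prod.norm_def, mul_comm D] using h2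

/-- Clamping the parameter and the radius of a polar system that is `C¹` near radius zero. -/
theorem exists_isPolarHopf {A Θ : ℝ → ℝ → ℝ → ℝ} {β ω : ℝ → ℝ} {μ₀ β' ω' : ℝ}
    (hA : ∀ θ, ContDiffAt ℝ 1 (fun q : ℝ × ℝ × ℝ => A q.1 q.2.1 q.2.2) (μ₀, 0, θ))
    (hΘ : ∀ θ, ContDiffAt ℝ 1 (fun q : ℝ × ℝ × ℝ => Θ q.1 q.2.1 q.2.2) (μ₀, 0, θ))
    (hAper : ∀ ν ρ, Function.Periodic (A ν ρ) (2 * Real.pi))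
    (hΘper : ∀ ν ρ, Function.Periodic (Θ ν ρ) (2 * Real.pi))
    (hA0 : ∀ ν θ, A ν 0 θ = β ν) (hΘ0 : ∀ ν θ, Θ ν 0 θ = ω ν) (hβ : HasDerivAt β β' μ₀)
    (hω : HasDerivAt ω ω' μ₀) (hβ0 : β μ₀ = 0) (hω0 : 0 < ω μ₀) (hβ' : β' ≠ 0) :
    ∃ e₀ > 0, ∀ e, 0 < e → e ≤ e₀ → ∃ (A' Θ' : ℝ → ℝ → ℝ → ℝ) (K C c D : ℝ),
      IsPolarHopf A' Θ' μ₀ (ω μ₀) e e K C c D ∧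
      ∀ ν ∈ Icc (μ₀ - e) (μ₀ + e), ∀ ρ ∈ Icc 0 e, ∀ θ, A' ν ρ θ = A ν ρ θ ∧ Θ' ν ρ θ = Θ ν ρ θ := by
  -- The derivative of β/ω at μ₀, as β vanishes there.
  set D := β' / ω μ₀ with hD
  have hD0 : D ≠ 0 := div_ne_zero hβ' hω0.ne'
  set h : ℝ × ℝ × ℝ → ℝ := fun q => polarRate A Θ q.1 q.2.1 q.2.2 with hh
  have hhC : ∀ θ, ContDiffAt ℝ 1 h (μ₀, 0, θ) := fun θ =>
    (hA θ).div (hΘ θ) (by simp only [hΘ0]; exact hω0.ne')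
  have hhD : ∀ θ, HasDerivAt (fun ν => h (ν, 0, θ)) D μ₀ := fun θ => by
    have h1 : (fun ν => h (ν, 0, θ)) = fun ν => β ν / ω ν := by
      funext ν
      simp only [hh, polarRate, hA0, hΘ0]
    rw [h1]
    refine (hβ.div hω hω0.ne').congr_deriv ?_
    rw [hβ0, hD]
    field_simp
    ring
  obtain ⟨K, hK, hev⟩ := exists_uniform_strict_bound (half_pos (abs_pos.2 hD0)) hhC hhD
  have hloc : ∀ᶠ x : ℝ × ℝ in 𝓝 (μ₀, 0), ∀ θ ∈ Icc 0 (2 * Real.pi),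
      ContinuousAt (fun q : ℝ × ℝ × ℝ => A q.1 q.2.1 q.2.2) (x.1, x.2, θ) ∧
      ContinuousAt (fun q : ℝ × ℝ × ℝ => Θ q.1 q.2.1 q.2.2) (x.1, x.2, θ) ∧
      |A x.1 x.2 θ| < 1 ∧ ω μ₀ / 2 < Θ x.1 x.2 θ ∧ Θ x.1 x.2 θ < ω μ₀ + 1 := by
    refine isCompact_Icc.eventually_forall_of_forall_eventually fun θ _ => ?_
    have htend : Tendsto (fun p : (ℝ × ℝ) × ℝ => (p.1.1, p.1.2, p.2)) (𝓝 ((μ₀, 0), θ))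
        (𝓝 (μ₀, 0, θ)) := Continuous.tendsto' (by fun_prop) _ _ rfl
    refine htend.eventually (p := fun q : ℝ × ℝ × ℝ =>
      ContinuousAt (fun q : ℝ × ℝ × ℝ => A q.1 q.2.1 q.2.2) q ∧
      ContinuousAt (fun q : ℝ × ℝ × ℝ => Θ q.1 q.2.1 q.2.2) q ∧
      |A q.1 q.2.1 q.2.2| < 1 ∧ ω μ₀ / 2 < Θ q.1 q.2.1 q.2.2 ∧ Θ q.1 q.2.1 q.2.2 < ω μ₀ + 1) ?_
    have hA1 := (hA θ).continuousAt.abs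
    have hΘ1 := (hΘ θ).continuousAt
    have e1 := ((hA θ).eventually (by simp)).mono fun q hq => hq.continuousAt
    have e2 := ((hΘ θ).eventually (by simp)).mono fun q hq => hq.continuousAt
    have e3 := hA1.eventually_lt_const (u := 1) (by simp [hA0, hβ0])
    have e4 := hΘ1.eventually_const_lt (u := ω μ₀ / 2) (by simp only [hΘ0]; linarith)
    have e5 := hΘ1.eventually_lt_const (u := ω μ₀ + 1) (by simp only [hΘ0]; linarith)
    filter_upwards [e1, e2, e3, e4, e5] with q h1 h2 h3 h4 h5
    exact ⟨h1, h2, h3, h4, h5⟩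
  obtain ⟨e₁, he₁, hev⟩ := Metric.nhds_basis_closedBall.eventually_iff.1 hev
  obtain ⟨e₂, he₂, hloc⟩ := Metric.nhds_basis_closedBall.eventually_iff.1 hloc
  refine ⟨min e₁ e₂, lt_min he₁ he₂, fun e he hle => ?_⟩
  set pν : ℝ → ℝ := fun ν => max (μ₀ - e) (min (μ₀ + e) ν) with hpν
  set pρ : ℝ → ℝ := fun ρ => max 0 (min ρ e) with hpρ
  have hpνm : ∀ ν, |pν ν - μ₀| ≤ e := fun ν => by
    rw [abs_le]
    have h1 := le_max_left (μ₀ - e) (min (μ₀ + e) ν)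
    have h2 : pν ν ≤ μ₀ + e := max_le (by linarith) (min_le_left _ _)
    constructor <;> linarith
  have hpρm : ∀ ρ, |pρ ρ - 0| ≤ e := fun ρ => by
    rw [sub_zero, abs_of_nonneg (le_max_left _ _)]
    exact max_le he.le (min_le_right _ _)
  have hpνeq : ∀ ν ∈ Icc (μ₀ - e) (μ₀ + e), pν ν = ν := fun ν hν => by
    simp only [hpν]
    rw [min_eq_right hν.2, max_eq_right hν.1]
  have hpρeq : ∀ ρ ∈ Icc 0 e, pρ ρ = ρ := fun ρ hρ => by
    simp only [hpρ]
    rw [min_eq_left hρ.2, max_eq_right hρ.1]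
  have hpνlip : ∀ ν ν', |pν ν - pν ν'| ≤ |ν - ν'| := fun ν ν' => by
    have h1 := abs_max_sub_max_le_abs (min (μ₀ + e) ν) (min (μ₀ + e) ν') (μ₀ - e)
    rw [max_comm _ (μ₀ - e), max_comm _ (μ₀ - e)] at h1
    refine h1.trans ?_
    rw [min_comm, min_comm _ ν']
    exact abs_min_sub_min_le _ _ _
  have hpρlip : ∀ ρ ρ', |pρ ρ - pρ ρ'| ≤ |min ρ e - min ρ' e| := fun ρ ρ' => by
    have h1 := abs_max_sub_max_le_abs (min ρ e) (min ρ' e) 0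
    rwa [max_comm _ (0 : ℝ), max_comm _ (0 : ℝ)] at h1
  have hball : ∀ {d : ℝ} (ν ρ : ℝ), e ≤ d → (pν ν, pρ ρ) ∈ Metric.closedBall (μ₀, (0 : ℝ)) d :=
    fun ν ρ hd => by
      rw [Metric.mem_closedBall, Prod.dist_eq, max_le_iff]
      exact ⟨(hpνm ν).trans hd, (hpρm ρ).trans hd⟩
  have hball2 : ∀ ν ρ ν' ρ' : ℝ, ((pν ν, pρ ρ), (pν ν', pρ ρ')) ∈
      Metric.closedBall ((μ₀, (0 : ℝ)), (μ₀, (0 : ℝ))) e₁ := fun ν ρ ν' ρ' => by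
    rw [Metric.mem_closedBall, Prod.dist_eq, max_le_iff]
    exact ⟨hball ν ρ (hle.trans (min_le_left _ _)), hball ν' ρ' (hle.trans (min_le_left _ _))⟩
  -- The local bounds hold for angles in [0, 2π]; periodicity carries them to all angles.
  have hred : ∀ θ : ℝ, ∃ n : ℤ, θ - n * (2 * Real.pi) ∈ Icc 0 (2 * Real.pi) := fun θ => by
    have h2π : (0 : ℝ) < 2 * Real.pi := by positivity
    refine ⟨⌊θ / (2 * Real.pi)⌋, ?_, ?_⟩
    · have := Int.floor_le (θ / (2 * Real.pi))
      rw [le_div_iff₀ h2π] at this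
      linarith
    · have := Int.lt_floor_add_one (θ / (2 * Real.pi))
      rw [div_lt_iff₀ h2π] at this
      linarith
  have bnd : ∀ ν ρ θ, |A (pν ν) (pρ ρ) θ| < 1 ∧ ω μ₀ / 2 < Θ (pν ν) (pρ ρ) θ ∧
      Θ (pν ν) (pρ ρ) θ < ω μ₀ + 1 := fun ν ρ θ => by
    obtain ⟨n, hn⟩ := hred θ
    have := (hloc (hball ν ρ (hle.trans (min_le_right _ _))) _ hn).2.2
    rwa [(hAper _ _).sub_int_mul_eq, (hΘper _ _).sub_int_mul_eq] at this
  have hratesub : ∀ ν ρ θ (n : ℤ), polarRate A Θ ν ρ (θ - n * (2 * Real.pi)) = polarRate A Θ ν ρ θ :=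
    fun ν ρ θ n => by
      rw [polarRate, polarRate, (hAper _ _).sub_int_mul_eq, (hΘper _ _).sub_int_mul_eq]
  have hcont : ∀ f : ℝ → ℝ → ℝ → ℝ, (∀ ν ρ, Function.Periodic (f ν ρ) (2 * Real.pi)) →
      (∀ ν ρ, ∀ θ ∈ Icc 0 (2 * Real.pi),
        ContinuousAt (fun q : ℝ × ℝ × ℝ => f q.1 q.2.1 q.2.2) (pν ν, pρ ρ, θ)) →
      Continuous fun q : ℝ × ℝ × ℝ => f (pν q.1) (pρ q.2.1) q.2.2 := by
    intro f hper hf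
    rw [continuous_iff_continuousAt]
    rintro ⟨ν, ρ, θ⟩
    obtain ⟨n, hn⟩ := hred θ
    have h1 : (fun q : ℝ × ℝ × ℝ => f (pν q.1) (pρ q.2.1) q.2.2) =
        (fun q : ℝ × ℝ × ℝ => f q.1 q.2.1 q.2.2) ∘
          fun q : ℝ × ℝ × ℝ => (pν q.1, pρ q.2.1, q.2.2 - n * (2 * Real.pi)) := by
      funext q
      simp only [Function.comp_apply]
      rw [(hper _ _).sub_int_mul_eq]
    rw [h1]
    exact ContinuousAt.comp (f := fun q : ℝ × ℝ × ℝ =>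
      (pν q.1, pρ q.2.1, q.2.2 - n * (2 * Real.pi))) (hf ν ρ _ hn) (by fun_prop)
  refine ⟨fun ν ρ θ => A (pν ν) (pρ ρ) θ, fun ν ρ θ => Θ (pν ν) (pρ ρ) θ, K, ω μ₀ + 1, ω μ₀ / 2, D,
    { ε_pos := he
      ρ₀_pos := he
      K_nonneg := hK
      c_pos := by positivity
      D_ne := hD0
      periodic_A := fun ν ρ => hAper _ _
      periodic_Θ := fun ν ρ => hΘper _ _
      cont_A := hcont A hAper fun ν ρ θ hθ => (hloc (hball ν ρ (hle.trans (min_le_right _ _))) θ hθ).1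
      cont_Θ := hcont Θ hΘper fun ν ρ θ hθ =>
        (hloc (hball ν ρ (hle.trans (min_le_right _ _))) θ hθ).2.1
      le_Θ := fun ν ρ θ => (bnd ν ρ θ).2.1.le
      Θ_le := fun ν ρ θ => (bnd ν ρ θ).2.2.le
      abs_A_le := fun ν ρ θ => by linarith [(bnd ν ρ θ).1]
      lip := fun ν ν' ρ ρ' θ => ?_
      transversal := fun ν hν ν' hν' ρ θ => ?_
      A_zero := fun θ => ?_
      Θ_zero := fun θ => ?_ }, fun ν hν ρ hρ θ => ?_⟩
  · obtain ⟨n, hn⟩ := hred θ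
    have := (hev (hball2 ν ρ ν' ρ') _ hn).1
    simp only [hh, hratesub] at this
    refine this.trans ?_
    have h1 := hpνlip ν ν'
    have h2 := hpρlip ρ ρ'
    gcongr
  · obtain ⟨n, hn⟩ := hred θ
    have := (hev (hball2 ν ρ ν' ρ) _ hn).2
    simp only [hh, hratesub] at this
    rw [hpνeq ν hν, hpνeq ν' hν'] at this
    simp only [polarRate] at this ⊢
    rw [hpνeq ν hν, hpνeq ν' hν']
    exact this
  · have h1 : pν μ₀ = μ₀ := hpνeq μ₀ ⟨by linarith, by linarith⟩
    have h2 : pρ 0 = 0 := hpρeq 0 ⟨le_rfl, he.le⟩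
    simp only [h1, h2, hA0, hβ0]
  · have h1 : pν μ₀ = μ₀ := hpνeq μ₀ ⟨by linarith, by linarith⟩
    have h2 : pρ 0 = 0 := hpρeq 0 ⟨le_rfl, he.le⟩
    simp only [h1, h2, hΘ0]
  · simp only [hpνeq ν hν, hpρeq ρ hρ, and_self]

/-! ### The linearization at the positive equilibrium -/

section Equilibrium

variable {α γ r : ℝ}

theorem one_sub_mul_pos (hα : 0 < α) (hr' : r < α⁻¹) : 0 < 1 - α * r := by
  have := mul_lt_mul_of_pos_left hr' hα
  rw [mul_inv_cancel₀ hα.ne'] at this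
  linarith

theorem mStar_pos (hα : 0 < α) (hr : 1 < r) (hr' : r < α⁻¹) : 0 < mStar α r :=
  div_pos (mul_pos hα (by linarith)) (one_sub_mul_pos hα hr')

theorem aStar_pos (hα : 0 < α) (hα' : α < 1) (hr : 1 < r) (hr' : r < α⁻¹) : 0 < aStar α r :=
  div_pos (one_sub_mul_pos hα hr') (mul_pos (by linarith) (by linarith))

/-- Together with `mul_aStar` this is the first equilibrium equation, r a* = 1/(1 + m*), with δ₀ as
the common value; `aStar_mul_add` is the second. The three relations stand in for the explicit
formulas in `kinetics_expand` and `modePoly_eq`. -/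
theorem delta0_mul_one_add_mStar (hα : 0 < α) (hα' : α < 1) (hr' : r < α⁻¹) :
    delta0 α r * (1 + mStar α r) = 1 := by
  have h1 := (one_sub_mul_pos hα hr').ne'
  have h2 : 1 - α ≠ 0 := by linarith
  unfold delta0 mStar
  field_simp
  ring

theorem mul_aStar (hα' : α < 1) (hr : 1 < r) : r * aStar α r = delta0 α r := by
  have h2 : 1 - α ≠ 0 := by linarith
  have h3 : r ≠ 0 := by linarith
  unfold delta0 aStar
  field_simp

theorem aStar_mul_add (hα : 0 < α) (hα' : α < 1) (hr : 1 < r) (hr' : r < α⁻¹) :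
    aStar α r * (α + mStar α r) = α := by
  have h1 := (one_sub_mul_pos hα hr').ne'
  have h2 : 1 - α ≠ 0 := by linarith
  have h3 : r ≠ 0 := by linarith
  unfold aStar mStar
  field_simp
  ring

variable (α γ r) in
/-- Half of the trace of the linearization at `E_*`. -/
def halfTrace : ℝ := (delta0 α r ^ 2 * mStar α r - α / (γ * aStar α r)) / 2

variable (α γ r) in
/-- The determinant of the linearization at `E_*`. -/
def jacobianDet : ℝ :=
  delta0 α r ^ 2 * mStar α r * -(α / (γ * aStar α r)) - r * mStar α r * -(aStar α r / γ)

variable (α γ r) in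
/-- The imaginary part of the eigenvalues at `E_*`. -/
def frequency : ℝ := √(jacobianDet α γ r - halfTrace α γ r ^ 2)

/-- Holds because α/(γ a*) = m* ρ₀; this is how the critical curve arises. -/
theorem halfTrace_eq (hα : 0 < α) (hα' : α < 1) (hγ : 0 < γ) (hr : 1 < r) (hr' : r < α⁻¹) :
    2 * halfTrace α γ r = mStar α r * (delta0 α r ^ 2 - rho0 α γ r) := by
  have h1 := (one_sub_mul_pos hα hr').ne'
  have h2 : 1 - α ≠ 0 := by linarith
  have h3 : r ≠ 0 := by linarith
  have h4 : r - 1 ≠ 0 := by linarith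
  unfold halfTrace rho0 mStar aStar
  field_simp

theorem jacobianDet_eq (hα : 0 < α) (hα' : α < 1) (hγ : 0 < γ) (hr : 1 < r) (hr' : r < α⁻¹) :
    jacobianDet α γ r = α * r * (r - 1) * aStar α r / γ := by
  have h1 := (one_sub_mul_pos hα hr').ne'
  have h2 : 1 - α ≠ 0 := by linarith
  have h3 : r ≠ 0 := by linarith
  unfold jacobianDet delta0 mStar aStar
  field_simp
  ring

theorem jacobianDet_pos (hα : 0 < α) (hα' : α < 1) (hγ : 0 < γ) (hr : 1 < r) (hr' : r < α⁻¹) :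
    0 < jacobianDet α γ r := by
  rw [jacobianDet_eq hα hα' hγ hr hr']
  have := aStar_pos hα hα' hr hr'
  have : 0 < r - 1 := by linarith
  positivity

theorem kinetics_EStar (hα : 0 < α) (hα' : α < 1) (hr : 1 < r) (hr' : r < α⁻¹) :
    kinetics α γ r (EStar α r) = 0 := by
  have hm := mStar_pos hα hr hr'
  have h1 := delta0_mul_one_add_mStar hα hα' hr'
  have h2 := mul_aStar hα' hr
  have h3 := aStar_mul_add hα hα' hr hr'
  have h4 : 1 + mStar α r ≠ 0 := by positivity
  have h5 : r * mStar α r * aStar α r - mStar α r / (1 + mStar α r) = 0 := by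
    rw [sub_eq_zero, eq_div_iff h4]
    linear_combination mStar α r * h1 + mStar α r * (1 + mStar α r) * h2
  have h6 : α * (1 - aStar α r) - mStar α r * aStar α r = 0 := by linear_combination -h3
  simp only [kinetics, EStar, h5, h6, zero_div]
  rfl

/-- Exact expansion of the kinetics at `E_*`. -/
theorem kinetics_expand (hα : 0 < α) (hα' : α < 1) (hγ : 0 < γ) (hr : 1 < r) (hr' : r < α⁻¹)
    {x y : ℝ} (hx : 1 + mStar α r + x ≠ 0) :
    kinetics α γ r (EStar α r + (x, y)) =
      (delta0 α r ^ 2 * mStar α r * x + r * mStar α r * y +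
          (r * x * y + delta0 α r ^ 2 * x ^ 2 / (1 + mStar α r + x)),
        -(aStar α r / γ) * x + -(α / (γ * aStar α r)) * y + -(x * y) / γ) := by
  have hm := mStar_pos hα hr hr'
  have ha := aStar_pos hα hα' hr hr'
  have h1 := delta0_mul_one_add_mStar hα hα' hr'
  have h2 := mul_aStar hα' hr
  have h3 := aStar_mul_add hα hα' hr hr'
  have hx' : 1 + (mStar α r + x) ≠ 0 := by rwa [← add_assoc]
  simp only [kinetics, EStar, Prod.mk_add_mk]
  refine Prod.ext ?_ ?_
  · simp only
    -- The increment of m/(1 + m) equals δ₀²x - δ₀²x²/(1 + m* + x) exactly, and the linear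
    -- coefficient is r a* - δ₀² = δ₀ - δ₀² = δ₀² m*.
    have h4 : delta0 α r = (1 + mStar α r)⁻¹ := eq_inv_of_mul_eq_one_left h1
    have h5 : aStar α r = (1 + mStar α r)⁻¹ / r := by rw [← h4, ← h2]; field_simp
    rw [h4, h5]
    field_simp
    ring
  · simp only
    have h6 : α / (γ * aStar α r) = (α + mStar α r) / γ := by
      rw [div_eq_div_iff (by positivity) hγ.ne']
      linear_combination -γ * h3
    rw [h6]
    field_simp
    linear_combination -h3

theorem contDiffAt_kinetics {p : ℝ × ℝ} (hp : 1 + p.1 ≠ 0) : ContDiffAt ℝ 1 (kinetics α γ r) p := by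
  unfold kinetics
  refine ContDiffAt.prodMk (ContDiffAt.sub (by fun_prop) ?_) (by fun_prop)
  exact ContDiffAt.div (by fun_prop) (by fun_prop) hp

theorem exists_hasFDerivAt_kinetics (hα : 0 < α) (hα' : α < 1) (hγ : 0 < γ) (hr : 1 < r)
    (hr' : r < α⁻¹) : ∃ L : ℝ × ℝ →L[ℝ] ℝ × ℝ, HasFDerivAt (kinetics α γ r) L (EStar α r) ∧
      ∀ v, L v = (delta0 α r ^ 2 * mStar α r * v.1 + r * mStar α r * v.2,
        -(aStar α r / γ) * v.1 + -(α / (γ * aStar α r)) * v.2) := by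
  have hm := mStar_pos hα hr hr'
  have ha := aStar_pos hα hα' hr hr'
  have h1 := delta0_mul_one_add_mStar hα hα' hr'
  have h2 := mul_aStar hα' hr
  have h3 := aStar_mul_add hα hα' hr hr'
  have h4 : 1 + (EStar α r).1 ≠ 0 := by simp only [EStar]; positivity
  have hf : HasFDerivAt (fun v : ℝ × ℝ => v.1) (ContinuousLinearMap.fst ℝ ℝ ℝ) (EStar α r) :=
    hasFDerivAt_fst
  have hs : HasFDerivAt (fun v : ℝ × ℝ => v.2) (ContinuousLinearMap.snd ℝ ℝ ℝ) (EStar α r) :=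
    hasFDerivAt_snd
  have hq : HasDerivAt (fun x : ℝ => x / (1 + x))
      ((1 * (1 + (EStar α r).1) - (EStar α r).1 * 1) / (1 + (EStar α r).1) ^ 2) (EStar α r).1 :=
    (hasDerivAt_id _).div ((hasDerivAt_id _).const_add 1) h4
  refine ⟨_, ((((hf.const_mul r).mul hs).sub (hq.comp_hasFDerivAt (EStar α r) hf)).prodMk
    (((((hs.const_sub 1).const_mul α).sub (hf.mul hs)).mul_const γ⁻¹))), fun v => ?_⟩
  have h5 : delta0 α r = (1 + mStar α r)⁻¹ := eq_inv_of_mul_eq_one_left h1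
  have h6 : aStar α r = (1 + mStar α r)⁻¹ / r := by rw [← h5, ← h2]; field_simp
  have h7 : α / (γ * aStar α r) = (α + mStar α r) / γ := by
    rw [div_eq_div_iff (by positivity) hγ.ne']
    linear_combination -γ * h3
  refine Prod.ext ?_ ?_
  · simp [EStar]
    rw [h5, h6]
    field_simp
    ring
  · simp [EStar]
    rw [h7]
    field_simp
    ring

end Equilibrium

/-! ### Characteristic polynomials -/

theorem roots_conjPair (β ω : ℝ) :
    ((X - C ((β : ℂ) + ω * Complex.I)) * (X - C ((β : ℂ) - ω * Complex.I))).roots =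
      conjPair β ω := by
  rw [roots_mul (mul_ne_zero (X_sub_C_ne_zero _) (X_sub_C_ne_zero _)), roots_X_sub_C,
    roots_X_sub_C]
  rfl

theorem quadratic_eq_mul (β ω : ℝ) :
    (X ^ 2 - C ((2 * β : ℝ) : ℂ) * X + C ((β ^ 2 + ω ^ 2 : ℝ) : ℂ)) =
      (X - C ((β : ℂ) + ω * Complex.I)) * (X - C ((β : ℂ) - ω * Complex.I)) := by
  have h1 : ((2 * β : ℝ) : ℂ) = ((β : ℂ) + ω * Complex.I) + ((β : ℂ) - ω * Complex.I) := by
    push_cast; ring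
  have h2 : ((β ^ 2 + ω ^ 2 : ℝ) : ℂ) = ((β : ℂ) + ω * Complex.I) * ((β : ℂ) - ω * Complex.I) := by
    push_cast
    linear_combination ((ω : ℂ) ^ 2) * Complex.I_sq
  rw [h1, h2, C_add, C_mul]
  ring

theorem charpoly_map_eq {L : ℝ × ℝ →ₗ[ℝ] ℝ × ℝ} {a b c d : ℝ}
    (hL : ∀ v, L v = (a * v.1 + b * v.2, c * v.1 + d * v.2)) :
    (LinearMap.charpoly L).map (algebraMap ℝ ℂ) =
      X ^ 2 - C ((a + d : ℝ) : ℂ) * X + C ((a * d - b * c : ℝ) : ℂ) := by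
  have hM : LinearMap.toMatrix (Module.Basis.finTwoProd ℝ) (Module.Basis.finTwoProd ℝ) L =
      !![a, b; c, d] := by
    ext i j
    fin_cases i <;> fin_cases j <;> simp [LinearMap.toMatrix_apply, hL]
  rw [← LinearMap.charpoly_toMatrix L (Module.Basis.finTwoProd ℝ), hM, Matrix.charpoly_fin_two]
  simp [Matrix.trace_fin_two, Matrix.det_fin_two]

/-! ### Hopf bifurcation at the positive equilibrium -/

section Polar

variable {α γ : ℝ}

variable (α γ) in
/-- First coefficient of the shear to polar coordinates at `E_*`. -/
def shearRe (r : ℝ) : ℝ :=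
  -(delta0 α r ^ 2 * mStar α r - halfTrace α γ r) / (r * mStar α r)

variable (α γ) in
/-- Second coefficient of the shear to polar coordinates at `E_*`. -/
def shearIm (r : ℝ) : ℝ := -frequency α γ r / (r * mStar α r)

variable (α γ) in
/-- The real part of the nonlinear terms, divided by `ρ²`. -/
def remainderRe (r ρ θ : ℝ) : ℝ :=
  r * (Real.cos θ * (shearRe α γ r * Real.cos θ + shearIm α γ r * Real.sin θ)) +
    delta0 α r ^ 2 * Real.cos θ ^ 2 / (1 + mStar α r + ρ * Real.cos θ)

variable (α γ) in
/-- The imaginary part of the nonlinear terms, divided by `ρ²`. -/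
def remainderIm (r ρ θ : ℝ) : ℝ :=
  (-(Real.cos θ * (shearRe α γ r * Real.cos θ + shearIm α γ r * Real.sin θ)) / γ -
    shearRe α γ r * remainderRe α γ r ρ θ) / shearIm α γ r

variable (α γ) in
/-- Radial growth rate of the kinetics in polar coordinates at `E_*`. -/
def radialSpeed (r ρ θ : ℝ) : ℝ :=
  halfTrace α γ r +
    ρ * (Real.cos θ * remainderRe α γ r ρ θ + Real.sin θ * remainderIm α γ r ρ θ)

variable (α γ) in
/-- Angular speed of the kinetics in polar coordinates at `E_*`. -/
def angularSpeed (r ρ θ : ℝ) : ℝ :=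
  frequency α γ r +
    ρ * (Real.cos θ * remainderIm α γ r ρ θ - Real.sin θ * remainderRe α γ r ρ θ)

/-- With k₁ = -(a - β)/b and k₂ = -ω/b, these are the four entries of A S = S(β + iω) for the shear
S: the linear part becomes multiplication by a complex number. -/
theorem shear_relations {a b c d β ω : ℝ} (hb : b ≠ 0) (hβ : 2 * β = a + d)
    (hdet : β ^ 2 + ω ^ 2 = a * d - b * c) :
    a + b * (-(a - β) / b) = β ∧ b * (-ω / b) = -ω ∧
      c + d * (-(a - β) / b) - -(a - β) / b * β = -ω / b * ω ∧
      d * (-ω / b) + -(a - β) / b * ω = -ω / b * β := by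
  refine ⟨?_, ?_, ?_, ?_⟩
  · field_simp; ring
  · field_simp
  · field_simp
    linear_combination (-β) * hβ + hdet
  · field_simp
    linear_combination ω * hβ

theorem frequency_sq {r : ℝ} (h : 0 < jacobianDet α γ r - halfTrace α γ r ^ 2) :
    halfTrace α γ r ^ 2 + frequency α γ r ^ 2 = jacobianDet α γ r := by
  rw [frequency, Real.sq_sqrt h.le]
  ring

theorem shearIm_ne_zero (hα : 0 < α) {r : ℝ} (hr : 1 < r) (hr' : r < α⁻¹)
    (h : 0 < jacobianDet α γ r - halfTrace α γ r ^ 2) : shearIm α γ r ≠ 0 := by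
  have hm := mStar_pos hα hr hr'
  have hω : 0 < frequency α γ r := Real.sqrt_pos.2 h
  exact div_ne_zero (neg_ne_zero.2 hω.ne') (by positivity)

/-- The kinetics in polar coordinates at `E_*`. -/
theorem kinetics_polar (hα : 0 < α) (hα' : α < 1) (hγ : 0 < γ) {r ρ : ℝ} (hr : 1 < r)
    (hr' : r < α⁻¹) (h : 0 < jacobianDet α γ r - halfTrace α γ r ^ 2) (hρ : ρ ∈ Icc 0 1) (θ : ℝ) :
    kinetics α γ r (EStar α r +
        shear (shearRe α γ r) (shearIm α γ r) (ρ * Complex.exp (θ * Complex.I))) =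
      shear (shearRe α γ r) (shearIm α γ r) (ρ * Complex.exp (θ * Complex.I) *
        (radialSpeed α γ r ρ θ + angularSpeed α γ r ρ θ * Complex.I)) := by
  have hm := mStar_pos hα hr hr'
  have hb : r * mStar α r ≠ 0 := by positivity
  obtain ⟨h1, h2, h3, h4⟩ := shear_relations (a := delta0 α r ^ 2 * mStar α r)
    (c := -(aStar α r / γ)) (d := -(α / (γ * aStar α r))) hb (β := halfTrace α γ r)
    (ω := frequency α γ r) (by unfold halfTrace; ring) (frequency_sq h)
  -- The nonlinear part is ρ² times the shear of `remainderRe` + i `remainderIm`; this is its second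
  -- coordinate.
  have h5 : shearIm α γ r * remainderIm α γ r ρ θ =
      -(Real.cos θ * (shearRe α γ r * Real.cos θ + shearIm α γ r * Real.sin θ)) / γ -
        shearRe α γ r * remainderRe α γ r ρ θ :=
    mul_div_cancel₀ _ (shearIm_ne_zero hα hr hr' h)
  -- For ρ ≤ 1 the expression is at least m* > 0.
  have hx : 1 + mStar α r + ρ * Real.cos θ ≠ 0 := by
    have := Real.neg_one_le_cos θ
    nlinarith [hρ.1, hρ.2]
  have hz : shear (shearRe α γ r) (shearIm α γ r) (ρ * Complex.exp (θ * Complex.I)) =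
      (ρ * Real.cos θ, shearRe α γ r * (ρ * Real.cos θ) + shearIm α γ r * (ρ * Real.sin θ)) := by
    simp only [shear, Complex.re_ofReal_mul, Complex.im_ofReal_mul, Complex.exp_ofReal_mul_I_re,
      Complex.exp_ofReal_mul_I_im]
  have hw : shear (shearRe α γ r) (shearIm α γ r) (ρ * Complex.exp (θ * Complex.I) *
        (radialSpeed α γ r ρ θ + angularSpeed α γ r ρ θ * Complex.I)) =
      (ρ * (Real.cos θ * radialSpeed α γ r ρ θ - Real.sin θ * angularSpeed α γ r ρ θ),
        shearRe α γ r *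
          (ρ * (Real.cos θ * radialSpeed α γ r ρ θ - Real.sin θ * angularSpeed α γ r ρ θ)) +
        shearIm α γ r *
          (ρ * (Real.cos θ * angularSpeed α γ r ρ θ + Real.sin θ * radialSpeed α γ r ρ θ))) := by
    simp only [shear, mul_assoc, Complex.mul_re, Complex.mul_im, Complex.exp_ofReal_mul_I_re, Complex.exp_ofReal_mul_I_im, Complex.add_re,
      Complex.add_im, Complex.ofReal_re, Complex.ofReal_im, Complex.I_re, Complex.I_im]
    ring_nf
  have hcs := Real.sin_sq_add_cos_sq θ
  rw [hz, hw, kinetics_expand hα hα' hγ hr hr' hx]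
  change _ + r * mStar α r * shearRe α γ r = _ at h1
  change r * mStar α r * shearIm α γ r = _ at h2
  change _ + _ * shearRe α γ r - shearRe α γ r * _ = shearIm α γ r * _ at h3
  change _ * shearIm α γ r + shearRe α γ r * _ = shearIm α γ r * _ at h4
  have h6 : r * (ρ * Real.cos θ) *
      (shearRe α γ r * (ρ * Real.cos θ) + shearIm α γ r * (ρ * Real.sin θ)) +
      delta0 α r ^ 2 * (ρ * Real.cos θ) ^ 2 / (1 + mStar α r + ρ * Real.cos θ) =
        ρ ^ 2 * remainderRe α γ r ρ θ := by
    unfold remainderRe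
    ring
  rw [h6]
  unfold radialSpeed angularSpeed
  refine Prod.ext ?_ ?_
  · simp only
    linear_combination ρ * Real.cos θ * h1 + ρ * Real.sin θ * h2 -
      ρ ^ 2 * remainderRe α γ r ρ θ * hcs
  · simp only
    linear_combination ρ * Real.cos θ * h3 + ρ * Real.sin θ * h4 - ρ ^ 2 * h5 -
      ρ ^ 2 * (shearRe α γ r * remainderRe α γ r ρ θ + shearIm α γ r * remainderIm α γ r ρ θ) * hcs

section Smooth

variable {r₀ : ℝ}

theorem contDiffAt_mStar (hα : 0 < α) (hr' : r₀ < α⁻¹) : ContDiffAt ℝ 1 (mStar α) r₀ := by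
  unfold mStar
  exact ContDiffAt.div (by fun_prop) (by fun_prop) (one_sub_mul_pos hα hr').ne'

theorem contDiffAt_aStar (hα' : α < 1) (hr : 1 < r₀) : ContDiffAt ℝ 1 (aStar α) r₀ := by
  unfold aStar
  exact ContDiffAt.div (by fun_prop) (by fun_prop) (mul_ne_zero (by linarith) (by linarith))

theorem contDiffAt_delta0 : ContDiffAt ℝ 1 (delta0 α) r₀ := by
  unfold delta0
  fun_prop

theorem contDiffAt_halfTrace (hα : 0 < α) (hα' : α < 1) (hγ : 0 < γ) (hr : 1 < r₀)
    (hr' : r₀ < α⁻¹) : ContDiffAt ℝ 1 (halfTrace α γ) r₀ := by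
  have h1 := contDiffAt_mStar hα hr'
  have h2 := contDiffAt_aStar hα' hr
  have h3 := contDiffAt_delta0 (α := α) (r₀ := r₀)
  have h4 := aStar_pos hα hα' hr hr'
  exact (((h3.pow 2).mul h1).sub (contDiffAt_const.div (contDiffAt_const.mul h2)
    (by positivity))).div_const 2

theorem contDiffAt_jacobianDet (hα : 0 < α) (hα' : α < 1) (hγ : 0 < γ) (hr : 1 < r₀)
    (hr' : r₀ < α⁻¹) : ContDiffAt ℝ 1 (jacobianDet α γ) r₀ := by
  have h1 := contDiffAt_mStar hα hr'
  have h2 := contDiffAt_aStar hα' hr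
  have h3 := contDiffAt_delta0 (α := α) (r₀ := r₀)
  have h4 := aStar_pos hα hα' hr hr'
  exact (((h3.pow 2).mul h1).mul (contDiffAt_const.div (contDiffAt_const.mul h2)
    (by positivity)).neg).sub ((contDiffAt_id.mul h1).mul (h2.div_const γ).neg)

theorem contDiffAt_frequency (hα : 0 < α) (hα' : α < 1) (hγ : 0 < γ) (hr : 1 < r₀)
    (hr' : r₀ < α⁻¹) (h : 0 < jacobianDet α γ r₀ - halfTrace α γ r₀ ^ 2) :
    ContDiffAt ℝ 1 (frequency α γ) r₀ :=
  ((contDiffAt_jacobianDet hα hα' hγ hr hr').sub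
    ((contDiffAt_halfTrace hα hα' hγ hr hr').pow 2)).sqrt h.ne'

theorem contDiffAt_shearRe (hα : 0 < α) (hα' : α < 1) (hγ : 0 < γ) (hr : 1 < r₀)
    (hr' : r₀ < α⁻¹) : ContDiffAt ℝ 1 (shearRe α γ) r₀ := by
  have hm := mStar_pos hα hr hr'
  have h1 := contDiffAt_mStar hα hr'
  have h3 := contDiffAt_delta0 (α := α) (r₀ := r₀)
  exact ((((h3.pow 2).mul h1).sub (contDiffAt_halfTrace hα hα' hγ hr hr')).neg).div
    (contDiffAt_id.mul h1) (mul_ne_zero (show r₀ ≠ 0 by linarith) hm.ne')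

theorem contDiffAt_shearIm (hα : 0 < α) (hα' : α < 1) (hγ : 0 < γ) (hr : 1 < r₀)
    (hr' : r₀ < α⁻¹) (h : 0 < jacobianDet α γ r₀ - halfTrace α γ r₀ ^ 2) :
    ContDiffAt ℝ 1 (shearIm α γ) r₀ := by
  have hm := mStar_pos hα hr hr'
  exact (contDiffAt_frequency hα hα' hγ hr hr' h).neg.div
    (contDiffAt_id.mul (contDiffAt_mStar hα hr')) (mul_ne_zero (show r₀ ≠ 0 by linarith) hm.ne')

/-- The factor ρ² was extracted algebraically from the exact remainder, so dividing by ρ loses no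
regularity at ρ = 0. -/
theorem contDiffAt_polarSpeeds (hα : 0 < α) (hα' : α < 1) (hγ : 0 < γ) (hr : 1 < r₀)
    (hr' : r₀ < α⁻¹) (h : 0 < jacobianDet α γ r₀ - halfTrace α γ r₀ ^ 2) (θ : ℝ) :
    ContDiffAt ℝ 1 (fun q : ℝ × ℝ × ℝ => radialSpeed α γ q.1 q.2.1 q.2.2) (r₀, 0, θ) ∧
    ContDiffAt ℝ 1 (fun q : ℝ × ℝ × ℝ => angularSpeed α γ q.1 q.2.1 q.2.2) (r₀, 0, θ) := by
  have lift : ∀ {f : ℝ → ℝ}, ContDiffAt ℝ 1 f r₀ →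
      ContDiffAt ℝ 1 (fun q : ℝ × ℝ × ℝ => f q.1) (r₀, 0, θ) := fun hf =>
    ContDiffAt.comp (f := Prod.fst) (r₀, (0 : ℝ), θ) hf contDiffAt_fst
  have hm := mStar_pos hα hr hr'
  have h1 := lift (contDiffAt_mStar hα hr')
  have h2 := lift (contDiffAt_delta0 (α := α) (r₀ := r₀))
  have h3 := lift (contDiffAt_shearRe hα hα' hγ hr hr')
  have h4 := lift (contDiffAt_shearIm hα hα' hγ hr hr' h)
  have h5 := lift (contDiffAt_halfTrace hα hα' hγ hr hr')
  have h6 := lift (contDiffAt_frequency hα hα' hγ hr hr' h)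
  have hρ : ContDiffAt ℝ 1 (fun q : ℝ × ℝ × ℝ => q.2.1) (r₀, 0, θ) := by fun_prop
  have hc : ContDiffAt ℝ 1 (fun q : ℝ × ℝ × ℝ => Real.cos q.2.2) (r₀, 0, θ) := by fun_prop
  have hs : ContDiffAt ℝ 1 (fun q : ℝ × ℝ × ℝ => Real.sin q.2.2) (r₀, 0, θ) := by fun_prop
  have hk := hc.mul ((h3.mul hc).add (h4.mul hs))
  have hre : ContDiffAt ℝ 1 (fun q : ℝ × ℝ × ℝ => remainderRe α γ q.1 q.2.1 q.2.2) (r₀, 0, θ) :=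
    (contDiffAt_fst.mul hk).add (((h2.pow 2).mul (hc.pow 2)).div
      ((contDiffAt_const.add h1).add (hρ.mul hc)) (by simp; positivity))
  have him : ContDiffAt ℝ 1 (fun q : ℝ × ℝ × ℝ => remainderIm α γ q.1 q.2.1 q.2.2) (r₀, 0, θ) :=
    ((hk.neg.div_const γ).sub (h3.mul hre)).div h4 (shearIm_ne_zero hα hr hr' h)
  exact ⟨h5.add (hρ.mul ((hc.mul hre).add (hs.mul him))),
    h6.add (hρ.mul ((hc.mul him).sub (hs.mul hre)))⟩

end Smooth

/-- Nonreal eigenvalues in a neighbourhood of a zero of the trace. -/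
theorem eventually_discriminant_pos (hα : 0 < α) (hα' : α < 1) (hγ : 0 < γ) {r₀ : ℝ} (hr : 1 < r₀)
    (hr' : r₀ < α⁻¹) (h0 : halfTrace α γ r₀ = 0) :
    ∀ᶠ r in 𝓝 r₀, 1 < r ∧ r < α⁻¹ ∧ 0 < jacobianDet α γ r - halfTrace α γ r ^ 2 := by
  have hc : ContinuousAt (fun r => jacobianDet α γ r - halfTrace α γ r ^ 2) r₀ :=
    (contDiffAt_jacobianDet hα hα' hγ hr hr').continuousAt.sub
      ((contDiffAt_halfTrace hα hα' hγ hr hr').continuousAt.pow 2)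
  have h : 0 < jacobianDet α γ r₀ - halfTrace α γ r₀ ^ 2 := by
    simpa [h0] using jacobianDet_pos hα hα' hγ hr hr'
  filter_upwards [eventually_gt_nhds hr, eventually_lt_nhds hr', hc.eventually_const_lt h]
    with r h1 h2 h3
  exact ⟨h1, h2, h3⟩

/-- The periodic branch of the system without diffusion. -/
theorem exists_isPeriodicBranch_kinetics (hα : 0 < α) (hα' : α < 1) (hγ : 0 < γ) {r₀ : ℝ}
    (hr : 1 < r₀) (hr' : r₀ < α⁻¹) (h0 : halfTrace α γ r₀ = 0)
    (hd : deriv (halfTrace α γ) r₀ ≠ 0) {U : Set (ℝ × ℝ)} (hU : U ∈ 𝓝 (EStar α r₀)) :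
    ∃ (s₀ : ℝ) (μ P : ℝ → ℝ) (u : ℝ → ℝ → ℝ × ℝ),
      IsPeriodicBranch (kinetics α γ) (EStar α r₀) r₀ (2 * Real.pi / frequency α γ r₀) s₀ μ P u ∧
      ∀ s ∈ Ioo 0 s₀, ∀ t, u s t ∈ U := by
  have hdet := jacobianDet_pos hα hα' hγ hr hr'
  have h : 0 < jacobianDet α γ r₀ - halfTrace α γ r₀ ^ 2 := by rw [h0]; simpa using hdet
  have hβ := contDiffAt_halfTrace hα hα' hγ hr hr'
  have hω := contDiffAt_frequency hα hα' hγ hr hr' h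
  have hRe : ∀ r ρ, Function.Periodic (remainderRe α γ r ρ) (2 * Real.pi) := fun r ρ θ => by
    simp only [remainderRe, Real.cos_add_two_pi, Real.sin_add_two_pi]
  have hIm : ∀ r ρ, Function.Periodic (remainderIm α γ r ρ) (2 * Real.pi) := fun r ρ θ => by
    simp only [remainderIm, Real.cos_add_two_pi, Real.sin_add_two_pi, hRe r ρ θ]
  obtain ⟨e₀, he₀, hpolar⟩ := exists_isPolarHopf
    (fun θ => (contDiffAt_polarSpeeds hα hα' hγ hr hr' h θ).1)
    (fun θ => (contDiffAt_polarSpeeds hα hα' hγ hr hr' h θ).2)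
    (fun r ρ θ => by
      simp only [radialSpeed, Real.cos_add_two_pi, Real.sin_add_two_pi, hRe r ρ θ, hIm r ρ θ])
    (fun r ρ θ => by
      simp only [angularSpeed, Real.cos_add_two_pi, Real.sin_add_two_pi, hRe r ρ θ, hIm r ρ θ])
    (fun r θ => by simp only [radialSpeed, zero_mul, add_zero])
    (fun r θ => by simp only [angularSpeed, zero_mul, add_zero])
    (hβ.differentiableAt one_ne_zero).hasDerivAt (hω.differentiableAt one_ne_zero).hasDerivAt h0
    (Real.sqrt_pos.2 h) hd
  have hnear := eventually_discriminant_pos hα hα' hγ hr hr' h0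
  obtain ⟨e₁, he₁, hnear⟩ := Metric.nhds_basis_closedBall.eventually_iff.1 hnear
  -- `e₁` keeps the eigenvalues nonreal on the whole window; 1/2 keeps 1 + m away from zero.
  set e := min (min e₀ e₁) (1 / 2) with he
  have he0 : 0 < e := by positivity
  have hle0 : e ≤ e₀ := (min_le_left _ _).trans (min_le_left _ _)
  have hle1 : e ≤ e₁ := (min_le_left _ _).trans (min_le_right _ _)
  have hle2 : e ≤ 1 / 2 := min_le_right _ _
  obtain ⟨A, Θ, K, C, c, D, H, hAΘ⟩ := hpolar e he0 hle0
  have hwin : ∀ r ∈ Icc (r₀ - e) (r₀ + e),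
      1 < r ∧ r < α⁻¹ ∧ 0 < jacobianDet α γ r - halfTrace α γ r ^ 2 := fun r hr => hnear (by
    rw [Metric.mem_closedBall, Real.dist_eq, abs_le]
    constructor <;> linarith [hr.1, hr.2])
  refine H.exists_isPeriodicBranch (F := kinetics α γ) (E := EStar α) (k₁ := shearRe α γ)
    (k₂ := shearIm α γ) ⟨fun r hr => ?_, fun r hr => ?_, fun r hr => ?_, fun r hr => ?_,
      fun r hr z hz => ?_, fun r hr ρ hρ θ => ?_⟩ hU
  all_goals obtain ⟨k1, k2, k3⟩ := hwin r hr
  · exact ((contDiffAt_mStar hα k2).continuousAt.prodMk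
      (contDiffAt_aStar hα' k1).continuousAt).continuousWithinAt
  · exact (contDiffAt_shearRe hα hα' hγ k1 k2).continuousAt.continuousWithinAt
  · exact (contDiffAt_shearIm hα hα' hγ k1 k2 k3).continuousAt.continuousWithinAt
  · exact shearIm_ne_zero hα k1 k2 k3
  · refine (contDiffAt_kinetics ?_).continuousAt
    have hm := mStar_pos hα k1 k2
    have := (abs_le.1 ((Complex.abs_re_le_norm z).trans hz)).1
    simp only [EStar, shear, Prod.fst_add]
    linarith
  · rw [(hAΘ r hr ρ hρ θ).1, (hAΘ r hr ρ hρ θ).2]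
    exact kinetics_polar hα hα' hγ k1 k2 k3 ⟨hρ.1, by linarith [hρ.2]⟩ θ

end Polar

/-! ### The system with diffusion -/

section Diffusion

variable {α γ d l : ℝ}

/-- Diffusion only adds a shift to -γ times the trace, so T₀ vanishes exactly with the trace. -/
theorem Tn_eq (n : ℕ) (r : ℝ) (hα' : α < 1) (hγ : 0 < γ) (hr : 1 < r) :
    Tn α γ d l n r = (1 + γ * d) * ((n : ℝ) ^ 2 / l ^ 2) - 2 * γ * halfTrace α γ r := by
  have h := mul_aStar hα' hr
  unfold Tn halfTrace
  have h2 : γ * r ^ 2 * aStar α r ^ 2 * mStar α r = γ * delta0 α r ^ 2 * mStar α r := by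
    rw [← h]; ring
  rw [h2, mul_comm γ (aStar α r), ← div_div α]
  field_simp
  ring

theorem Dn_zero (hα : 0 < α) (hα' : α < 1) (hγ : 0 < γ) {r : ℝ} (hr : 1 < r) (hr' : r < α⁻¹) :
    Dn α d l 0 r = γ * jacobianDet α γ r := by
  rw [jacobianDet_eq hα hα' hγ hr hr']
  unfold Dn
  field_simp
  simp

/-- The given T_n and D_n use the equilibrium relations α + m* = α/a* and r a* - 1/(1 + m*)² =
r²a*²m*. -/
theorem modePoly_eq (hα : 0 < α) (hα' : α < 1) {r : ℝ} (hr : 1 < r) (hr' : r < α⁻¹) (n : ℕ) :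
    modePoly α γ d l n r =
      C (γ : ℂ) * X ^ 2 + C (Tn α γ d l n r : ℂ) * X + C (Dn α d l n r : ℂ) := by
  have hm := mStar_pos hα hr hr'
  have ha := aStar_pos hα hα' hr hr'
  have h1 := delta0_mul_one_add_mStar hα hα' hr'
  have h2 := mul_aStar hα' hr
  have h3 := aStar_mul_add hα hα' hr hr'
  have h4 : α / aStar α r = α + mStar α r := by
    rw [div_eq_iff ha.ne']; linear_combination -h3
  have h5 : r * aStar α r - 1 / (1 + mStar α r) ^ 2 = r ^ 2 * aStar α r ^ 2 * mStar α r := by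
    have h6 : 1 / (1 + mStar α r) ^ 2 = delta0 α r ^ 2 := by
      rw [div_eq_iff (by positivity)]
      linear_combination -(delta0 α r * (1 + mStar α r) + 1) * h1
    rw [h6, ← h2]
    rw [← h2] at h1
    linear_combination -(r * aStar α r) * h1
  have hT : Tn α γ d l n r = γ * (d * ((n : ℝ) ^ 2 / l ^ 2) -
      (r * aStar α r - 1 / (1 + mStar α r) ^ 2)) + ((n : ℝ) ^ 2 / l ^ 2 + (α + mStar α r)) := by
    rw [h5, Tn, h4]; ring
  have hD : Dn α d l n r = (d * ((n : ℝ) ^ 2 / l ^ 2) -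
      (r * aStar α r - 1 / (1 + mStar α r) ^ 2)) * ((n : ℝ) ^ 2 / l ^ 2 + (α + mStar α r)) -
        -(r * mStar α r) * aStar α r := by
    have h6 : α * r * (r - 1) * aStar α r = (α + mStar α r) *
        -(r ^ 2 * aStar α r ^ 2 * mStar α r) + r * mStar α r * aStar α r := by
      have h7 : mStar α r * (1 - α * r) = α * (r - 1) :=
        div_mul_cancel₀ _ (one_sub_mul_pos hα hr').ne'
      linear_combination (-(r * aStar α r)) * h7 + r ^ 2 * aStar α r * mStar α r * h3
    rw [h5, Dn, mul_div_assoc d α, h4]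
    linear_combination h6
  rw [modePoly, Matrix.det_fin_two_of, hT, hD]
  simp only [Complex.ofReal_add, Complex.ofReal_mul, Complex.ofReal_sub, C_add, C_mul, C_sub]
  ring

end Diffusion

/-! ### Stability, transversality and bifurcation at the positive equilibrium -/

section HopfPoint

variable {α γ d l : ℝ}

theorem crossesImaginaryAxis (hα : 0 < α) (hα' : α < 1) (hγ : 0 < γ) {r₀ : ℝ} (hr : 1 < r₀)
    (hr' : r₀ < α⁻¹) (h0 : halfTrace α γ r₀ = 0) (hd : deriv (halfTrace α γ) r₀ ≠ 0) :
    CrossesImaginaryAxis (halfTrace α γ) (frequency α γ) r₀ := by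
  have h := (eventually_discriminant_pos hα hα' hγ hr hr' h0).self_of_nhds.2.2
  exact ⟨contDiffAt_halfTrace hα hα' hγ hr hr', contDiffAt_frequency hα hα' hγ hr hr' h, h0,
    Real.sqrt_pos.2 h, hd⟩

theorem charpoly_fderiv_kinetics (hα : 0 < α) (hα' : α < 1) (hγ : 0 < γ) {r : ℝ} (hr : 1 < r)
    (hr' : r < α⁻¹) :
    (LinearMap.charpoly (fderiv ℝ (kinetics α γ r) (EStar α r)).toLinearMap).map (algebraMap ℝ ℂ) =
      X ^ 2 - C ((2 * halfTrace α γ r : ℝ) : ℂ) * X + C (jacobianDet α γ r : ℂ) := by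
  obtain ⟨L, hL, hLv⟩ := exists_hasFDerivAt_kinetics hα hα' hγ hr hr'
  rw [hL.fderiv, charpoly_map_eq (fun v => hLv v)]
  congr 5
  unfold halfTrace
  ring

theorem modePoly_zero_roots (hα : 0 < α) (hα' : α < 1) (hγ : 0 < γ) {r : ℝ} (hr : 1 < r)
    (hr' : r < α⁻¹) (h : 0 < jacobianDet α γ r - halfTrace α γ r ^ 2) :
    (modePoly α γ d l 0 r).roots = conjPair (halfTrace α γ r) (frequency α γ r) := by
  have h1 : modePoly α γ d l 0 r = C (γ : ℂ) *
      ((X - C ((halfTrace α γ r : ℂ) + frequency α γ r * Complex.I)) *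
        (X - C ((halfTrace α γ r : ℂ) - frequency α γ r * Complex.I))) := by
    rw [modePoly_eq hα hα' hr hr', Tn_eq _ _ hα' hγ hr, Dn_zero hα hα' hγ hr hr',
      ← quadratic_eq_mul, frequency_sq h]
    simp only [Nat.cast_zero, Complex.ofReal_mul, Complex.ofReal_sub, C_mul, C_sub]
    simp
    ring
  rw [h1, roots_C_mul _ (by exact_mod_cast hγ.ne'), roots_conjPair]

/-- Real part of the characteristic value of a nonreal pair. -/
theorem charValue_re {n : ℕ} {r : ℝ}
    (h : Tn α γ d l n r ^ 2 - 4 * γ * Dn α d l n r ≤ 0) :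
    (charValue α γ d l n r).re = -Tn α γ d l n r / (2 * γ) := by
  have h1 : ((Tn α γ d l n r ^ 2 - 4 * γ * Dn α d l n r : ℝ) : ℂ) ^ (1 / 2 : ℂ) =
      (((-(Tn α γ d l n r ^ 2 - 4 * γ * Dn α d l n r)) ^ (1 / 2 : ℝ) : ℝ) : ℂ) * Complex.I := by
    -- The principal square root of a nonpositive real is purely imaginary, so only -T_n contributes
    -- to the real part.
    rw [Complex.ofReal_cpow_of_nonpos h, Complex.ofReal_cpow (by linarith)]
    have h2 : Complex.exp (Real.pi * Complex.I * (1 / 2)) = Complex.I := by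
      rw [show (Real.pi : ℂ) * Complex.I * (1 / 2) = Real.pi / 2 * Complex.I by ring,
        Complex.exp_pi_div_two_mul_I]
    rw [h2]
    push_cast
    rfl
  have h3 : (2 * γ : ℂ) = ((2 * γ : ℝ) : ℂ) := by push_cast; rfl
  unfold charValue
  rw [h1, h3, Complex.div_ofReal_re]
  simp

theorem halfTrace_eq_zero_iff (hα : 0 < α) (hα' : α < 1) (hγ : 0 < γ) {r : ℝ} (hr : 1 < r)
    (hr' : r < α⁻¹) : halfTrace α γ r = 0 ↔ delta0 α r ^ 2 = rho0 α γ r := by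
  have h := halfTrace_eq hα hα' hγ hr hr'
  have hm := mStar_pos hα hr hr'
  constructor
  · intro h0
    rw [h0, mul_zero] at h
    exact sub_eq_zero.1 ((mul_eq_zero.1 h.symm).resolve_left hm.ne')
  · intro h0
    rw [h0, sub_self, mul_zero] at h
    linarith

/-- At a point of `hopfSet` on the critical curve the spatially constant mode is critical. -/
theorem deriv_halfTrace_ne_zero_of_mem_hopfSet (hα : 0 < α) (hα' : α < 1) (hγ : 0 < γ) {r₀ : ℝ}
    (hS : r₀ ∈ hopfSet α γ d l) (h0 : halfTrace α γ r₀ = 0) :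
    deriv (halfTrace α γ) r₀ ≠ 0 ∧
      ∀ j : ℕ, j ≠ 0 → Tn α γ d l j r₀ ≠ 0 ∧ Dn α d l j r₀ ≠ 0 := by
  obtain ⟨⟨⟨hr, hr'⟩, -⟩, n, -, -, hderiv, hne⟩ := hS
  -- The zero trace gives T₀ = 0, which is excluded for every mode but the critical one.
  have hn : n = 0 := by
    by_contra hn
    refine (hne 0 (Ne.symm hn)).1 ?_
    rw [Tn_eq _ _ hα' hγ hr, h0]
    simp
  subst hn
  refine ⟨fun hd => hderiv ?_, hne⟩
  rw [← hd]
  -- The pair stays nonreal near `r₀`, so there the real part of `charValue` is `halfTrace` itself,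
  -- not just at the point.
  refine Filter.EventuallyEq.deriv_eq ?_
  filter_upwards [eventually_discriminant_pos hα hα' hγ hr hr' h0] with r ⟨h1, h2, h3⟩
  have hT : Tn α γ d l 0 r = -(2 * γ * halfTrace α γ r) := by
    rw [Tn_eq _ _ hα' hγ h1]
    simp
  rw [charValue_re, hT]
  · field_simp
  · rw [hT, Dn_zero hα hα' hγ h1 h2]
    nlinarith [mul_pos (mul_pos hγ hγ) h3]

/-- A real quadratic with nonzero linear and constant coefficients has no imaginary root. -/
theorem modePoly_root_re_ne_zero (hα : 0 < α) (hα' : α < 1) {r : ℝ} (hr : 1 < r)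
    (hr' : r < α⁻¹) {n : ℕ} (hT : Tn α γ d l n r ≠ 0) (hD : Dn α d l n r ≠ 0) {z : ℂ}
    (hz : z ∈ (modePoly α γ d l n r).roots) : z.re ≠ 0 := by
  intro hre
  have h1 := isRoot_of_mem_roots hz
  rw [IsRoot, modePoly_eq hα hα' hr hr'] at h1
  simp only [eval_add, eval_mul, eval_C, eval_pow, eval_X] at h1
  have h2 := congrArg Complex.im h1
  have h3 := congrArg Complex.re h1
  -- At z = iy the imaginary part is T y, so y = 0, and then the real part gives D = 0.
  simp [pow_two, hre] at h2 h3
  rcases h2 with h2 | h2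
  · exact hT h2
  · rw [h2] at h3
    simp at h3
    exact hD h3

theorem isDiffusiveSolution_of_homogeneous {r : ℝ} {u : ℝ → ℝ × ℝ}
    (hu : IsIntegralCurve u fun _ => kinetics α γ r) (hpos : ∀ t, 0 < (u t).1 ∧ 0 < (u t).2) :
    IsDiffusiveSolution α γ d l r (fun _ t => (u t).1) (fun _ t => (u t).2) := by
  refine ⟨fun _ _ => 0, fun _ _ => 0, fun _ _ => 0, fun _ _ => 0, continuousOn_const,
    continuousOn_const, fun x _ t => ⟨hasDerivWithinAt_const _ _ _, hasDerivWithinAt_const _ _ _,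
      hasDerivWithinAt_const _ _ _, hasDerivWithinAt_const _ _ _, (hpos t).1, (hpos t).2, ?_, ?_⟩,
    fun _ => ⟨rfl, rfl, rfl, rfl⟩⟩
  · have h : HasDerivAt (fun t => (u t).1) _ t :=
      (ContinuousLinearMap.fst ℝ ℝ ℝ).hasFDerivAt.comp_hasDerivAt t (hu t)
    exact h.congr_deriv (by simp [kinetics])
  · have h : HasDerivAt (fun t => (u t).2) _ t :=
      (ContinuousLinearMap.snd ℝ ℝ ℝ).hasFDerivAt.comp_hasDerivAt t (hu t)
    exact h.congr_deriv (by simp [kinetics])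

theorem isHopfBifurcation_kinetics (hα : 0 < α) (hα' : α < 1) (hγ : 0 < γ) {r₀ : ℝ} (hr : 1 < r₀)
    (hr' : r₀ < α⁻¹) (h0 : halfTrace α γ r₀ = 0) (hd : deriv (halfTrace α γ) r₀ ≠ 0) :
    IsHopfBifurcation (kinetics α γ) (EStar α) r₀ := by
  obtain ⟨s₀, μ, P, u, hu, -⟩ := exists_isPeriodicBranch_kinetics hα hα' hγ hr hr' h0 hd univ_mem
  refine ⟨halfTrace α γ, frequency α γ, crossesImaginaryAxis hα hα' hγ hr hr' h0 hd, ?_,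
    s₀, μ, P, u, hu⟩
  filter_upwards [eventually_discriminant_pos hα hα' hγ hr hr' h0] with r ⟨h1, h2, h3⟩
  refine ⟨kinetics_EStar hα hα' h1 h2, ?_⟩
  rw [charpoly_fderiv_kinetics hα hα' hγ h1 h2, ← frequency_sq h3, quadratic_eq_mul,
    roots_conjPair]

theorem isHomogeneousHopfBifurcation (hα : 0 < α) (hα' : α < 1) (hγ : 0 < γ) {r₀ : ℝ}
    (hS : r₀ ∈ hopfSet α γ d l) (h0 : halfTrace α γ r₀ = 0) :
    IsHomogeneousHopfBifurcation α γ d l r₀ := by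
  obtain ⟨hd, hne⟩ := deriv_halfTrace_ne_zero_of_mem_hopfSet hα hα' hγ hS h0
  obtain ⟨⟨⟨hr, hr'⟩, -⟩, -⟩ := hS
  -- Confining the branch to the open quadrant makes its members positive.
  have hU : {q : ℝ × ℝ | 0 < q.1 ∧ 0 < q.2} ∈ 𝓝 (EStar α r₀) :=
    ((isOpen_lt continuous_const continuous_fst).inter
      (isOpen_lt continuous_const continuous_snd)).mem_nhds
        ⟨mStar_pos hα hr hr', aStar_pos hα hα' hr hr'⟩
  obtain ⟨s₀, μ, P, u, hu, huU⟩ := exists_isPeriodicBranch_kinetics hα hα' hγ hr hr' h0 hd hU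
  refine ⟨halfTrace α γ, frequency α γ, crossesImaginaryAxis hα hα' hγ hr hr' h0 hd, ?_,
    fun n hn z hz => modePoly_root_re_ne_zero hα hα' hr hr' (hne n hn).1 (hne n hn).2 hz,
    s₀, μ, P, u, hu, fun s hs => isDiffusiveSolution_of_homogeneous (hu.solves s hs) (huU s hs)⟩
  filter_upwards [eventually_discriminant_pos hα hα' hγ hr hr' h0] with r ⟨h1, h2, h3⟩
  exact modePoly_zero_roots hα hα' hγ h1 h2 h3

theorem isLocallyAsymptoticallyStable_EStar (hα : 0 < α) (hα' : α < 1) (hγ : 0 < γ) {r : ℝ}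
    (hr : 1 < r) (hr' : r < α⁻¹) (h : delta0 α r ^ 2 < rho0 α γ r) :
    IsLocallyAsymptoticallyStable (kinetics α γ r) (EStar α r) := by
  obtain ⟨L, hL, hLv⟩ := exists_hasFDerivAt_kinetics hα hα' hγ hr hr'
  have hm := mStar_pos hα hr hr'
  have h1 := mul_pos hm (sub_pos.2 h)
  have h2 := halfTrace_eq hα hα' hγ hr hr'
  refine isLocallyAsymptoticallyStable_of_trace_neg (kinetics_EStar hα hα' hr hr')
    (contDiffAt_kinetics (add_pos one_pos hm).ne') hL hLv ?_ (jacobianDet_pos hα hα' hγ hr hr')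
  unfold halfTrace at h2
  linarith

theorem isUnstable_EStar (hα : 0 < α) (hα' : α < 1) (hγ : 0 < γ) {r : ℝ}
    (hr : 1 < r) (hr' : r < α⁻¹) (h : rho0 α γ r < delta0 α r ^ 2) :
    IsUnstable (kinetics α γ r) (EStar α r) := by
  obtain ⟨L, hL, hLv⟩ := exists_hasFDerivAt_kinetics hα hα' hγ hr hr'
  have hm := mStar_pos hα hr hr'
  have h1 := mul_pos hm (sub_pos.2 h)
  have h2 := halfTrace_eq hα hα' hγ hr hr'
  refine isUnstable_of_trace_pos (kinetics_EStar hα hα' hr hr')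
    (contDiffAt_kinetics (add_pos one_pos hm).ne') hL hLv ?_ (jacobianDet_pos hα hα' hγ hr hr')
  unfold halfTrace at h2
  linarith

/-- At a Hopf bifurcation the trace vanishes. -/
theorem halfTrace_eq_zero_of_isHopfBifurcation (hα : 0 < α) (hα' : α < 1) (hγ : 0 < γ) {r₀ : ℝ}
    (hr : 1 < r₀) (hr' : r₀ < α⁻¹) (h : IsHopfBifurcation (kinetics α γ) (EStar α) r₀) :
    halfTrace α γ r₀ = 0 := by
  obtain ⟨β, ω, ⟨-, -, hβ, hω, -⟩, hroots, -⟩ := h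
  have h1 := hroots.self_of_nhds.2
  rw [charpoly_fderiv_kinetics hα hα' hγ hr hr', hβ] at h1
  have h2 : (((0 : ℝ) : ℂ) + ω r₀ * Complex.I) ∈ conjPair 0 (ω r₀) := by simp [conjPair]
  rw [← h1] at h2
  have h3 := isRoot_of_mem_roots h2
  rw [IsRoot] at h3
  simp only [eval_add, eval_sub, eval_mul, eval_C, eval_pow, eval_X] at h3
  -- At iω the imaginary part of the characteristic polynomial is -ω times the trace.
  have h4 := congrArg Complex.im h3
  simpa [pow_two, hω.ne'] using h4

end HopfPoint

end MusselAlgae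

end

theorem mainTheorem5 (α γ : ℝ) (hα : 0 < α) (hα' : α < 1) (hγ : 0 < γ) :
    (∀ r : ℝ, 1 < r → r < α⁻¹ →
      MusselAlgae.delta0 α r ^ 2 < MusselAlgae.rho0 α γ r →
        MusselAlgae.IsLocallyAsymptoticallyStable
          (MusselAlgae.kinetics α γ r) (MusselAlgae.EStar α r)) ∧
    (∀ r : ℝ, 1 < r → r < α⁻¹ →
      MusselAlgae.rho0 α γ r < MusselAlgae.delta0 α r ^ 2 →
        MusselAlgae.IsUnstable
          (MusselAlgae.kinetics α γ r) (MusselAlgae.EStar α r)) ∧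
    (∀ d l : ℝ, 0 < d → 0 < l → ∀ rH ∈ MusselAlgae.hopfSet α γ d l,
      MusselAlgae.delta0 α rH ^ 2 = MusselAlgae.rho0 α γ rH →
        MusselAlgae.IsHopfBifurcation (MusselAlgae.kinetics α γ) (MusselAlgae.EStar α) rH ∧
        MusselAlgae.IsHomogeneousHopfBifurcation α γ d l rH) ∧
    (∀ rH : ℝ, 1 < rH → rH < α⁻¹ →
      MusselAlgae.IsHopfBifurcation (MusselAlgae.kinetics α γ) (MusselAlgae.EStar α) rH →
        MusselAlgae.delta0 α rH ^ 2 = MusselAlgae.rho0 α γ rH) := by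
  refine ⟨fun r hr hr' h => MusselAlgae.isLocallyAsymptoticallyStable_EStar hα hα' hγ hr hr' h,
    fun r hr hr' h => MusselAlgae.isUnstable_EStar hα hα' hγ hr hr' h,
    fun d l _ _ rH hS h => ?_, fun rH hr hr' h => ?_⟩
  · obtain ⟨hr, hr'⟩ := hS.1.1
    have h0 := (MusselAlgae.halfTrace_eq_zero_iff hα hα' hγ hr hr').2 h
    exact ⟨MusselAlgae.isHopfBifurcation_kinetics hα hα' hγ hr hr' h0
        (MusselAlgae.deriv_halfTrace_ne_zero_of_mem_hopfSet hα hα' hγ hS h0).1,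
      MusselAlgae.isHomogeneousHopfBifurcation hα hα' hγ hS h0⟩
  · exact (MusselAlgae.halfTrace_eq_zero_iff hα hα' hγ hr hr').1
      (MusselAlgae.halfTrace_eq_zero_of_isHopfBifurcation hα hα' hγ hr hr' h)
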